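/- **Setting.** Let $\mu(t,z)$, $(t,z)\in\mathbb R^2$, be a real random field on a probability space $(\Omega,\mathcal F,\mathbb P)$: mean zero, stationary, twice continuously differentiable, with $\mu$ and its first and second order derivatives bounded by deterministic constants. Let $c_o,S,T>0$. For $\alpha,\beta\in[0,2]$, $0<\varepsilon\le 1$ and $s\in\mathbb R$ let $\mathcal W_\varepsilon(\cdot,s)$ be the random travel-time shift, that is, the unique continuous solution on $\tau\ge 0$ of $$\mathcal W_\varepsilon(\tau,s)=\frac1\varepsilon\int_0^\tau \mu\Big(\frac{u}{\varepsilon^\alpha}+\varepsilon^{2-\alpha}\big(s+\mathcal W_\varepsilon(u,s)\big),\frac{c_o u}{\varepsilon^\beta}\Big)\,du ;$$ equivalently, $t_\varepsilon(c_o\tau,s)=\tau+\varepsilon^2 s+\varepsilon^2\mathcal W_\varepsilon(\tau,s)$ is the characteristic, started at time $\varepsilon^2 s$ from $z=0$, of the right going wave with speed $c_\varepsilon(t,z)=c_o\big[1+\varepsilon\mu(t/\varepsilon^\alpha,z/\varepsilon^\beta)\big]^{-1}$. A field $X$ ($\mu$ or one of its derivatives) is called *mixing in range* if there are a deterministic constant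 $C$ and a $d>2$ with $|\mathbb E[X(t,z+\Delta z)\mid\mathcal F_z]|\le C(\Delta z)^{-d}$ almost surely, for all $t\in\mathbb R$, $z\ge 0$, $\Delta z>0$, where $\mathcal F_z$ is generated by $\mu(t',z')$, $t'\in\mathbb R$, $0\le z'\le z$. It is called *mixing in time* if the same holds with the roles of $t$ and $z$ exchanged. **Lemma.** (Regime 1.) Let $\alpha\in[0,1]$, $\beta=2$, and let $\mu$ and $\mu_t=\partial_t\mu$ be mixing in range. Then $\mathcal W_\varepsilon(\tau,s)=W_\varepsilon(\tau)+q_\varepsilon(c_o\tau,s)$ for $\tau\in[0,T]$, $s\in[0,S]$, where $$W_\varepsilon(\tau)=\frac1\varepsilon\int_0^\tau\mu\Big(\frac{u}{\varepsilon^\alpha},\frac{c_o u}{\varepsilon^2}\Big)\,du$$ does not depend on $s$, $\mathcal W_\varepsilon$ is differentiable in $s$, and there are constants $c,C>0$, independent of $\varepsilon$ and $\theta$, such that for all $\theta\in(0,2-\alpha)$ and all $\varepsilon\in(0,1]$ $$\mathbb P\Big(\sup_{s\in[0,S],\,\tau\in[0,T]}|q_\varepsilon(c_o\tau,s)|\ge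 c\,\varepsilon^{(2-\alpha-\theta)/2}\Big)\le C\varepsilon^\theta,\qquad \mathbb P\Big(\sup_{s\in[0,S],\,\tau\in[0,T]}|\partial_s\mathcal W_\varepsilon(\tau,s)|\ge c\,\varepsilon^{(2-\alpha-\theta)/2}\Big)\le C\varepsilon^\theta .$$ (Regime 2.) Let $\alpha=2$, $\beta\in[0,1]$, and let $\mu$ and $\mu_z=\partial_z\mu$ be mixing in time. Then the same conclusions hold with $\alpha$ replaced by $\beta$ in the two estimates and in the range of $\theta$, and with $$W_\varepsilon(\tau)=\frac1\varepsilon\int_0^\tau\mu\Big(\frac{u}{\varepsilon^2},\frac{c_o u}{\varepsilon^\beta}\Big)\,du-\int_0^\tau\mu^2\Big(\frac{u}{\varepsilon^2},\frac{c_o u}{\varepsilon^\beta}\Big)\,du .$$ -/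

import Mathlib

open MeasureTheory Set
open scoped ENNReal NNReal

namespace WaveFront

noncomputable section

/-! ### The random medium -/

/-- Partial derivative of a random field in its first argument (time). -/
def partialT {Ω : Type*} (μ : ℝ → ℝ → Ω → ℝ) : ℝ → ℝ → Ω → ℝ :=
  fun t z ω => deriv (fun t' => μ t' z ω) t

/-- Partial derivative of a random field in its second argument (range). -/
def partialZ {Ω : Type*} (μ : ℝ → ℝ → Ω → ℝ) : ℝ → ℝ → Ω → ℝ :=
  fun t z ω => deriv (fun z' => μ t z' ω) z

/-- A random field is bounded if a deterministic constant bounds it. -/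
def IsBoundedField {Ω : Type*} (μ : ℝ → ℝ → Ω → ℝ) : Prop :=
  ∃ K : ℝ, ∀ t z ω, |μ t z ω| ≤ K

/-- The dimensionless fluctuations `μ(t, z)` of the medium: a mean zero, (strictly) stationary,
bounded random field, twice continuously differentiable with bounded first and second order
derivatives. -/
structure IsRandomMedium {Ω : Type*} [MeasurableSpace Ω] (P : Measure Ω)
    (μ : ℝ → ℝ → Ω → ℝ) : Prop where
  measurable : ∀ t z, Measurable (μ t z)
  mean_zero : ∀ t z, ∫ ω, μ t z ω ∂P = 0
  stationary : ∀ h k : ℝ,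
    P.map (fun ω (p : ℝ × ℝ) => μ (p.1 + h) (p.2 + k) ω) =
      P.map (fun ω (p : ℝ × ℝ) => μ p.1 p.2 ω)
  contDiff : ∀ ω, ContDiff ℝ 2 (fun p : ℝ × ℝ => μ p.1 p.2 ω)
  bounded : IsBoundedField μ
  bounded_t : IsBoundedField (partialT μ)
  bounded_z : IsBoundedField (partialZ μ)
  bounded_tt : IsBoundedField (partialT (partialT μ))
  bounded_tz : IsBoundedField (partialT (partialZ μ))
  bounded_zz : IsBoundedField (partialZ (partialZ μ))

/-- `ℱ_z`, the σ-algebra generated by the medium at the ranges in `[0, z]` (at all times). -/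
@[reducible]
def rangeHistory {Ω : Type*} (μ : ℝ → ℝ → Ω → ℝ) (z : ℝ) : MeasurableSpace Ω :=
  ⨆ (t : ℝ) (z' ∈ Icc 0 z), MeasurableSpace.comap (μ t z') inferInstance

/-- The σ-algebra generated by the medium at the times in `[0, t]` (at all ranges). -/
@[reducible]
def timeHistory {Ω : Type*} (μ : ℝ → ℝ → Ω → ℝ) (t : ℝ) : MeasurableSpace Ω :=
  ⨆ (z : ℝ) (t' ∈ Icc 0 t), MeasurableSpace.comap (μ t' z) inferInstance

/-- Mixing in range of a field `X` carried by the medium `μ` (`X` is `μ` or a derivative of it):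
`|𝔼[X(t, z + Δz) | ℱ_z]| ≤ C (Δz)^{-d}` with a deterministic constant `C` and some `d > 2`. -/
def MixesInRange {Ω : Type*} [MeasurableSpace Ω] (P : Measure Ω)
    (μ X : ℝ → ℝ → Ω → ℝ) : Prop :=
  ∃ C d : ℝ, 2 < d ∧ ∀ t z Δ : ℝ, 0 ≤ z → 0 < Δ →
    ∀ᵐ ω ∂P, |condExp (rangeHistory μ z) P (X t (z + Δ)) ω| ≤ C * Δ ^ (-d)

/-- Mixing in time of a field `X` carried by the medium `μ`. -/
def MixesInTime {Ω : Type*} [MeasurableSpace Ω] (P : Measure Ω)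
    (μ X : ℝ → ℝ → Ω → ℝ) : Prop :=
  ∃ C d : ℝ, 2 < d ∧ ∀ t z Δ : ℝ, 0 ≤ t → 0 < Δ →
    ∀ᵐ ω ∂P, |condExp (timeHistory μ t) P (X (t + Δ) z) ω| ≤ C * Δ ^ (-d)

/-! ### The random travel time shift -/

/-- `w = 𝒲_ε(·, s)` solves, on `τ ≥ 0`, the equation
`w(τ) = ε⁻¹ ∫_0^τ m(u/ε^α + ε^{2-α} (s + w(u)), c₀ u/ε^β) du`
in the realization `m` of the medium. Equivalently, `t(z) = z/c₀ + ε² (s + w(z/c₀))` is the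
characteristic `t(z) = ε² s + ∫_0^z dz'/c_ε(t(z'), z')` of the wave speed
`c_ε(t, z) = c₀ / (1 + ε m(t/ε^α, z/ε^β))`. -/
def IsTravelTimeShift (m : ℝ → ℝ → ℝ) (α β c₀ ε s : ℝ) (w : ℝ → ℝ) : Prop :=
  ContinuousOn w (Ici 0) ∧ ∀ τ, 0 ≤ τ →
    w τ = 1 / ε * ∫ u in (0 : ℝ)..τ,
      m (u / ε ^ α + ε ^ (2 - α) * (s + w u)) (c₀ * u / ε ^ β)

/-- The random travel time shift `𝒲_ε(τ, s)`, `τ ≥ 0`: the solution of its integral equation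
(it exists and is unique, as shown below). -/
def travelTimeShift {Ω : Type*} (μ : ℝ → ℝ → Ω → ℝ) (α β c₀ ε τ s : ℝ) (ω : Ω) : ℝ :=
  Classical.epsilon (IsTravelTimeShift (fun t z => μ t z ω) α β c₀ ε s) τ

/-- The `s`-independent shift `W_ε(τ)` of slowly changing media (`β = 2`). -/
def slowShift {Ω : Type*} (μ : ℝ → ℝ → Ω → ℝ) (α c₀ ε τ : ℝ) (ω : Ω) : ℝ :=
  1 / ε * ∫ u in (0 : ℝ)..τ, μ (u / ε ^ α) (c₀ * u / ε ^ 2) ω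

/-- The `s`-independent shift `W_ε(τ)` of rapidly changing media (`α = 2`). -/
def rapidShift {Ω : Type*} (μ : ℝ → ℝ → Ω → ℝ) (β c₀ ε τ : ℝ) (ω : Ω) : ℝ :=
  1 / ε * (∫ u in (0 : ℝ)..τ, μ (u / ε ^ 2) (c₀ * u / ε ^ β) ω)
    - ∫ u in (0 : ℝ)..τ, (μ (u / ε ^ 2) (c₀ * u / ε ^ β) ω) ^ 2

/-- The supremum of `|f(τ, s)|` over `s ∈ [0, S]`, `τ ∈ [0, T]`, as an extended real in
`[0, ∞]`. -/
def supAbs (S T : ℝ) (f : ℝ → ℝ → ℝ) : ℝ≥0∞ :=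
  ⨆ s ∈ Icc 0 S, ⨆ τ ∈ Icc 0 T, ENNReal.ofReal |f τ s|

/-- The shift `𝒲 ε τ s ω` splits as `W ε τ ω + q ε (c₀ τ) s ω`, where the residual `q` and the
derivative `∂_s 𝒲` are small, uniformly in `s ∈ [0, S]` and `τ ∈ [0, T]`, with the rates that
belong to the exponent `γ`. The constants depend neither on `ε` nor on `θ`. -/
def SplitsWithRate {Ω : Type*} [MeasurableSpace Ω] (P : Measure Ω) (c₀ S T γ : ℝ)
    (𝒲 : ℝ → ℝ → ℝ → Ω → ℝ) (W : ℝ → ℝ → Ω → ℝ) : Prop :=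
  ∃ q : ℝ → ℝ → ℝ → Ω → ℝ,
    (∀ ε ∈ Ioc (0 : ℝ) 1, ∀ τ ∈ Icc 0 T, ∀ s ∈ Icc 0 S, ∀ ω,
      𝒲 ε τ s ω = W ε τ ω + q ε (c₀ * τ) s ω ∧
        DifferentiableAt ℝ (fun s' => 𝒲 ε τ s' ω) s) ∧
    ∃ c C : ℝ, 0 < c ∧ 0 < C ∧ ∀ θ ∈ Ioo 0 (2 - γ), ∀ ε ∈ Ioc (0 : ℝ) 1,
      P {ω | ENNReal.ofReal (c * ε ^ ((2 - γ - θ) / 2)) ≤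
          supAbs S T (fun τ s => q ε (c₀ * τ) s ω)} ≤ ENNReal.ofReal (C * ε ^ θ) ∧
      P {ω | ENNReal.ofReal (c * ε ^ ((2 - γ - θ) / 2)) ≤
          supAbs S T (fun τ s => deriv (fun s' => 𝒲 ε τ s' ω) s)} ≤
        ENNReal.ofReal (C * ε ^ θ)

/-! ### Existence and uniqueness of the travel time shift -/

theorem integral_solution_unique {G : ℝ → ℝ → ℝ} (hG : Continuous (Function.uncurry G))
    {K : ℝ≥0} (hK : ∀ u, LipschitzWith K (G u)) {b : ℝ} {v w : ℝ → ℝ}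
    (hv : ContinuousOn v (Icc 0 b)) (hw : ContinuousOn w (Icc 0 b))
    (hv' : ∀ τ ∈ Icc 0 b, v τ = ∫ u in (0 : ℝ)..τ, G u (v u))
    (hw' : ∀ τ ∈ Icc 0 b, w τ = ∫ u in (0 : ℝ)..τ, G u (w u)) : EqOn v w (Icc 0 b) := by
  rcases lt_or_ge b 0 with hb | hb
  · rw [Icc_eq_empty (not_le.2 hb)]; exact eqOn_empty _ _
  have key : ∀ f : ℝ → ℝ, ContinuousOn f (Icc 0 b) →
      (∀ τ ∈ Icc 0 b, f τ = ∫ u in (0 : ℝ)..τ, G u (f u)) →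
      ∀ t ∈ Ico 0 b, HasDerivWithinAt f (G t (f t)) (Ici t) t := by
    intro f hf hf' t ht
    have hc : ContinuousOn (fun u => G u (f u)) (Icc 0 b) :=
      hG.comp_continuousOn (continuousOn_id.prodMk hf)
    have hct : ContinuousOn (fun u => G u (f u)) (Icc t b) :=
      hc.mono (Icc_subset_Icc_left ht.1)
    have hnhds : Icc t b ∈ nhdsWithin t (Ici t) := Icc_mem_nhdsGE ht.2
    have hint : IntervalIntegrable (fun u => G u (f u)) volume 0 t :=
      ContinuousOn.intervalIntegrable_of_Icc ht.1 (hc.mono (Icc_subset_Icc_right ht.2.le))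
    have hd : HasDerivWithinAt (fun τ => ∫ u in (0 : ℝ)..τ, G u (f u)) (G t (f t)) (Ici t) t := by
      refine intervalIntegral.integral_hasDerivWithinAt_right hint
        (t := Ioi t) ?_ ?_
      · refine ⟨Icc t b, nhdsWithin_mono _ Ioi_subset_Ici_self hnhds, ?_⟩
        exact hct.aestronglyMeasurable measurableSet_Icc
      · exact ((hct t ⟨le_rfl, ht.2.le⟩).mono_of_mem_nhdsWithin hnhds).mono Ioi_subset_Ici_self
    refine hd.congr_of_eventuallyEq ?_ (hf' t ⟨ht.1, ht.2.le⟩)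
    filter_upwards [hnhds] with x hx
    exact hf' x ⟨ht.1.trans hx.1, hx.2⟩
  refine ODE_solution_unique (v := G) hK hv (key v hv hv') hw (key w hw hw') ?_
  rw [hv' 0 ⟨le_rfl, hb⟩, hw' 0 ⟨le_rfl, hb⟩]; simp

theorem integral_solution_exists {G : ℝ → ℝ → ℝ} (hG : Continuous (Function.uncurry G))
    {K L : ℝ≥0} (hK : ∀ u, LipschitzWith K (G u)) (hL : ∀ u y, |G u y| ≤ L) :
    ∃ w : ℝ → ℝ, ContinuousOn w (Ici 0) ∧
      ∀ τ, 0 ≤ τ → w τ = ∫ u in (0 : ℝ)..τ, G u (w u) := by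
  have hloc : ∀ n : ℕ, ∃ f : ℝ → ℝ, ContinuousOn f (Icc 0 (n : ℝ)) ∧
      ∀ τ ∈ Icc 0 (n : ℝ), f τ = ∫ u in (0 : ℝ)..τ, G u (f u) := by
    intro n
    have hpl : IsPicardLindelof G (tmin := 0) (tmax := n) ⟨0, le_rfl, n.cast_nonneg⟩ 0
        (L * n) 0 L K := by
      refine ⟨fun t _ => (hK t).lipschitzOnWith, fun x _ => ?_, fun t _ x _ => ?_, ?_⟩
      · exact (hG.comp (continuous_id.prodMk continuous_const)).continuousOn
      · simpa using hL t x
      · simp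
    obtain ⟨f, hf0, hf⟩ := hpl.exists_eq_forall_mem_Icc_hasDerivWithinAt₀
    have hfc : ContinuousOn f (Icc 0 (n : ℝ)) := fun t ht => (hf t ht).continuousWithinAt
    refine ⟨f, hfc, fun τ hτ => ?_⟩
    have hsub : Icc 0 τ ⊆ Icc 0 (n : ℝ) := Icc_subset_Icc_right hτ.2
    have hc : ContinuousOn (fun u => G u (f u)) (Icc 0 τ) :=
      hG.comp_continuousOn (continuousOn_id.prodMk (hfc.mono hsub))
    rw [intervalIntegral.integral_eq_sub_of_hasDeriv_right_of_le hτ.1 (hfc.mono hsub)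
      (f' := fun u => G u (f u)) ?_ (ContinuousOn.intervalIntegrable_of_Icc hτ.1 hc)]
    · simp at hf0
      simp [hf0]
    · intro x hx
      have hx' : x ∈ Ioo 0 (n : ℝ) := ⟨hx.1, hx.2.trans_le hτ.2⟩
      exact ((hf x (Ioo_subset_Icc_self hx')).hasDerivAt
        (Icc_mem_nhds hx'.1 hx'.2)).hasDerivWithinAt
  choose f hfc hf using hloc
  have hagree : ∀ n k : ℕ, n ≤ k → EqOn (f n) (f k) (Icc 0 (n : ℝ)) := fun n k hnk => by
    have hsub : Icc 0 (n : ℝ) ⊆ Icc 0 (k : ℝ) := Icc_subset_Icc_right (by exact_mod_cast hnk)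
    exact integral_solution_unique hG hK (hfc n) ((hfc k).mono hsub) (hf n)
      fun τ hτ => hf k τ (hsub hτ)
  let w : ℝ → ℝ := fun τ => f ⌈τ⌉₊ τ
  have hw : ∀ n : ℕ, EqOn w (f n) (Icc 0 (n : ℝ)) := fun n τ hτ =>
    hagree _ _ (Nat.ceil_le.2 hτ.2) ⟨hτ.1, Nat.le_ceil τ⟩
  refine ⟨w, fun τ hτ => ?_, fun τ hτ => ?_⟩
  · have hn : τ < ((⌈τ⌉₊ + 1 : ℕ) : ℝ) := by
      push_cast; exact (Nat.le_ceil τ).trans_lt (lt_add_one _)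
    have hc : ContinuousWithinAt w (Icc 0 ((⌈τ⌉₊ + 1 : ℕ) : ℝ)) τ :=
      ((hfc _).congr (hw _)) τ ⟨hτ, hn.le⟩
    refine hc.mono_of_mem_nhdsWithin ?_
    rw [← Ici_inter_Iic]
    exact Filter.inter_mem self_mem_nhdsWithin (mem_nhdsWithin_of_mem_nhds (Iic_mem_nhds hn))
  · have hτ' : τ ∈ Icc 0 ((⌈τ⌉₊ : ℕ) : ℝ) := ⟨hτ, Nat.le_ceil τ⟩
    rw [hw _ hτ', hf _ τ hτ']
    refine intervalIntegral.integral_congr fun u hu => ?_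
    rw [uIcc_of_le hτ] at hu
    simp only [hw ⌈τ⌉₊ ⟨hu.1, hu.2.trans hτ'.2⟩]

/-- The right hand side of the equation of the travel time shift, as a vector field. -/
theorem shift_field_regular {Ω : Type*} [MeasurableSpace Ω] {P : Measure Ω}
    {μ : ℝ → ℝ → Ω → ℝ} (hμ : IsRandomMedium P μ) (α β c₀ ε s : ℝ) (ω : Ω) :
    ∃ K L : ℝ≥0,
      Continuous (Function.uncurry fun u y : ℝ =>
        1 / ε * μ (u / ε ^ α + ε ^ (2 - α) * (s + y)) (c₀ * u / ε ^ β) ω) ∧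
      (∀ u, LipschitzWith K fun y : ℝ =>
        1 / ε * μ (u / ε ^ α + ε ^ (2 - α) * (s + y)) (c₀ * u / ε ^ β) ω) ∧
      ∀ u y : ℝ, |1 / ε * μ (u / ε ^ α + ε ^ (2 - α) * (s + y)) (c₀ * u / ε ^ β) ω| ≤ L := by
  obtain ⟨A, hA⟩ := hμ.bounded
  obtain ⟨B, hB⟩ := hμ.bounded_t
  have hlip : ∀ z, LipschitzWith B.toNNReal fun t => μ t z ω := fun z => by
    refine lipschitzWith_of_nnnorm_deriv_le ?_ fun t => ?_
    · have h := (hμ.contDiff ω).differentiable (by norm_num)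
      exact h.comp (differentiable_id.prodMk (differentiable_const z))
    · rw [← NNReal.coe_le_coe]
      exact (hB t z ω).trans (Real.le_coe_toNNReal B)
  refine ⟨‖1 / ε‖₊ * (B.toNNReal * ‖ε ^ (2 - α)‖₊), ‖1 / ε‖₊ * A.toNNReal, ?_, fun u => ?_,
    fun u y => ?_⟩
  · have h := (hμ.contDiff ω).continuous
    have h2 : Continuous fun p : ℝ × ℝ =>
        ((p.1 / ε ^ α + ε ^ (2 - α) * (s + p.2), c₀ * p.1 / ε ^ β) : ℝ × ℝ) := by fun_prop
    exact continuous_const.mul (h.comp h2)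
  · refine LipschitzWith.of_dist_le_mul fun x y => ?_
    have h := (hlip (c₀ * u / ε ^ β)).dist_le_mul (u / ε ^ α + ε ^ (2 - α) * (s + x))
      (u / ε ^ α + ε ^ (2 - α) * (s + y))
    rw [Real.dist_eq, ← mul_sub, abs_mul, ← Real.dist_eq]
    have h3 : dist (u / ε ^ α + ε ^ (2 - α) * (s + x)) (u / ε ^ α + ε ^ (2 - α) * (s + y)) =
        |ε ^ (2 - α)| * dist x y := by
      rw [Real.dist_eq, Real.dist_eq, ← abs_mul]; ring_nf
    rw [h3] at h
    calc _ ≤ |1 / ε| * (B.toNNReal * (|ε ^ (2 - α)| * dist x y)) :=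
          mul_le_mul_of_nonneg_left h (abs_nonneg _)
      _ = _ := by push_cast; simp only [Real.norm_eq_abs]; ring
  · rw [abs_mul]
    push_cast
    exact mul_le_mul_of_nonneg_left ((hA _ _ ω).trans (Real.le_coe_toNNReal A)) (abs_nonneg _)

/-- `𝒲_ε(·, s)` solves its equation. -/
theorem isTravelTimeShift_travelTimeShift {Ω : Type*} [MeasurableSpace Ω] {P : Measure Ω}
    {μ : ℝ → ℝ → Ω → ℝ} (hμ : IsRandomMedium P μ) (α β c₀ ε s : ℝ) (ω : Ω) :
    IsTravelTimeShift (fun t z => μ t z ω) α β c₀ ε s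
      (fun τ => travelTimeShift μ α β c₀ ε τ s ω) := by
  obtain ⟨K, L, hc, hK, hL⟩ := shift_field_regular hμ α β c₀ ε s ω
  obtain ⟨w, hw, hw'⟩ := integral_solution_exists hc hK hL
  refine Classical.epsilon_spec (p := IsTravelTimeShift (fun t z => μ t z ω) α β c₀ ε s)
    ⟨w, hw, fun τ hτ => ?_⟩
  rw [hw' τ hτ, intervalIntegral.integral_const_mul]

/-- `𝒲_ε(·, s)` is the only solution of its equation. -/
theorem IsTravelTimeShift.eq_travelTimeShift {Ω : Type*} [MeasurableSpace Ω] {P : Measure Ω}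
    {μ : ℝ → ℝ → Ω → ℝ} (hμ : IsRandomMedium P μ) {α β c₀ ε s : ℝ} {ω : Ω} {w : ℝ → ℝ}
    (hw : IsTravelTimeShift (fun t z => μ t z ω) α β c₀ ε s w) {τ : ℝ} (hτ : 0 ≤ τ) :
    w τ = travelTimeShift μ α β c₀ ε τ s ω := by
  obtain ⟨K, L, hc, hK, hL⟩ := shift_field_regular hμ α β c₀ ε s ω
  have hv := isTravelTimeShift_travelTimeShift hμ α β c₀ ε s ω
  refine integral_solution_unique hc hK (hw.1.mono Icc_subset_Ici_self)
    (hv.1.mono Icc_subset_Ici_self) (fun x hx => ?_) (fun x hx => ?_) (⟨hτ, le_rfl⟩ : τ ∈ Icc 0 τ)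
  · rw [hw.2 x hx.1, intervalIntegral.integral_const_mul]
  · rw [intervalIntegral.integral_const_mul]; exact hv.2 x hx.1

end

end WaveFront

/-!
Both regimes concern an equation `y' = ε⁻¹ f(u, ε κ (s + y))` with `κ = ε ^ (1 - γ)`, whose driving
field depends on a fast variable, in which it decorrelates on the scale `ε ^ 2` of `u`, and on a
slow variable, the only one that the shift `s + y` perturbs. With `f₀` the unperturbed field and
`f₁` its derivative in the slow variable, put
`W(τ) = ε⁻¹ ∫₀^τ f₀`, `M(τ) = ∫₀^τ f₁`, `Y(τ) = ∫₀^τ W f₁`.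

*Probability.* Up to an event of probability `C / r ^ 2`, uniformly in `τ`, one has `|W| ≤ C r`,
`|M| ≤ C r ε` and `|Y| ≤ C r √ε` (`exists_measure_not_hasIntegralBounds_le`). Cut the time interval
into blocks that are longer than `ε ^ 2`. The integral over a block, minus its conditional mean
given the past, is a martingale difference, of variance `O(ε ^ 2)` times the length of the block,
and the conditional mean is `O(ε ^ 2)` (`IsMixing.integral_mul_sq_integral_le`,
`IsMixing.abs_condExp_integral_le`); Doob's maximal inequality for the squared martingale
does the rest. For `Y` the factor `W` is frozen at the start of each block.

*Analysis.* On such an event everything is deterministic. The residual `q = y - W` is `O(r)` by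
Gronwall. Since `q' = κ (s + W + q) f₁ + O(ε κ ^ 2 r ^ 2)`, the function
`q - κ (s M + Y + q M)` has a derivative of size `ε κ r ^ 2 = b ^ 2 r ^ 2` with
`b = ε ^ ((2 - γ) / 2)`, whence `q = O(b r + b ^ 2 r ^ 2)` (`exists_shift_error_le`). This bound is
uniform in `s`, as `W`, `M` and `Y` do not depend on `s`. With `r = ε ^ (-θ / 2)` one has `b r ≤ 1`,
and both rates follow (`splitsWithRate_of_events`).

If the range is the fast variable (`β = 2`), this applies as it stands (`exists_slow_shift_bounds`).
If time is (`α = 2`), the fast argument is `v(u) / ε ^ 2` with `v(u) = u + ε ^ 2 (s + y)`, so the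
comparison is made along the path `v` instead of `u`. As `v' = 1 + ε μ`, the identity
`y' = ε⁻¹ μ = v' ε⁻¹ μ - μ ^ 2` is where the term `-∫ μ ^ 2` comes from
(`exists_rapid_shift_bounds`).

The derivative satisfies `1 + ∂_s 𝒲 = exp I`, where `I` is the integral along the solution of the
derivative of the right hand side (`hasDerivAt_flow`). In slowly changing media `I` is close to
`κ M`. In rapidly changing media it involves `ε⁻¹ μ_t`, about which no mixing is assumed, but this
is the derivative of `log (1 + ε μ)` along the characteristic, up to a term in `κ μ_z`.
-/

namespace WaveFront

/-! ### A maximal inequality for orthogonal sums -/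

section Mixing

variable {Ω : Type*} [m : MeasurableSpace Ω]

/-- Kolmogorov's maximal inequality for a sum of martingale differences, from Doob's inequality for
the submartingale of its squares. -/
theorem maximal_ineq_orthogonal_sum {P : Measure Ω} [IsProbabilityMeasure P]
    {𝒢 : Filtration ℕ m} {X : ℕ → Ω → ℝ} (hX : ∀ k, StronglyMeasurable[𝒢 (k + 1)] (X k))
    (hX2 : ∀ k, MemLp (X k) 2 P) (h0 : ∀ k, P[X k | 𝒢 k] =ᵐ[P] 0) {V : ℝ}
    {N : ℕ} (hV : ∀ k < N, ∫ ω, X k ω ^ 2 ∂P ≤ V) {r : ℝ} (hr : 0 < r) :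
    P {ω | ∃ n ≤ N, r ≤ |∑ k ∈ Finset.range n, X k ω|} ≤ ENNReal.ofReal (N * V / r ^ 2) := by
  set S : ℕ → Ω → ℝ := fun n ω => ∑ k ∈ Finset.range n, X k ω with hS
  have hSs : ∀ n ω, S (n + 1) ω = S n ω + X n ω := fun n ω => Finset.sum_range_succ _ _
  have hSm : ∀ n, StronglyMeasurable[𝒢 n] (S n) := by
    intro n
    refine Finset.stronglyMeasurable_fun_sum _ fun k hk => (hX k).mono (𝒢.mono ?_)
    exact Finset.mem_range.1 hk
  have hS2 : ∀ n, MemLp (S n) 2 P := fun n => memLp_finsetSum _ fun k _ => hX2 k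
  have hSX : ∀ n, Integrable (fun ω => S n ω * X n ω) P := fun n =>
    (hS2 n).integrable_mul (hX2 n)
  have hXi : ∀ n, Integrable (X n) P := fun n => (hX2 n).integrable one_le_two
  have hc : ∀ n, P[fun ω => S n ω * X n ω | 𝒢 n] =ᵐ[P] 0 := by
    intro n
    refine (condExp_mul_of_stronglyMeasurable_left (hSm n) (hSX n) (hXi n)).trans ?_
    filter_upwards [h0 n] with ω hω
    simp [hω]
  have hsub : Submartingale (fun n ω => S n ω ^ 2) 𝒢 P := by
    refine submartingale_nat (fun n => (hSm n).pow 2) (fun n => (hS2 n).integrable_sq) fun n => ?_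
    have h1 : P[fun ω => S n ω ^ 2 + 2 * (S n ω * X n ω) | 𝒢 n] ≤ᵐ[P]
        P[fun ω => S (n + 1) ω ^ 2 | 𝒢 n] := by
      refine condExp_mono ((hS2 n).integrable_sq.add ((hSX n).const_mul 2))
        (hS2 (n + 1)).integrable_sq (ae_of_all _ fun ω => ?_)
      simp only [hSs]
      nlinarith [sq_nonneg (X n ω)]
    have h2 : P[fun ω => S n ω ^ 2 + 2 * (S n ω * X n ω) | 𝒢 n] =ᵐ[P]
        P[fun ω => S n ω ^ 2 | 𝒢 n] + P[fun ω => 2 * (S n ω * X n ω) | 𝒢 n] :=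
      condExp_add ((hS2 n).integrable_sq) ((hSX n).const_mul 2) _
    have h3 : P[fun ω => S n ω ^ 2 | 𝒢 n] = fun ω => S n ω ^ 2 :=
      condExp_of_stronglyMeasurable (𝒢.le n) ((hSm n).pow 2) (hS2 n).integrable_sq
    have h4 : P[fun ω => 2 * (S n ω * X n ω) | 𝒢 n] =ᵐ[P]
        (2 : ℝ) • P[fun ω => S n ω * X n ω | 𝒢 n] :=
      condExp_smul (2 : ℝ) (fun ω => S n ω * X n ω) _
    filter_upwards [h1, h2, h4, hc n] with ω g1 g2 g4 g5
    rw [g2, Pi.add_apply, h3, g4, Pi.smul_apply, g5] at g1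
    simpa using g1
  have hE : ∀ n ≤ N, ∫ ω, S n ω ^ 2 ∂P ≤ n * V := by
    intro n hn
    induction n with
    | zero => simp [hS]
    | succ n ih =>
      have h1 : ∀ ω, S (n + 1) ω ^ 2 = S n ω ^ 2 + 2 * (S n ω * X n ω) + X n ω ^ 2 := fun ω => by
        rw [hSs]; ring
      have h2 : ∫ ω, S n ω * X n ω ∂P = 0 := by
        rw [← integral_condExp (𝒢.le n), integral_congr_ae (hc n)]; simp
      have i1 : Integrable (fun ω => S n ω ^ 2 + 2 * (S n ω * X n ω)) P :=
        (hS2 n).integrable_sq.add ((hSX n).const_mul 2)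
      simp_rw [h1]
      rw [integral_add i1 (hX2 n).integrable_sq,
        integral_add (hS2 n).integrable_sq ((hSX n).const_mul 2), integral_const_mul, h2]
      push_cast
      linarith [hV n hn, ih (Nat.le_of_succ_le hn)]
  have hmax := maximal_ineq hsub (fun n ω => sq_nonneg (S n ω)) (ε := (r ^ 2).toNNReal) N
  set A : Set Ω := {ω | (((r ^ 2).toNNReal : ℝ≥0) : ℝ) ≤
    (Finset.range (N + 1)).sup' Finset.nonempty_range_add_one fun k => S k ω ^ 2} with hA
  have hsubset : {ω | ∃ n ≤ N, r ≤ |∑ k ∈ Finset.range n, X k ω|} ⊆ A := by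
    rintro ω ⟨n, hn, hrn⟩
    rw [hA, mem_ofPred_eq, Real.coe_toNNReal _ (sq_nonneg r)]
    refine le_trans ?_ (Finset.le_sup' (fun k => S k ω ^ 2) (Finset.mem_range_succ_iff.2 hn))
    exact sq_le_sq' (by linarith [abs_nonneg (S n ω)]) hrn |>.trans_eq (sq_abs (S n ω))
  have hI : ∫ ω in A, S N ω ^ 2 ∂P ≤ N * V :=
    (setIntegral_le_integral (hS2 N).integrable_sq
      (ae_of_all _ fun ω => sq_nonneg (S N ω))).trans (hE N le_rfl)
  have hr2 : 0 < r ^ 2 := by positivity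
  have hfin : ENNReal.ofReal (r ^ 2) * P A ≤ ENNReal.ofReal (N * V) :=
    hmax.trans (ENNReal.ofReal_le_ofReal hI)
  calc _ ≤ P A := measure_mono hsubset
    _ ≤ ENNReal.ofReal (N * V) / ENNReal.ofReal (r ^ 2) := by
        rw [ENNReal.le_div_iff_mul_le (Or.inl (by simpa using hr2.ne'))
          (Or.inl ENNReal.ofReal_ne_top), mul_comm]
        exact hfin
    _ = _ := (ENNReal.ofReal_div_of_pos hr2).symm

end Mixing

/-! ### Mixing processes -/

section Mixing

variable {Ω : Type*} [m : MeasurableSpace Ω]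

theorem measurable_intervalIntegral_of_continuous {f : ℝ → Ω → ℝ} (hfm : ∀ u, Measurable (f u))
    (hfc : ∀ ω, Continuous fun u => f u ω) (a b : ℝ) :
    Measurable fun ω => ∫ u in a..b, f u ω := by
  have h : StronglyMeasurable (Function.uncurry f) :=
    (measurable_uncurry_of_continuous_of_measurable hfc hfm).stronglyMeasurable
  have h2 : StronglyMeasurable (Function.uncurry fun (ω : Ω) (u : ℝ) => f u ω) :=
    h.comp_measurable measurable_swap
  simp only [intervalIntegral]
  exact ((h2.integral_prod_right (ν := volume.restrict (Ioc a b))).sub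
    (h2.integral_prod_right (ν := volume.restrict (Ioc b a)))).measurable

theorem integral_mul_intervalIntegral {P : Measure Ω} [IsProbabilityMeasure P] {f : ℝ → Ω → ℝ}
    (hfm : ∀ u, Measurable (f u)) (hfc : ∀ ω, Continuous fun u => f u ω) {K a b : ℝ} (hab : a ≤ b)
    (hK : ∀ u ∈ Icc a b, ∀ ω, |f u ω| ≤ K) {Z : Ω → ℝ} (hZ : Measurable Z) {B : ℝ}
    (hB : ∀ ω, |Z ω| ≤ B) :
    ∫ ω, Z ω * (∫ u in a..b, f u ω) ∂P = ∫ u in a..b, ∫ ω, Z ω * f u ω ∂P := by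
  have h : Measurable (Function.uncurry f) :=
    measurable_uncurry_of_continuous_of_measurable hfc hfm
  have hm : Measurable (Function.uncurry fun (ω : Ω) (u : ℝ) => Z ω * f u ω) :=
    (hZ.comp measurable_fst).mul (h.comp measurable_swap)
  have hi : Integrable (Function.uncurry fun (ω : Ω) (u : ℝ) => Z ω * f u ω)
      (P.prod (volume.restrict (Ioc a b))) := by
    refine Integrable.of_bound hm.aestronglyMeasurable (B * K) ?_
    have h1 : ∀ᵐ u ∂(volume.restrict (Ioc a b)), u ∈ Ioc a b := ae_restrict_mem measurableSet_Ioc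
    filter_upwards [Measure.quasiMeasurePreserving_snd.ae h1] with p hp
    simp only [Function.uncurry, Real.norm_eq_abs, abs_mul]
    exact mul_le_mul (hB _) (hK _ (Ioc_subset_Icc_self hp) _) (abs_nonneg _)
      ((abs_nonneg _).trans (hB p.1))
  simp_rw [intervalIntegral.integral_of_le hab, ← integral_const_mul]
  exact integral_integral_swap hi

/-- A bounded process with continuous paths, adapted to `ℱ` on `[0, ∞)`, whose conditional mean
given the past decays on the time scale `η`. The profile `η² / (η + x)²` of the decay is a smooth,
integrable majorant, up to a constant factor, of both the trivial bound for `x ≤ η` and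
`(x / η)⁻²` for `x ≥ η`. -/
structure IsMixing (P : Measure Ω) (ℱ : Filtration ℝ m) (η K : ℝ) (g : ℝ → Ω → ℝ) :
    Prop where
  measurable : ∀ u, Measurable (g u)
  adapted : ∀ u, 0 ≤ u → Measurable[ℱ u] (g u)
  continuous : ∀ ω, Continuous fun u => g u ω
  bound : ∀ u ω, |g u ω| ≤ K
  mixing : ∀ u x, 0 ≤ u → 0 < x →
    ∀ᵐ ω ∂P, |(P[g (u + x) | ℱ u]) ω| ≤ K * (η ^ 2 / (η + x) ^ 2)

theorem integral_decay_le {η K t r : ℝ} (hη : 0 < η) (hK : 0 ≤ K) (htr : t ≤ r) :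
    IntervalIntegrable (fun u => K * (η ^ 2 / (η + (r - u)) ^ 2)) volume t r ∧
    ∫ u in t..r, K * (η ^ 2 / (η + (r - u)) ^ 2) ≤ K * η := by
  have hd : ∀ u ∈ uIcc t r, HasDerivAt (fun u => K * (η ^ 2 / (η + (r - u))))
      (K * (η ^ 2 / (η + (r - u)) ^ 2)) u := by
    intro u hu
    rw [uIcc_of_le htr] at hu
    have h0 : η + (r - u) ≠ 0 := by linarith [hu.2]
    have h1 : HasDerivAt (fun u => η + (r - u)) (-1) u :=
      ((hasDerivAt_id u).const_sub r).const_add η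
    have h2 := ((hasDerivAt_const u (η ^ 2)).div h1 h0).const_mul K
    refine h2.congr_deriv ?_
    simp
  have hc : IntervalIntegrable (fun u => K * (η ^ 2 / (η + (r - u)) ^ 2)) volume t r := by
    refine ContinuousOn.intervalIntegrable_of_Icc htr ?_
    refine continuousOn_const.mul (continuousOn_const.div (by fun_prop) fun u hu => ?_)
    have : 0 < η + (r - u) := by linarith [hu.2]
    positivity
  refine ⟨hc, ?_⟩
  rw [intervalIntegral.integral_eq_sub_of_hasDerivAt hd hc]
  have h1 : 0 < η + (r - t) := by linarith
  have h2 : 0 ≤ K * (η ^ 2 / (η + (r - t))) := by positivity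
  have h3 : K * (η ^ 2 / (η + (r - r))) = K * η := by rw [sub_self, add_zero, sq, mul_self_div_self]
  linarith

namespace IsMixing

variable {P : Measure Ω} {ℱ : Filtration ℝ m} {η K : ℝ} {g : ℝ → Ω → ℝ}

theorem abs_integral_le (hg : IsMixing P ℱ η K g) (ω : Ω) {a b : ℝ} (hab : a ≤ b) :
    |∫ u in a..b, g u ω| ≤ K * (b - a) := by
  have h := intervalIntegral.norm_integral_le_of_norm_le_const (a := a) (b := b) (C := K)
    (f := fun u => g u ω) fun x _ => hg.bound x ω
  rwa [abs_of_nonneg (sub_nonneg.2 hab)] at h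

theorem measurable_integral (hg : IsMixing P ℱ η K g) {a b : ℝ} (ha : 0 ≤ a) (hab : a ≤ b) :
    Measurable[ℱ b] fun ω => ∫ u in a..b, g u ω := by
  -- stopping the time argument at `a` and `b` makes the whole path `ℱ b`-measurable
  have h : ∀ ω, ∫ u in a..b, g u ω = ∫ u in a..b, g (max a (min u b)) ω := fun ω =>
    intervalIntegral.integral_congr fun u hu => by
      rw [uIcc_of_le hab] at hu
      simp [min_eq_left hu.2, max_eq_right hu.1]
  simp_rw [h]
  refine @measurable_intervalIntegral_of_continuous Ω (ℱ b) (fun u => g (max a (min u b)))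
    (fun u => ?_) (fun ω => (hg.continuous ω).comp (by fun_prop)) a b
  exact (hg.adapted _ (ha.trans (le_max_left _ _))).mono (ℱ.mono (max_le hab (min_le_right _ _)))
    le_rfl

variable [IsProbabilityMeasure P]

theorem nonneg (hg : IsMixing P ℱ η K g) : 0 ≤ K := by
  obtain ⟨ω⟩ := P.nonempty_of_neZero
  exact (abs_nonneg _).trans (hg.bound 0 ω)

/-- Pulling a factor that is known at time `t` out of the conditional expectation transfers the
decay of the conditional mean to the correlation with that factor. -/
theorem abs_integral_mul_le (hg : IsMixing P ℱ η K g) {t r : ℝ} (ht : 0 ≤ t) (htr : t < r)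
    {Z : Ω → ℝ} (hZ : Measurable[ℱ t] Z) {B : ℝ} (hB : ∀ ω, |Z ω| ≤ B) :
    |∫ ω, Z ω * g r ω ∂P| ≤ (∫ ω, |Z ω| ∂P) * (K * (η ^ 2 / (η + (r - t)) ^ 2)) := by
  have hZm : Measurable Z := hZ.mono (ℱ.le t) le_rfl
  have hZi : Integrable Z P := Integrable.of_bound hZm.aestronglyMeasurable B (ae_of_all _ hB)
  have hgi : Integrable (g r) P :=
    Integrable.of_bound (hg.measurable r).aestronglyMeasurable K (ae_of_all _ (hg.bound r))
  have hZg : Integrable (Z * g r) P :=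
    hgi.bdd_mul hZm.aestronglyMeasurable (ae_of_all _ hB)
  have h1 : P[Z * g r | ℱ t] =ᵐ[P] Z * P[g r | ℱ t] :=
    condExp_mul_of_stronglyMeasurable_left hZ.stronglyMeasurable hZg hgi
  have h2 : ∫ ω, Z ω * g r ω ∂P = ∫ ω, (P[Z * g r | ℱ t]) ω ∂P :=
    (integral_condExp (ℱ.le t)).symm
  rw [h2, ← integral_mul_const, ← Real.norm_eq_abs]
  refine norm_integral_le_of_norm_le (hZi.abs.mul_const _) ?_
  have hmix := hg.mixing t (r - t) ht (sub_pos.2 htr)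
  rw [add_sub_cancel] at hmix
  filter_upwards [h1, hmix] with ω e1 e2
  rw [e1, Pi.mul_apply, Real.norm_eq_abs, abs_mul]
  exact mul_le_mul_of_nonneg_left e2 (abs_nonneg _)

theorem abs_integral_mul_integral_le (hg : IsMixing P ℱ η K g) (hη : 0 < η) {t r : ℝ}
    (ht : 0 ≤ t) (htr : t ≤ r) {Z : Ω → ℝ} (hZ : Measurable[ℱ t] Z) {B : ℝ}
    (hB : ∀ ω, |Z ω| ≤ B) :
    |∫ ω, Z ω * (∫ u in t..r, g u ω) ∂P| ≤ (∫ ω, |Z ω| ∂P) * (K * η) := by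
  have hZm : Measurable Z := hZ.mono (ℱ.le t) le_rfl
  have hE : 0 ≤ ∫ ω, |Z ω| ∂P := integral_nonneg fun ω => abs_nonneg _
  rw [integral_mul_intervalIntegral hg.measurable hg.continuous htr (fun u _ => hg.bound u) hZm hB]
  -- the substitution `u ↦ t + r - u` turns the decay in `u - t` into one in `r - u`
  have hdec := integral_decay_le hη hg.nonneg htr
  have hint : IntervalIntegrable (fun u => K * (η ^ 2 / (η + (u - t)) ^ 2)) volume t r := by
    have := hdec.1.comp_sub_left (t + r)
    simp only [add_sub_cancel_left, add_sub_cancel_right] at this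
    refine (this.symm).congr ?_
    intro u _
    ring_nf
  have hval : ∫ u in t..r, K * (η ^ 2 / (η + (u - t)) ^ 2) ≤ K * η := by
    refine le_of_eq_of_le ?_ hdec.2
    have := intervalIntegral.integral_comp_sub_left (a := t) (b := r)
      (fun u => K * (η ^ 2 / (η + (u - t)) ^ 2)) (t + r)
    simp only [add_sub_cancel_left, add_sub_cancel_right] at this
    rw [← this]
    refine intervalIntegral.integral_congr fun u _ => ?_
    ring_nf
  rw [← Real.norm_eq_abs]
  refine (intervalIntegral.norm_integral_le_of_norm_le htr (ae_of_all _ fun u hu => ?_)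
    (hint.const_mul (∫ ω, |Z ω| ∂P))).trans ?_
  · exact hg.abs_integral_mul_le ht hu.1 hZ hB
  · rw [intervalIntegral.integral_const_mul]
    exact mul_le_mul_of_nonneg_left hval hE

/-- The second moment of a time integral grows linearly, at the rate `η`, also after weighting with
the past. -/
theorem integral_mul_sq_integral_le (hg : IsMixing P ℱ η K g) (hη : 0 < η) {t r : ℝ}
    (ht : 0 ≤ t) (htr : t ≤ r) {Z : Ω → ℝ} (hZ : Measurable[ℱ t] Z) {B : ℝ}
    (hB : ∀ ω, |Z ω| ≤ B) :
    ∫ ω, Z ω * (∫ u in t..r, g u ω) ^ 2 ∂P ≤ (∫ ω, |Z ω| ∂P) * (2 * K ^ 2 * η * (r - t)) := by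
  have hK := hg.nonneg
  have hZm : Measurable Z := hZ.mono (ℱ.le t) le_rfl
  have hZi : Integrable Z P := Integrable.of_bound hZm.aestronglyMeasurable B (ae_of_all _ hB)
  have hE : 0 ≤ ∫ ω, |Z ω| ∂P := integral_nonneg fun ω => abs_nonneg _
  set H : ℝ → Ω → ℝ := fun v ω => ∫ u in t..v, g u ω with hH
  have hHm : ∀ v, Measurable (H v) := fun v =>
    measurable_intervalIntegral_of_continuous hg.measurable hg.continuous t v
  have hHd : ∀ ω v, HasDerivAt (fun v => H v ω) (g v ω) v := fun ω v =>
    intervalIntegral.integral_hasDerivAt_right ((hg.continuous ω).intervalIntegrable _ _)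
      ((hg.continuous ω).stronglyMeasurableAtFilter _ _) (hg.continuous ω).continuousAt
  have hHc : ∀ ω, Continuous fun v => H v ω := fun ω =>
    continuous_iff_continuousAt.2 fun v => (hHd ω v).continuousAt
  -- the square is the time integral of its derivative `2 H g`
  have hsq : ∀ ω, H r ω ^ 2 = ∫ v in t..r, 2 * (H v ω * g v ω) := by
    intro ω
    have := intervalIntegral.integral_eq_sub_of_hasDerivAt (a := t) (b := r)
      (f := fun v => H v ω ^ 2) (f' := fun v => 2 * (H v ω * g v ω))
      (fun v _ => ((hHd ω v).fun_pow 2).congr_deriv (by simp; ring))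
      ((continuous_const.mul ((hHc ω).mul (hg.continuous ω))).intervalIntegrable _ _)
    rw [this]
    simp [hH]
  have hbd : ∀ v ∈ Icc t r, ∀ ω, |H v ω| ≤ K * (r - t) := fun v hv ω =>
    (hg.abs_integral_le ω hv.1).trans (by gcongr; exact hv.2)
  have hstep : ∀ v ∈ Icc t r, |∫ ω, Z ω * (2 * (H v ω * g v ω)) ∂P| ≤
      (∫ ω, |Z ω| ∂P) * (2 * K ^ 2 * η) := by
    intro v hv
    have e1 : ∀ ω, Z ω * (2 * (H v ω * g v ω)) = 2 * ((Z ω * g v ω) * H v ω) := fun ω => by ring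
    simp_rw [e1]
    have e3 : ∫ ω, Z ω * g v ω * H v ω ∂P = ∫ u in t..v, ∫ ω, Z ω * g v ω * g u ω ∂P :=
      integral_mul_intervalIntegral hg.measurable hg.continuous hv.1
        (fun u _ => hg.bound u) (hZm.mul (hg.measurable v)) (B := B * K) (fun ω => by
          rw [abs_mul]
          exact mul_le_mul (hB ω) (hg.bound v ω) (abs_nonneg _) ((abs_nonneg _).trans (hB ω)))
    rw [integral_const_mul, e3]
    have hdec := integral_decay_le hη hK hv.1
    have h1 : ‖∫ u in t..v, ∫ ω, Z ω * g v ω * g u ω ∂P‖ ≤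
        ∫ u in t..v, ((∫ ω, |Z ω| ∂P) * K) * (K * (η ^ 2 / (η + (v - u)) ^ 2)) := by
      refine intervalIntegral.norm_integral_le_of_norm_le hv.1 ?_ (hdec.1.const_mul _)
      have hne : ∀ᵐ u : ℝ, u ≠ v := Measure.ae_ne volume v
      filter_upwards [hne] with u hu huI
      have huv : u < v := lt_of_le_of_ne huI.2 hu
      have hu0 : 0 ≤ u := ht.trans huI.1.le
      have e2 : ∀ ω, Z ω * g v ω * g u ω = (Z ω * g u ω) * g v ω := fun ω => by ring
      simp_rw [e2]
      refine (hg.abs_integral_mul_le hu0 huv (Z := fun ω => Z ω * g u ω)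
        ((hZ.mono (ℱ.mono huI.1.le) le_rfl).mul (hg.adapted u hu0)) (B := B * K) (fun ω => by
          rw [abs_mul]
          exact mul_le_mul (hB ω) (hg.bound u ω) (abs_nonneg _)
            ((abs_nonneg _).trans (hB ω)))).trans ?_
      refine mul_le_mul_of_nonneg_right ?_ (by positivity)
      rw [← integral_mul_const]
      refine integral_mono_of_nonneg (ae_of_all _ fun ω => abs_nonneg _) (hZi.abs.mul_const _)
        (ae_of_all _ fun ω => ?_)
      simp only [abs_mul]
      exact mul_le_mul_of_nonneg_left (hg.bound u ω) (abs_nonneg _)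
    rw [intervalIntegral.integral_const_mul] at h1
    rw [abs_mul, abs_two]
    have h2 := h1.trans (mul_le_mul_of_nonneg_left hdec.2 (by positivity))
    rw [Real.norm_eq_abs] at h2
    nlinarith [h2]
  change ∫ ω, Z ω * H r ω ^ 2 ∂P ≤ _
  simp_rw [hsq]
  have hmul : ∀ v, Measurable fun ω => 2 * (H v ω * g v ω) := fun v =>
    ((hHm v).mul (hg.measurable v)).const_mul 2
  rw [integral_mul_intervalIntegral (f := fun v ω => 2 * (H v ω * g v ω)) hmul
    (fun ω => continuous_const.mul ((hHc ω).mul (hg.continuous ω))) htr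
    (K := 2 * (K * (r - t) * K)) (fun u hu ω => ?_) hZm hB]
  · have h3 := intervalIntegral.norm_integral_le_of_norm_le_const (a := t) (b := r)
      (C := (∫ ω, |Z ω| ∂P) * (2 * K ^ 2 * η))
      (f := fun v => ∫ ω, Z ω * (2 * (H v ω * g v ω)) ∂P) (fun v hv => by
        rw [uIoc_of_le htr] at hv
        exact hstep v (Ioc_subset_Icc_self hv))
    rw [abs_of_nonneg (sub_nonneg.2 htr)] at h3
    calc _ ≤ _ := (le_abs_self _).trans h3
      _ = _ := by ring
  · rw [abs_mul, abs_two, abs_mul]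
    have := hbd u hu ω
    gcongr
    exact hg.bound u ω

/-- The conditional mean of a time integral of any length is at most `K η`: tested against events of
the past, it is bounded by the integral of the decay profile. -/
theorem abs_condExp_integral_le (hg : IsMixing P ℱ η K g) (hη : 0 < η) {t r : ℝ}
    (ht : 0 ≤ t) (htr : t ≤ r) :
    ∀ᵐ ω ∂P, |(P[fun ω => ∫ u in t..r, g u ω | ℱ t]) ω| ≤ K * η := by
  set G : Ω → ℝ := fun ω => ∫ u in t..r, g u ω with hG
  have hGi : Integrable G P := Integrable.of_bound
    ((hg.measurable_integral ht htr).mono (ℱ.le r) le_rfl).aestronglyMeasurable _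
    (ae_of_all _ fun ω => hg.abs_integral_le ω htr)
  have key : ∀ A, MeasurableSet[ℱ t] A → |∫ ω in A, G ω ∂P| ≤ P.real A * (K * η) := by
    intro A hA
    have h := hg.abs_integral_mul_integral_le hη ht htr (Z := A.indicator 1)
      ((@measurable_const ℝ Ω _ (ℱ t) 1).indicator hA) (B := 1) (fun ω => by
        by_cases h : ω ∈ A <;> simp [h])
    have e1 : ∀ ω, |A.indicator (1 : Ω → ℝ) ω| = A.indicator (1 : Ω → ℝ) ω := fun ω => by
      by_cases h : ω ∈ A <;> simp [h]
    have e2 : ∀ ω, A.indicator (1 : Ω → ℝ) ω * (∫ u in t..r, g u ω) = A.indicator G ω := fun ω => by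
      by_cases h : ω ∈ A <;> simp [h, hG]
    simp_rw [e1, e2] at h
    rwa [integral_indicator (ℱ.le t A hA), integral_indicator_one (ℱ.le t A hA)] at h
  have hsm : StronglyMeasurable[ℱ t] (P[G | ℱ t]) := stronglyMeasurable_condExp
  have hint : Integrable (P[G | ℱ t]) (P.trim (ℱ.le t)) := integrable_condExp.trim (ℱ.le t) hsm
  have hset : ∀ A, MeasurableSet[ℱ t] A → ∫ ω in A, (P[G | ℱ t]) ω ∂(P.trim (ℱ.le t)) =
      ∫ ω in A, G ω ∂P := fun A hA => by
    rw [← setIntegral_trim (ℱ.le t) hsm hA, setIntegral_condExp (ℱ.le t) hGi hA]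
  have hreal : ∀ A, MeasurableSet[ℱ t] A → (P.trim (ℱ.le t)).real A = P.real A := fun A hA => by
    rw [measureReal_def, trim_measurableSet_eq (ℱ.le t) hA, measureReal_def]
  have h1 : (P[G | ℱ t]) ≤ᵐ[P.trim (ℱ.le t)] fun _ => K * η := by
    refine ae_le_of_forall_setIntegral_le hint (integrable_const _) fun A hA _ => ?_
    rw [hset A hA, setIntegral_const, hreal A hA]
    exact (le_abs_self _).trans (key A hA)
  have h2 : (fun _ => -(K * η)) ≤ᵐ[P.trim (ℱ.le t)] (P[G | ℱ t]) := by
    refine ae_le_of_forall_setIntegral_le (integrable_const _) hint fun A hA _ => ?_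
    rw [hset A hA, setIntegral_const, hreal A hA, smul_neg]
    exact (neg_le_neg (key A hA)).trans (neg_abs_le _)
  filter_upwards [ae_of_ae_trim (ℱ.le t) h1, ae_of_ae_trim (ℱ.le t) h2] with ω e1 e2
  exact abs_le.2 ⟨e2, e1⟩

end IsMixing

end Mixing

/-! ### Uniform bounds of integrals of mixing processes -/

section Mixing

variable {Ω : Type*} [m : MeasurableSpace Ω] {P : Measure Ω} [IsProbabilityMeasure P]

namespace IsMixing

variable {ℱ : Filtration ℝ m} {η K : ℝ} {g g₀ g₁ : ℝ → Ω → ℝ}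

/-- Maximal inequality for the integrals over consecutive blocks of length `h`, each weighted with a
factor `a k` known at the start of the block. The term added to `r` accounts for the conditional
means of the integrals; what remains is a sum of martingale differences. -/
theorem measure_weighted_block_sum_le (hg : IsMixing P ℱ η K g) (hη : 0 < η) {h : ℝ}
    (hηh : η ≤ h) {a : ℕ → Ω → ℝ} (ha : ∀ k : ℕ, Measurable[ℱ (k * h)] (a k)) {B : ℕ → ℝ}
    (hB : ∀ k ω, |a k ω| ≤ B k) {A : ℝ} {N : ℕ} (hA : ∀ k < N, ∫ ω, a k ω ^ 2 ∂P ≤ A)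
    {r : ℝ} (hr : 0 < r) :
    P {ω | ∃ n ≤ N, r + (∑ k ∈ Finset.range n, |a k ω|) * (K * η) <
        |∑ k ∈ Finset.range n, a k ω * ∫ u in (k * h : ℝ)..((k + 1 : ℕ) * h : ℝ), g u ω|} ≤
      ENNReal.ofReal (N * (6 * K ^ 2 * η * h * A) / r ^ 2) := by
  have hh : 0 < h := hη.trans_le hηh
  have hK := hg.nonneg
  have ht0 : ∀ k : ℕ, (0 : ℝ) ≤ k * h := fun k => by positivity
  have htm : ∀ k : ℕ, (k * h : ℝ) ≤ (k + 1 : ℕ) * h := fun k => by push_cast; nlinarith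
  have hlen : ∀ k : ℕ, ((k + 1 : ℕ) * h - k * h : ℝ) = h := fun k => by push_cast; ring
  let 𝒢 : Filtration ℕ m :=
    ⟨fun k => ℱ (k * h), fun i j hij => ℱ.mono (by gcongr), fun k => ℱ.le _⟩
  set G : ℕ → Ω → ℝ := fun k ω => ∫ u in (k * h : ℝ)..((k + 1 : ℕ) * h : ℝ), g u ω with hG
  have hGm : ∀ k, Measurable[ℱ ((k + 1 : ℕ) * h)] (G k) := fun k =>
    hg.measurable_integral (ht0 k) (htm k)
  have hGb : ∀ k ω, |G k ω| ≤ K * h := fun k ω => by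
    have := hg.abs_integral_le ω (htm k)
    rwa [hlen] at this
  have hGi : ∀ k, Integrable (G k) P := fun k => Integrable.of_bound
    ((hGm k).mono (ℱ.le _) le_rfl).aestronglyMeasurable _ (ae_of_all _ (hGb k))
  set M : ℕ → Ω → ℝ := fun k : ℕ => P[G k | ℱ (k * h)] with hM
  have hMm : ∀ k : ℕ, StronglyMeasurable[ℱ (k * h)] (M k) := fun k => stronglyMeasurable_condExp
  have hMb : ∀ k : ℕ, ∀ᵐ ω ∂P, |M k ω| ≤ K * η := fun k =>
    hg.abs_condExp_integral_le hη (ht0 k) (htm k)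
  have hMi : ∀ k : ℕ, Integrable (M k) P := fun k => integrable_condExp
  set X : ℕ → Ω → ℝ := fun k ω => a k ω * (G k ω - M k ω) with hX
  have ham : ∀ k, Measurable (a k) := fun k => (ha k).mono (ℱ.le _) le_rfl
  have hXm : ∀ k, StronglyMeasurable[𝒢 (k + 1)] (X k) := fun k =>
    ((ha k).mono (ℱ.mono (htm k)) le_rfl).stronglyMeasurable.mul
      ((hGm k).stronglyMeasurable.sub ((hMm k).mono (ℱ.mono (htm k))))
  have hX2 : ∀ k, MemLp (X k) 2 P := fun k => by
    refine MemLp.of_bound ((hXm k).mono (𝒢.le _)).aestronglyMeasurable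
      (B k * (K * h + K * η)) ?_
    filter_upwards [hMb k] with ω hω
    rw [Real.norm_eq_abs, abs_mul]
    refine mul_le_mul (hB k ω) ?_ (abs_nonneg _) ((abs_nonneg _).trans (hB k ω))
    exact (abs_sub _ _).trans (add_le_add (hGb k ω) hω)
  have h0 : ∀ k, P[X k | 𝒢 k] =ᵐ[P] 0 := fun k => by
    have hi : Integrable (fun ω => G k ω - M k ω) P := (hGi k).sub (hMi k)
    have e1 : P[X k | ℱ (k * h)] =ᵐ[P] a k * P[G k - M k | ℱ (k * h)] :=
      condExp_mul_of_stronglyMeasurable_left (ha k).stronglyMeasurable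
        ((hX2 k).integrable one_le_two) hi
    have e2 : P[G k - M k | ℱ (k * h)] =ᵐ[P] P[G k | ℱ (k * h)] - P[M k | ℱ (k * h)] :=
      condExp_sub (hGi k) (hMi k) _
    have e3 : P[M k | ℱ (k * h)] = M k := condExp_of_stronglyMeasurable (ℱ.le _) (hMm k) (hMi k)
    refine e1.trans ?_
    filter_upwards [e2] with ω hω
    rw [Pi.mul_apply, hω, Pi.sub_apply, e3]
    simp [hM]
  have hV : ∀ k < N, ∫ ω, X k ω ^ 2 ∂P ≤ 6 * K ^ 2 * η * h * A := fun k hk => by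
    have hZb : ∀ ω, |a k ω ^ 2| ≤ B k ^ 2 := fun ω => by
      rw [abs_pow]; exact pow_le_pow_left₀ (abs_nonneg _) (hB k ω) 2
    have i1 : Integrable (fun ω => a k ω ^ 2) P :=
      Integrable.of_bound ((ham k).pow_const 2).aestronglyMeasurable _ (ae_of_all _ hZb)
    have i2 : Integrable (fun ω => a k ω ^ 2 * G k ω ^ 2) P := by
      refine Integrable.of_bound (((ham k).pow_const 2).mul
        (((hGm k).mono (ℱ.le _) le_rfl).pow_const 2)).aestronglyMeasurable
        (B k ^ 2 * (K * h) ^ 2) (ae_of_all _ fun ω => ?_)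
      rw [Real.norm_eq_abs, abs_mul, abs_pow (G k ω)]
      exact mul_le_mul (hZb ω) (pow_le_pow_left₀ (abs_nonneg _) (hGb k ω) 2) (by positivity)
        (by positivity)
    have e := hg.integral_mul_sq_integral_le hη (ht0 k) (htm k) ((ha k).pow_const 2) hZb
    have e4 : ∀ ω, |a k ω ^ 2| = a k ω ^ 2 := fun ω => abs_of_nonneg (sq_nonneg _)
    simp_rw [e4] at e
    rw [hlen] at e
    have hle : ∫ ω, X k ω ^ 2 ∂P ≤
        ∫ ω, (2 * (a k ω ^ 2 * G k ω ^ 2) + 2 * (K * η) ^ 2 * a k ω ^ 2) ∂P := by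
      refine integral_mono_ae (hX2 k).integrable_sq ((i2.const_mul 2).add (i1.const_mul _)) ?_
      filter_upwards [hMb k] with ω hω
      have h1 : M k ω ^ 2 ≤ (K * η) ^ 2 := sq_le_sq' (neg_le_of_abs_le hω) (le_of_abs_le hω)
      have h2 : (G k ω - M k ω) ^ 2 ≤ 2 * G k ω ^ 2 + 2 * (K * η) ^ 2 := by
        nlinarith [sq_nonneg (G k ω + M k ω)]
      simp only [hX, mul_pow]
      nlinarith [mul_le_mul_of_nonneg_left h2 (sq_nonneg (a k ω))]
    rw [integral_add (i2.const_mul 2) (i1.const_mul _), integral_const_mul,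
      integral_const_mul] at hle
    have hA0 : 0 ≤ ∫ ω, a k ω ^ 2 ∂P := integral_nonneg fun ω => sq_nonneg _
    have h3 : 2 * (K * η) ^ 2 ≤ 2 * K ^ 2 * η * h := by
      have : K ^ 2 * η * η ≤ K ^ 2 * η * h := by gcongr
      linarith
    calc _ ≤ 2 * ((∫ ω, a k ω ^ 2 ∂P) * (2 * K ^ 2 * η * h)) +
          (2 * K ^ 2 * η * h) * ∫ ω, a k ω ^ 2 ∂P :=
          hle.trans (add_le_add (by linarith) (mul_le_mul_of_nonneg_right h3 hA0))
      _ = 6 * K ^ 2 * η * h * ∫ ω, a k ω ^ 2 ∂P := by ring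
      _ ≤ _ := by gcongr; exact hA k hk
  -- the bound of the conditional means holds almost surely only, whence a comparison of
  -- events up to null sets
  refine (measure_mono_ae ?_).trans (maximal_ineq_orthogonal_sum hXm hX2 h0 hV hr)
  filter_upwards [ae_all_iff.2 hMb] with ω hω
  rintro ⟨n, hn, hlt⟩
  refine ⟨n, hn, ?_⟩
  have e5 : ∑ k ∈ Finset.range n, a k ω * G k ω =
      ∑ k ∈ Finset.range n, X k ω + ∑ k ∈ Finset.range n, a k ω * M k ω := by
    rw [← Finset.sum_add_distrib]
    exact Finset.sum_congr rfl fun k _ => by simp only [hX]; ring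
  have e6 : |∑ k ∈ Finset.range n, a k ω * M k ω| ≤
      (∑ k ∈ Finset.range n, |a k ω|) * (K * η) := by
    rw [Finset.sum_mul]
    refine (Finset.abs_sum_le_sum_abs _ _).trans (Finset.sum_le_sum fun k _ => ?_)
    rw [abs_mul]
    exact mul_le_mul_of_nonneg_left (hω k) (abs_nonneg _)
  have hlt' : r + (∑ k ∈ Finset.range n, |a k ω|) * (K * η) <
      |∑ k ∈ Finset.range n, a k ω * G k ω| := hlt
  rw [e5] at hlt'
  linarith [abs_add_le (∑ k ∈ Finset.range n, X k ω) (∑ k ∈ Finset.range n, a k ω * M k ω)]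

/-- Uniform bound of the time integral of a process that mixes on the scale `ε ^ 2`: it is of
size `ε`. Blocks of length `ε` make the conditional means add up to `O(ε)`, and the path does not
move by more than `O(ε)` inside a block. -/
theorem measure_integral_gt_le {ε T : ℝ} (hε : ε ∈ Ioc (0 : ℝ) 1) (hT : 0 < T)
    (hg : IsMixing P ℱ (ε ^ 2) K g) {r : ℝ} (hr : 1 ≤ r) :
    P {ω | ∃ τ ∈ Icc 0 T, (1 + K * (T + 2)) * r * ε < |∫ u in (0 : ℝ)..τ, g u ω|} ≤
      ENNReal.ofReal (6 * K ^ 2 * (T + 1) / r ^ 2) := by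
  have hε0 := hε.1
  have hK := hg.nonneg
  set N : ℕ := ⌈T / ε⌉₊ with hN
  have hNε : N * ε ≤ T + 1 := by
    have h1 : (N : ℝ) < T / ε + 1 := Nat.ceil_lt_add_one (by positivity)
    have h2 : N * ε < (T / ε + 1) * ε := by gcongr
    rw [add_mul, div_mul_cancel₀ _ hε0.ne'] at h2
    linarith [hε.2]
  have hmax := hg.measure_weighted_block_sum_le (by positivity) (h := ε)
    (by nlinarith [hε.2]) (a := fun _ _ => 1) (fun k => measurable_const) (B := fun _ => 1)
    (fun k ω => by simp) (A := 1) (N := N) (fun k _ => by simp) (r := r * ε) (by positivity)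
  refine (measure_mono ?_).trans (hmax.trans (ENNReal.ofReal_le_ofReal ?_))
  · rintro ω ⟨τ, hτ, hlt⟩
    set n : ℕ := ⌊τ / ε⌋₊ with hn
    have hnN : n ≤ N := (Nat.floor_le_ceil _).trans
      (Nat.ceil_le_ceil (div_le_div_of_nonneg_right hτ.2 hε0.le))
    have hnτ : n * ε ≤ τ := by
      rw [← le_div_iff₀ hε0]; exact Nat.floor_le (div_nonneg hτ.1 hε0.le)
    have hτn : τ - n * ε ≤ ε := by
      have h1 : τ / ε < n + 1 := Nat.lt_floor_add_one _
      rw [div_lt_iff₀ hε0] at h1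
      linarith
    refine ⟨n, hnN, ?_⟩
    have hii : ∀ a b, IntervalIntegrable (fun u => g u ω) volume a b := fun a b =>
      (hg.continuous ω).intervalIntegrable a b
    have e1 : ∑ k ∈ Finset.range n, (1 : ℝ) *
        ∫ u in (k * ε : ℝ)..((k + 1 : ℕ) * ε : ℝ), g u ω = ∫ u in (0 : ℝ)..n * ε, g u ω := by
      simp_rw [one_mul]
      rw [intervalIntegral.sum_integral_adjacent_intervals (a := fun k : ℕ => (k * ε : ℝ))
        fun k _ => hii _ _]
      simp
    rw [e1]
    have e2 : (∫ u in (0 : ℝ)..n * ε, g u ω) + ∫ u in (n * ε : ℝ)..τ, g u ω =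
        ∫ u in (0 : ℝ)..τ, g u ω := intervalIntegral.integral_add_adjacent_intervals
      (hii _ _) (hii _ _)
    have e3 := hg.abs_integral_le ω hnτ
    have e4 := abs_add_le (∫ u in (0 : ℝ)..n * ε, g u ω) (∫ u in (n * ε : ℝ)..τ, g u ω)
    rw [e2] at e4
    have e5 : (n : ℝ) * ε ≤ T + 1 := by
      refine le_trans ?_ hNε
      gcongr
    simp only [abs_one, Finset.sum_const, Finset.card_range, nsmul_eq_mul, mul_one]
    have e6 : K * (τ - n * ε) ≤ K * ε * r := by
      calc _ ≤ K * ε := by gcongr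
        _ ≤ _ := le_mul_of_one_le_right (by positivity) hr
    have e7 : n * (K * ε ^ 2) ≤ (T + 1) * K * ε * r := by
      calc n * (K * ε ^ 2) = (n * ε) * K * ε := by ring
        _ ≤ (T + 1) * K * ε := by gcongr
        _ ≤ _ := le_mul_of_one_le_right (by positivity) hr
    linarith
  · rw [mul_one]
    have h1 : N * (6 * K ^ 2 * ε ^ 2 * ε) / (r * ε) ^ 2 = 6 * K ^ 2 * (N * ε) / r ^ 2 := by
      field_simp
    rw [h1]
    gcongr

/-- The iterated integral of two processes that mix on the scale `ε ^ 2` is `O(√ε)`, relative to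
the bound `D` of the inner one. On blocks of length `ε ^ (3/2)` the inner integral, of slope
`1 / ε`, moves by no more than `√ε`, so that it can be frozen at the start of the block; the sum of
the frozen terms is controlled by the maximal inequality. -/
theorem measure_iterated_integral_gt_le {ε T : ℝ} (hε : ε ∈ Ioc (0 : ℝ) 1) (hT : 0 < T)
    (hg₀ : IsMixing P ℱ (ε ^ 2) K g₀) (hg₁ : IsMixing P ℱ (ε ^ 2) K g₁)
    {r D : ℝ} (hr : 1 ≤ r) (hD : 1 ≤ D) :
    P {ω | (∀ τ ∈ Icc 0 T, |1 / ε * ∫ u in (0 : ℝ)..τ, g₀ u ω| ≤ D * r) ∧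
        ∃ τ ∈ Icc 0 T, (1 + D * K * (T + 2) + K ^ 2 * T) * r * √ε <
          |∫ u in (0 : ℝ)..τ, (1 / ε * ∫ v in (0 : ℝ)..u, g₀ v ω) * g₁ u ω|} ≤
      ENNReal.ofReal (12 * K ^ 4 * (T + 1) ^ 2 / r ^ 2) := by
  have hε0 := hε.1
  have hK := hg₀.nonneg
  set h : ℝ := ε * √ε with hh
  have hsq : √ε * √ε = ε := Real.mul_self_sqrt hε0.le
  have hsq0 : 0 < √ε := Real.sqrt_pos.2 hε0
  have hsq1 : √ε ≤ 1 := Real.sqrt_le_one.2 hε.2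
  have hεs : ε ≤ √ε := by nlinarith
  have hh0 : 0 < h := by positivity
  have hhs : h ≤ √ε := by nlinarith [hε.2]
  have hηh : ε ^ 2 ≤ h := by rw [hh, sq]; gcongr
  set N : ℕ := ⌈T / h⌉₊ with hN
  have hNh : N * h ≤ T + 1 := by
    have h1 : (N : ℝ) < T / h + 1 := Nat.ceil_lt_add_one (by positivity)
    have h2 : N * h < (T / h + 1) * h := by gcongr
    rw [add_mul, div_mul_cancel₀ _ hh0.ne'] at h2
    linarith
  set W : ℝ → Ω → ℝ := fun τ ω => 1 / ε * ∫ u in (0 : ℝ)..τ, g₀ u ω with hW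
  have hWd : ∀ ω v, HasDerivAt (fun v => W v ω) (1 / ε * g₀ v ω) v := fun ω v =>
    (intervalIntegral.integral_hasDerivAt_right ((hg₀.continuous ω).intervalIntegrable _ _)
      ((hg₀.continuous ω).stronglyMeasurableAtFilter _ _)
      (hg₀.continuous ω).continuousAt).const_mul _
  have hWc : ∀ ω, Continuous fun v => W v ω := fun ω =>
    continuous_iff_continuousAt.2 fun v => (hWd ω v).continuousAt
  have hk0 : ∀ k : ℕ, (0 : ℝ) ≤ k * h := fun k => by positivity
  have hmax := hg₁.measure_weighted_block_sum_le (by positivity) hηh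
    (a := fun k ω => W (k * h) ω)
    (fun k => (hg₀.measurable_integral le_rfl (hk0 k)).const_mul (1 / ε))
    (B := fun k => 1 / ε * (K * (k * h))) (fun k ω => by
      have := hg₀.abs_integral_le ω (hk0 k)
      rw [sub_zero] at this
      rw [abs_mul, abs_of_pos (by positivity : 0 < 1 / ε)]
      gcongr) (A := 2 * K ^ 2 * (T + 1)) (N := N) (fun k hk => by
      have h1 := hg₀.integral_mul_sq_integral_le (by positivity) le_rfl (hk0 k)
        (Z := fun _ => 1 / ε ^ 2) measurable_const (B := 1 / ε ^ 2)
        (fun ω => (abs_of_pos (by positivity)).le)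
      have h2 : (k : ℝ) * h ≤ T + 1 := le_trans (by gcongr) hNh
      have h3 : ∀ ω, W (k * h) ω ^ 2 = 1 / ε ^ 2 * (∫ u in (0 : ℝ)..k * h, g₀ u ω) ^ 2 :=
        fun ω => by simp only [hW]; rw [mul_pow, div_pow, one_pow]
      simp_rw [h3]
      refine h1.trans ?_
      rw [integral_const, abs_of_pos (by positivity : 0 < 1 / ε ^ 2)]
      simp only [probReal_univ, one_smul, sub_zero]
      have h4 : 1 / ε ^ 2 * (2 * K ^ 2 * ε ^ 2 * (k * h)) = 2 * K ^ 2 * (k * h) := by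
        field_simp
      rw [h4]
      gcongr) (r := r * √ε) (by positivity)
  refine (measure_mono ?_).trans (hmax.trans (ENNReal.ofReal_le_ofReal ?_))
  · rintro ω ⟨hb, τ, hτ, hlt⟩
    set n : ℕ := ⌊τ / h⌋₊ with hn
    have hnN : n ≤ N := (Nat.floor_le_ceil _).trans
      (Nat.ceil_le_ceil (div_le_div_of_nonneg_right hτ.2 hh0.le))
    have hnτ : n * h ≤ τ := by
      rw [← le_div_iff₀ hh0]; exact Nat.floor_le (div_nonneg hτ.1 hh0.le)
    have hτn : τ - n * h ≤ h := by
      have h1 : τ / h < n + 1 := Nat.lt_floor_add_one _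
      rw [div_lt_iff₀ hh0] at h1
      linarith
    refine ⟨n, hnN, ?_⟩
    have hnT : n * h ≤ T := hnτ.trans hτ.2
    have hkT : ∀ k < n, (k * h : ℝ) ∈ Icc 0 T := fun k hk =>
      ⟨hk0 k, le_trans (by gcongr) hnT⟩
    have hg1c := hg₁.continuous ω
    have hii : ∀ a b, IntervalIntegrable (fun u => W u ω * g₁ u ω) volume a b := fun a b =>
      ((hWc ω).mul hg1c).intervalIntegrable a b
    have e1 : ∑ k ∈ Finset.range n,
        (∫ u in (k * h : ℝ)..((k + 1 : ℕ) * h : ℝ), W u ω * g₁ u ω) =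
        ∫ u in (0 : ℝ)..n * h, W u ω * g₁ u ω := by
      rw [intervalIntegral.sum_integral_adjacent_intervals (a := fun k : ℕ => (k * h : ℝ))
        fun k _ => hii _ _]
      simp
    have e2 : (∫ u in (0 : ℝ)..n * h, W u ω * g₁ u ω) + ∫ u in (n * h : ℝ)..τ, W u ω * g₁ u ω =
        ∫ u in (0 : ℝ)..τ, W u ω * g₁ u ω := intervalIntegral.integral_add_adjacent_intervals
      (hii _ _) (hii _ _)
    have hfr : ∀ k < n, |(∫ u in (k * h : ℝ)..((k + 1 : ℕ) * h : ℝ), W u ω * g₁ u ω) -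
        W (k * h) ω * ∫ u in (k * h : ℝ)..((k + 1 : ℕ) * h : ℝ), g₁ u ω| ≤ K * √ε * K * h := by
      intro k _
      have htm : (k * h : ℝ) ≤ (k + 1 : ℕ) * h := by push_cast; nlinarith
      rw [← intervalIntegral.integral_const_mul,
        ← intervalIntegral.integral_sub (hii _ _) ((hg1c.const_mul _).intervalIntegrable _ _)]
      have h1 := intervalIntegral.norm_integral_le_of_norm_le_const (a := (k * h : ℝ))
        (b := (k + 1 : ℕ) * h) (C := K * √ε * K)
        (f := fun u => W u ω * g₁ u ω - W (k * h) ω * g₁ u ω) (fun u hu => by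
          rw [uIoc_of_le htm] at hu
          rw [← sub_mul, norm_mul]
          refine mul_le_mul ?_ (hg₁.bound u ω) (norm_nonneg _) (by positivity)
          have h2 : W u ω - W (k * h) ω = 1 / ε * ∫ v in (k * h : ℝ)..u, g₀ v ω := by
            simp only [hW]
            rw [← mul_sub, intervalIntegral.integral_interval_sub_left
              ((hg₀.continuous ω).intervalIntegrable _ _)
              ((hg₀.continuous ω).intervalIntegrable _ _)]
          have h3 := hg₀.abs_integral_le ω hu.1.le
          have h4 : u - k * h ≤ h := by have := hu.2; push_cast at this; linarith
          rw [h2, norm_mul, Real.norm_eq_abs, Real.norm_eq_abs,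
            abs_of_pos (by positivity : 0 < 1 / ε)]
          calc _ ≤ 1 / ε * (K * h) := by
                gcongr
                exact h3.trans (by gcongr)
            _ = K * √ε := by rw [hh]; field_simp)
      have h5 : ((k + 1 : ℕ) * h - k * h : ℝ) = h := by push_cast; ring
      rwa [h5, abs_of_pos hh0] at h1
    have e3 : |(∫ u in (0 : ℝ)..n * h, W u ω * g₁ u ω) - ∑ k ∈ Finset.range n,
        W (k * h) ω * ∫ u in (k * h : ℝ)..((k + 1 : ℕ) * h : ℝ), g₁ u ω| ≤ K ^ 2 * T * √ε := by
      rw [← e1, ← Finset.sum_sub_distrib]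
      refine (Finset.abs_sum_le_sum_abs _ _).trans ?_
      refine (Finset.sum_le_card_nsmul _ _ _ fun k hk => hfr k (Finset.mem_range.1 hk)).trans ?_
      rw [Finset.card_range, nsmul_eq_mul]
      calc n * (K * √ε * K * h) = K ^ 2 * (n * h) * √ε := by ring
        _ ≤ _ := by gcongr
    have e4 : |∫ u in (n * h : ℝ)..τ, W u ω * g₁ u ω| ≤ D * r * K * √ε := by
      have h1 := intervalIntegral.norm_integral_le_of_norm_le_const (a := (n * h : ℝ))
        (b := τ) (C := D * r * K) (f := fun u => W u ω * g₁ u ω) (fun u hu => by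
          rw [uIoc_of_le hnτ] at hu
          rw [norm_mul]
          exact mul_le_mul (hb u ⟨(hk0 n).trans hu.1.le, hu.2.trans hτ.2⟩) (hg₁.bound u ω)
            (norm_nonneg _) (by positivity))
      rw [abs_of_nonneg (sub_nonneg.2 hnτ)] at h1
      exact h1.trans (by gcongr; exact hτn.trans hhs)
    have e5 : (∑ k ∈ Finset.range n, |W (k * h) ω|) * (K * ε ^ 2) ≤
        D * r * K * (T + 1) * √ε := by
      have h1 : ∑ k ∈ Finset.range n, |W (k * h) ω| ≤ n * (D * r) := by
        refine (Finset.sum_le_card_nsmul _ _ _ fun k hk =>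
          hb _ (hkT k (Finset.mem_range.1 hk))).trans ?_
        rw [Finset.card_range, nsmul_eq_mul]
      calc _ ≤ n * (D * r) * (K * ε ^ 2) := by gcongr
        _ = (n * h) * (D * r) * K * √ε := by
          have : ε ^ 2 = h * √ε := by rw [hh, mul_assoc, hsq, sq]
          rw [this]; ring
        _ ≤ (T + 1) * (D * r) * K * √ε := by gcongr; linarith
        _ = _ := by ring
    have e6 := abs_add_le (∫ u in (0 : ℝ)..n * h, W u ω * g₁ u ω)
      (∫ u in (n * h : ℝ)..τ, W u ω * g₁ u ω)
    rw [e2] at e6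
    have e7 := abs_sub_abs_le_abs_sub (∫ u in (0 : ℝ)..n * h, W u ω * g₁ u ω)
      (∑ k ∈ Finset.range n, W (k * h) ω *
        ∫ u in (k * h : ℝ)..((k + 1 : ℕ) * h : ℝ), g₁ u ω)
    have e8 : K ^ 2 * T * √ε ≤ K ^ 2 * T * r * √ε :=
      mul_le_mul_of_nonneg_right (le_mul_of_one_le_right (by positivity) hr) hsq0.le
    have hlt' : (1 + D * K * (T + 2) + K ^ 2 * T) * r * √ε <
      |∫ u in (0 : ℝ)..τ, W u ω * g₁ u ω| := hlt
    linarith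
  · have h1 : N * (6 * K ^ 2 * ε ^ 2 * h * (2 * K ^ 2 * (T + 1))) / (r * √ε) ^ 2 =
        12 * K ^ 4 * (T + 1) * (N * h) * ε / r ^ 2 := by
      have : (r * √ε) ^ 2 = r ^ 2 * ε := by rw [mul_pow, sq (√ε), hsq]
      rw [this]
      field_simp
      ring
    rw [h1]
    refine div_le_div_of_nonneg_right ?_ (by positivity)
    calc 12 * K ^ 4 * (T + 1) * (N * h) * ε ≤ 12 * K ^ 4 * (T + 1) * (T + 1) * 1 := by
          gcongr
          exact hε.2
      _ = _ := by ring

end IsMixing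

/-- The bounds on `W = ε⁻¹ ∫ f₀`, `M = ∫ f₁` and `Y = ∫ W f₁`, of strength `r`, that control the
travel time shift in a fixed realization. -/
structure HasIntegralBounds (ε T r : ℝ) (f₀ f₁ : ℝ → ℝ) : Prop where
  base : ∀ τ ∈ Icc 0 T, |1 / ε * ∫ u in (0 : ℝ)..τ, f₀ u| ≤ r
  correction : ∀ τ ∈ Icc 0 T, |∫ u in (0 : ℝ)..τ, f₁ u| ≤ r * ε
  iterated : ∀ τ ∈ Icc 0 T,
    |∫ u in (0 : ℝ)..τ, (1 / ε * ∫ v in (0 : ℝ)..u, f₀ v) * f₁ u| ≤ r * √ε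

/-- The integral bounds of strength `C r` fail with probability at most `C / r ^ 2`. The constant
depends neither on `ε` nor on the processes, but only on their constant `K` and on `T`. -/
theorem exists_measure_not_hasIntegralBounds_le (P : Measure Ω) [IsProbabilityMeasure P]
    {K T : ℝ} (hK : 0 ≤ K) (hT : 0 < T) :
    ∃ C : ℝ, 1 ≤ C ∧ ∀ (ℱ : Filtration ℝ m) (ε : ℝ) (g₀ g₁ : ℝ → Ω → ℝ), ε ∈ Ioc (0 : ℝ) 1 →
      IsMixing P ℱ (ε ^ 2) K g₀ → IsMixing P ℱ (ε ^ 2) K g₁ → ∀ r : ℝ, 1 ≤ r →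
      P {ω | ¬ HasIntegralBounds ε T (C * r) (fun u => g₀ u ω) fun u => g₁ u ω} ≤
        ENNReal.ofReal (C / r ^ 2) := by
  set D : ℝ := 1 + K * (T + 2) with hD
  have hD1 : 1 ≤ D := by rw [hD]; nlinarith
  set E : ℝ := 1 + D * K * (T + 2) + K ^ 2 * T with hE
  have hE1 : 0 ≤ E := by positivity
  set F : ℝ := 6 * K ^ 2 * (T + 1) with hF
  have hF0 : 0 ≤ F := by positivity
  set G : ℝ := 12 * K ^ 4 * (T + 1) ^ 2 with hG
  have hG0 : 0 ≤ G := by positivity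
  refine ⟨D + E + (F + F + G), by linarith, fun ℱ ε g₀ g₁ hε hg₀ hg₁ r hr => ?_⟩
  have hε0 := hε.1
  set C : ℝ := D + E + (F + F + G) with hC
  have hDC : D ≤ C := by linarith
  have hEC : E ≤ C := by linarith
  have b0 := hg₀.measure_integral_gt_le hε hT hr
  have b1 := hg₁.measure_integral_gt_le hε hT hr
  have b2 := hg₀.measure_iterated_integral_gt_le hε hT hg₁ hr hD1
  have hsum : ENNReal.ofReal (F / r ^ 2) + ENNReal.ofReal (F / r ^ 2) +
      ENNReal.ofReal (G / r ^ 2) ≤ ENNReal.ofReal (C / r ^ 2) := by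
    rw [← ENNReal.ofReal_add (by positivity) (by positivity),
      ← ENNReal.ofReal_add (by positivity) (by positivity), ← add_div, ← add_div]
    exact ENNReal.ofReal_le_ofReal (by gcongr; linarith)
  refine le_trans ?_ hsum
  refine le_trans (measure_mono ?_) ((measure_union_le _ _).trans (add_le_add
    ((measure_union_le _ _).trans (add_le_add b0 b1)) b2))
  intro ω hω
  by_contra hn
  simp only [mem_union, not_or] at hn
  obtain ⟨⟨n0, n1⟩, n2⟩ := hn
  simp only [mem_ofPred_eq, not_exists, not_and, not_lt] at n0 n1 n2
  have hW : ∀ τ ∈ Icc 0 T, |1 / ε * ∫ u in (0 : ℝ)..τ, g₀ u ω| ≤ D * r := fun τ hτ => by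
    have := n0 τ hτ
    rw [abs_mul, abs_of_pos (by positivity : 0 < 1 / ε), one_div_mul_eq_div, div_le_iff₀ hε0]
    exact this
  refine hω ⟨fun τ hτ => (hW τ hτ).trans (by gcongr), fun τ hτ => (n1 τ hτ).trans (by gcongr),
    fun τ hτ => (n2 hW τ hτ).trans (by gcongr)⟩

end Mixing

/-! ### Deterministic comparison of shifts and differentiability of flows -/

theorem hasDerivAt_integral_of_continuous {f : ℝ → ℝ} (hf : Continuous f) (v : ℝ) :
    HasDerivAt (fun v => ∫ u in (0 : ℝ)..v, f u) (f v) v :=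
  intervalIntegral.integral_hasDerivAt_right (hf.intervalIntegrable _ _)
    (hf.stronglyMeasurableAtFilter _ _) hf.continuousAt

/-- Gronwall's inequality, with a bound that is linear in the data. -/
theorem abs_le_of_deriv_le_affine {f f' : ℝ → ℝ} {T δ K D : ℝ} (hK : 1 ≤ K) (hD : 0 ≤ D)
    (hf : ∀ u ∈ Icc 0 T, HasDerivAt f (f' u) u) (h0 : |f 0| ≤ δ)
    (hle : ∀ u ∈ Icc 0 T, |f' u| ≤ K * |f u| + D) :
    ∀ u ∈ Icc 0 T, |f u| ≤ (δ + D) * Real.exp (K * T) := by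
  intro u hu
  have hg := norm_le_gronwallBound_of_norm_deriv_right_le (f := f) (f' := f') (δ := δ) (K := K)
    (ε := D) (a := 0) (b := T) (fun x hx => (hf x hx).continuousAt.continuousWithinAt)
    (fun x hx => (hf x (Ico_subset_Icc_self hx)).hasDerivWithinAt) h0
    (fun x hx => hle x (Ico_subset_Icc_self hx)) u hu
  rw [gronwallBound_of_K_ne_0 (by positivity), sub_zero] at hg
  have hδ : 0 ≤ δ := (abs_nonneg _).trans h0
  have hexp : Real.exp (K * u) ≤ Real.exp (K * T) := by
    apply Real.exp_le_exp.2; gcongr; exact hu.2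
  have h1 : D / K * (Real.exp (K * u) - 1) ≤ D * Real.exp (K * T) := by
    refine mul_le_mul (div_le_self hD hK) (by linarith) ?_ hD
    rw [sub_nonneg]
    exact Real.one_le_exp (mul_nonneg (by positivity) hu.1)
  have h2 : δ * Real.exp (K * u) ≤ δ * Real.exp (K * T) := by gcongr
  calc |f u| ≤ _ := hg
    _ ≤ δ * Real.exp (K * T) + D * Real.exp (K * T) := add_le_add h2 h1
    _ = _ := by ring

/-- The deterministic comparison of the shift `y`, driven along the path `v` by
`f₀ + ε κ (s + y) f₁`, with the shift driven by `f₀` alone. The function `Φ` in the proof, the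
residual corrected by the part that the linearized equation predicts for it, has a derivative of
size `b ^ 2 r ^ 2` only, which spares an integration by parts. -/
theorem exists_shift_error_le {K T S : ℝ} (hK : 1 ≤ K) (hT : 0 ≤ T) (hS : 0 ≤ S) (T' : ℝ) :
    ∃ C : ℝ, 1 ≤ C ∧ ∀ (ε κ b s r : ℝ) (f₀ f₁ y y' v v' ρ : ℝ → ℝ),
      ε ∈ Ioc (0 : ℝ) 1 → κ ∈ Icc (0 : ℝ) 1 → 0 ≤ b → b ^ 2 = ε * κ → ε ≤ b → κ * √ε ≤ b →
      s ∈ Icc 0 S → 1 ≤ r → Continuous f₀ → Continuous f₁ → Continuous ρ →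
      HasIntegralBounds ε T' r f₀ f₁ →
      (∀ u ∈ Icc 0 T, HasDerivAt v (v' u) u) → (∀ u ∈ Icc 0 T, v u ∈ Icc 0 T') →
      (∀ u ∈ Icc 0 T, HasDerivAt y (y' u) u) → y 0 = 0 →
      |1 / ε * ∫ u in (0 : ℝ)..v 0, f₀ u| ≤ K * ε →
      (∀ u ∈ Icc 0 T, |y' u - v' u * (1 / ε * f₀ (v u) + κ * (s + y u) * f₁ (v u)) - ρ u| ≤
        K * (ε * κ ^ 2) * (s + y u) ^ 2) →
      (∀ u ∈ Icc 0 T, |y' u - v' u * (1 / ε * f₀ (v u))| ≤ K * (|s + y u| + 1)) →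
      ∀ τ ∈ Icc 0 T, |y τ| ≤ C * r ∧
        |y τ - 1 / ε * (∫ u in (0 : ℝ)..v τ, f₀ u) - ∫ u in (0 : ℝ)..τ, ρ u| ≤
          C * (b * r + (b * r) ^ 2) := by
  have hK0 : 0 ≤ K := by linarith
  set C₁ : ℝ := (K + K * (S + 2)) * Real.exp (K * T) with hC₁
  have hC₁0 : 0 ≤ C₁ := by positivity
  set C₂ : ℝ := S + C₁ + 1 with hC₂
  have hC₂0 : 0 ≤ C₂ := by positivity
  set C₃ : ℝ := K * C₂ ^ 2 + K * (C₂ + 1) with hC₃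
  have hC₃0 : 0 ≤ C₃ := by positivity
  refine ⟨2 * K + 2 * S + 2 + C₁ + C₃ * T, by
    linarith [mul_nonneg hC₃0 hT], fun ε κ b s r f₀ f₁ y y' v v' ρ hε hκ hb hbκ hεb hκε hs hr
      hf₀ hf₁ hρ hI hv hvm hy hy0 h0 htay hlip => ?_⟩
  have hε0 := hε.1
  have hκ0 := hκ.1
  have hr0 : 0 ≤ r := by linarith
  set W : ℝ → ℝ := fun x => 1 / ε * ∫ u in (0 : ℝ)..x, f₀ u with hW
  set M : ℝ → ℝ := fun x => ∫ u in (0 : ℝ)..x, f₁ u with hM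
  set Y : ℝ → ℝ := fun x => ∫ u in (0 : ℝ)..x, W u * f₁ u with hY
  set Q : ℝ → ℝ := fun x => ∫ u in (0 : ℝ)..x, ρ u with hQ
  have hWd : ∀ x, HasDerivAt W (1 / ε * f₀ x) x := fun x =>
    (hasDerivAt_integral_of_continuous hf₀ x).const_mul _
  have hWc : Continuous W := continuous_iff_continuousAt.2 fun x => (hWd x).continuousAt
  have hMd : ∀ x, HasDerivAt M (f₁ x) x := hasDerivAt_integral_of_continuous hf₁
  have hYd : ∀ x, HasDerivAt Y (W x * f₁ x) x := hasDerivAt_integral_of_continuous (hWc.mul hf₁)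
  have hQd : ∀ x, HasDerivAt Q (ρ x) x := hasDerivAt_integral_of_continuous hρ
  have hWb : ∀ u ∈ Icc 0 T, |W (v u)| ≤ r := fun u hu => hI.base _ (hvm u hu)
  have hMb : ∀ u ∈ Icc 0 T, |M (v u)| ≤ r * ε := fun u hu => hI.correction _ (hvm u hu)
  have hYb : ∀ u ∈ Icc 0 T, |Y (v u)| ≤ r * √ε := fun u hu => hI.iterated _ (hvm u hu)
  -- the residual and its derivative; Gronwall gives a first bound of size `r`, without a rate
  set q : ℝ → ℝ := fun u => y u - W (v u) with hq
  set q' : ℝ → ℝ := fun u => y' u - v' u * (1 / ε * f₀ (v u)) with hq'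
  have hqd : ∀ u ∈ Icc 0 T, HasDerivAt q (q' u) u := fun u hu =>
    ((hy u hu).sub ((hWd (v u)).comp u (hv u hu))).congr_deriv (by simp only [hq']; ring)
  have hq0 : |q 0| ≤ K * ε := by
    simp only [hq, hy0, zero_sub, abs_neg]; exact h0
  have hqb : ∀ u ∈ Icc 0 T, |q u| ≤ C₁ * r := by
    intro u hu
    have h1 := abs_le_of_deriv_le_affine (δ := K * r) (D := K * (S + 2) * r) hK (by positivity)
      hqd (hq0.trans (by gcongr; exact hε.2.trans hr)) (fun x hx => by
        refine (hlip x hx).trans ?_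
        have e1 : |s + y x| ≤ S + (|q x| + r) := by
          have : s + y x = s + (q x + W (v x)) := by simp only [hq]; ring
          rw [this]
          refine (abs_add_le _ _).trans (add_le_add (by rw [abs_of_nonneg hs.1]; exact hs.2) ?_)
          exact (abs_add_le _ _).trans (add_le_add le_rfl (hWb x hx))
        have e2 : |s + y x| + 1 ≤ |q x| + (S + 2) * r := by nlinarith
        calc _ ≤ K * (|q x| + (S + 2) * r) := by gcongr
          _ = _ := by ring) u hu
    calc _ ≤ _ := h1
      _ = C₁ * r := by rw [hC₁]; ring
  have hyb : ∀ u ∈ Icc 0 T, |y u| ≤ (C₁ + 1) * r := by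
    intro u hu
    have : y u = q u + W (v u) := by simp only [hq]; ring
    rw [this]
    linarith [abs_add_le (q u) (W (v u)), hqb u hu, hWb u hu]
  have hsy : ∀ u ∈ Icc 0 T, |s + y u| ≤ C₂ * r := by
    intro u hu
    have h1 := abs_add_le s (y u)
    rw [abs_of_nonneg hs.1] at h1
    have h2 := hyb u hu
    have h3 : s ≤ S * r := hs.2.trans (le_mul_of_one_le_right hS hr)
    rw [hC₂]
    linarith
  have hq'b : ∀ u ∈ Icc 0 T, |q' u| ≤ K * (C₂ + 1) * r := by
    intro u hu
    refine (hlip u hu).trans ?_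
    rw [mul_assoc]
    gcongr
    linarith [hsy u hu]
  set Φ : ℝ → ℝ := fun u => q u - κ * (s * M (v u) + Y (v u) + q u * M (v u)) - Q u with hΦ
  have hΦd : ∀ u ∈ Icc 0 T, HasDerivAt Φ
      ((y' u - v' u * (1 / ε * f₀ (v u) + κ * (s + y u) * f₁ (v u)) - ρ u) -
        κ * (q' u * M (v u))) u := by
    intro u hu
    have dM := (hMd (v u)).comp u (hv u hu)
    have dY := (hYd (v u)).comp u (hv u hu)
    refine (((hqd u hu).sub ((((dM.const_mul s).add dY).add
      ((hqd u hu).mul dM)).const_mul κ)).sub (hQd u)).congr_deriv ?_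
    simp only [hq, hq', Function.comp]
    ring
  have hb2 : 0 ≤ ε * κ := by positivity
  have hΦb : ∀ u ∈ Icc 0 T, |(y' u - v' u * (1 / ε * f₀ (v u) + κ * (s + y u) * f₁ (v u)) - ρ u) -
      κ * (q' u * M (v u))| ≤ C₃ * (b * r) ^ 2 := by
    intro u hu
    have e1 : K * (ε * κ ^ 2) * (s + y u) ^ 2 ≤ K * (ε * κ) * (C₂ * r) ^ 2 := by
      have h1 : (s + y u) ^ 2 ≤ (C₂ * r) ^ 2 := by
        rw [← sq_abs]; exact pow_le_pow_left₀ (abs_nonneg _) (hsy u hu) 2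
      have h2 : ε * κ ^ 2 ≤ ε * κ := by
        rw [sq]; gcongr; exact mul_le_of_le_one_left hκ0 hκ.2
      gcongr
    have e2 : |κ * (q' u * M (v u))| ≤ κ * (K * (C₂ + 1) * r * (r * ε)) := by
      rw [abs_mul, abs_mul, abs_of_nonneg hκ0]
      gcongr
      · exact hq'b u hu
      · exact hMb u hu
    calc _ ≤ K * (ε * κ) * (C₂ * r) ^ 2 + κ * (K * (C₂ + 1) * r * (r * ε)) :=
          (abs_sub _ _).trans (add_le_add ((htay u hu).trans e1) e2)
      _ = C₃ * (b * r) ^ 2 := by rw [mul_pow b, hbκ, hC₃]; ring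
  intro τ hτ
  have h0T : (0 : ℝ) ∈ Icc 0 T := ⟨le_rfl, hT⟩
  refine ⟨(hyb τ hτ).trans
    (mul_le_mul_of_nonneg_right (by linarith [mul_nonneg hC₃0 hT]) hr0), ?_⟩
  have hΦτ := norm_image_sub_le_of_norm_deriv_le_segment' (f := Φ) (C := C₃ * (b * r) ^ 2)
    (fun u hu => (hΦd u hu).hasDerivWithinAt)
    (fun u hu => hΦb u (Ico_subset_Icc_self hu)) τ hτ
  rw [sub_zero, Real.norm_eq_abs] at hΦτ
  have hΦτ' : |Φ τ - Φ 0| ≤ C₃ * T * (b * r) ^ 2 := hΦτ.trans (by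
    calc _ ≤ C₃ * (b * r) ^ 2 * T := by gcongr; exact hτ.2
      _ = _ := by ring)
  have hcorr : ∀ u ∈ Icc 0 T, ∀ D, |q u| ≤ D → |κ * (s * M (v u) + Y (v u) + q u * M (v u))| ≤
      (S + 1) * (b * r) + κ * (D * (r * ε)) := by
    intro u hu D hqD
    have hD0 : 0 ≤ D := (abs_nonneg _).trans hqD
    rw [abs_mul, abs_of_nonneg hκ0]
    have t1 : |s * M (v u)| ≤ S * (r * ε) := by
      rw [abs_mul, abs_of_nonneg hs.1]
      exact mul_le_mul hs.2 (hMb u hu) (abs_nonneg _) hS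
    have t2 : |q u * M (v u)| ≤ D * (r * ε) := by
      rw [abs_mul]; exact mul_le_mul hqD (hMb u hu) (abs_nonneg _) hD0
    have t3 : |s * M (v u) + Y (v u) + q u * M (v u)| ≤ S * (r * ε) + r * √ε + D * (r * ε) :=
      (abs_add_le _ _).trans (add_le_add ((abs_add_le _ _).trans (add_le_add t1 (hYb u hu))) t2)
    have t4 : κ * (S * (r * ε)) ≤ S * (b * r) := by
      calc κ * (S * (r * ε)) ≤ 1 * (S * (r * b)) := by gcongr; exact hκ.2
        _ = _ := by ring
    have t5 : κ * (r * √ε) ≤ b * r := by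
      calc κ * (r * √ε) = (κ * √ε) * r := by ring
        _ ≤ _ := by gcongr
    have t6 := mul_le_mul_of_nonneg_left t3 hκ0
    linarith
  have c0 := hcorr 0 h0T _ hq0
  have cτ := hcorr τ hτ _ (hqb τ hτ)
  have hbr : 0 ≤ b * r := by positivity
  have hKb : K * ε ≤ K * (b * r) := by
    gcongr
    exact hεb.trans (le_mul_of_one_le_right hb hr)
  have c1 : κ * (K * ε * (r * ε)) ≤ K * (b * r) := by
    calc κ * (K * ε * (r * ε)) ≤ 1 * (K * 1 * (r * b)) := by
          gcongr
          · exact hκ.2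
          · exact hε.2
      _ = _ := by ring
  have c2 : κ * (C₁ * r * (r * ε)) = C₁ * (b * r) ^ 2 := by rw [mul_pow b, hbκ]; ring
  have hQ0 : Q 0 = 0 := by simp [hQ]
  have eq1 : y τ - W (v τ) - Q τ = (Φ τ - Φ 0) +
      κ * (s * M (v τ) + Y (v τ) + q τ * M (v τ)) + q 0 -
      κ * (s * M (v 0) + Y (v 0) + q 0 * M (v 0)) := by
    simp only [hΦ, hQ0]; simp only [hq]; ring
  change |y τ - W (v τ) - Q τ| ≤ _
  rw [eq1]
  have tot := (abs_sub (Φ τ - Φ 0 + κ * (s * M (v τ) + Y (v τ) + q τ * M (v τ)) + q 0)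
    (κ * (s * M (v 0) + Y (v 0) + q 0 * M (v 0)))).trans (add_le_add
      ((abs_add_le _ _).trans (add_le_add (abs_add_le _ _) le_rfl)) le_rfl)
  refine tot.trans ?_
  have p1 : 0 ≤ (2 * K + 2 * S + 2) * (b * r) ^ 2 := by positivity
  have p2 : 0 ≤ (C₁ + C₃ * T) * (b * r) := by positivity
  linarith

/-- A continuous solution on `[0, ∞)` of an integral equation extends to a continuous function on
the line with a two-sided derivative on `[0, ∞)`, also at `0`. -/
theorem exists_extension_hasDerivAt {F : ℝ → ℝ → ℝ} (hF : Continuous (Function.uncurry F))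
    {w : ℝ → ℝ} (hw : ContinuousOn w (Ici 0))
    (hw' : ∀ τ, 0 ≤ τ → w τ = ∫ u in (0 : ℝ)..τ, F u (w u)) :
    ∃ y : ℝ → ℝ, Continuous y ∧ (∀ τ, 0 ≤ τ → y τ = w τ) ∧
      ∀ u, 0 ≤ u → HasDerivAt y (F u (y u)) u := by
  have hwc : Continuous fun u => w (max u 0) :=
    hw.comp_continuous (by fun_prop) fun u => le_max_right u 0
  have hc : Continuous fun u => F u (w (max u 0)) := hF.comp (continuous_id.prodMk hwc)
  have hd := hasDerivAt_integral_of_continuous hc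
  have heq : ∀ τ, 0 ≤ τ → ∫ u in (0 : ℝ)..τ, F u (w (max u 0)) = w τ := fun τ hτ => by
    rw [hw' τ hτ]
    refine intervalIntegral.integral_congr fun u hu => ?_
    rw [uIcc_of_le hτ] at hu
    simp only [max_eq_left hu.1]
  refine ⟨_, continuous_iff_continuousAt.2 fun u => (hd u).continuousAt, heq, fun u hu => ?_⟩
  have := hd u
  rwa [max_eq_left hu, ← heq u hu] at this

/-- Differentiability of a flow in its initial value: if `s + w s` solves `x' = f(u, x)` with
initial value `s`, then `1 + ∂_s w` is the exponential of the integral of `∂ₓ f` along the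
solution. -/
theorem hasDerivAt_flow {f f' : ℝ → ℝ → ℝ} {K : ℝ} (hK : 1 ≤ K)
    (hf : Continuous (Function.uncurry f)) (hf' : Continuous (Function.uncurry f'))
    (hlip : ∀ u x x', |f u x' - f u x| ≤ K * |x' - x|) (hb : ∀ u x, |f' u x| ≤ K)
    (htay : ∀ u x x', |f u x' - f u x - (x' - x) * f' u x| ≤ K * (x' - x) ^ 2)
    {w : ℝ → ℝ → ℝ} (hw : ∀ s, ContinuousOn (w s) (Ici 0))
    (hw' : ∀ s τ, 0 ≤ τ → w s τ = ∫ u in (0 : ℝ)..τ, f u (s + w s u)) {τ : ℝ} (hτ : 0 ≤ τ)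
    (s : ℝ) :
    HasDerivAt (fun s => w s τ) (Real.exp (∫ u in (0 : ℝ)..τ, f' u (s + w s u)) - 1) s := by
  have hext : ∀ s, ∃ y : ℝ → ℝ, Continuous y ∧ (∀ τ, 0 ≤ τ → y τ = w s τ) ∧
      ∀ u, 0 ≤ u → HasDerivAt y (f u (s + y u)) u := fun s => by
    refine exists_extension_hasDerivAt (F := fun u x => f u (s + x)) ?_ (hw s) (hw' s)
    exact hf.comp (by fun_prop : Continuous fun p : ℝ × ℝ => (p.1, s + p.2))
  choose y hyc hyw hyd using hext
  have hy0 : ∀ s, y s 0 = 0 := fun s => by rw [hyw s 0 le_rfl, hw' s 0 le_rfl]; simp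
  have hJc : Continuous fun u => f' u (s + y s u) :=
    hf'.comp (continuous_id.prodMk (continuous_const.add (hyc s)))
  set J : ℝ → ℝ := fun x => Real.exp (∫ u in (0 : ℝ)..x, f' u (s + y s u)) with hJ
  have hJd : ∀ x, HasDerivAt J (J x * f' x (s + y s x)) x := fun x =>
    (hasDerivAt_integral_of_continuous hJc x).exp
  have hJτ : Real.exp (∫ u in (0 : ℝ)..τ, f' u (s + w s u)) = J τ := by
    simp only [hJ]
    congr 1
    refine intervalIntegral.integral_congr fun u hu => ?_
    rw [uIcc_of_le hτ] at hu
    simp only [hyw s u hu.1]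
  set E : ℝ := Real.exp (K * τ) with hE
  have hE0 : 0 < E := Real.exp_pos _
  -- two applications of Gronwall: the difference of two solutions is `O(s₂ - s)`, hence its
  -- deviation from the solution `(s₂ - s) J` of the linearized equation is quadratic
  have hmain : ∀ s₂, |w s₂ τ - w s τ - (s₂ - s) * (J τ - 1)| ≤ K * E ^ 3 * ‖s₂ - s‖ ^ 2 := by
    intro s₂
    have hed : ∀ u ∈ Icc 0 τ, HasDerivAt (fun u => (s₂ + y s₂ u) - (s + y s u))
        (f u (s₂ + y s₂ u) - f u (s + y s u)) u := fun u hu =>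
      ((hyd s₂ u hu.1).const_add s₂).sub ((hyd s u hu.1).const_add s)
    have heb := abs_le_of_deriv_le_affine (δ := |s₂ - s|) (D := 0) hK le_rfl hed
      (by simp [hy0]) (fun u _ => by rw [add_zero]; exact hlip u _ _)
    rw [add_zero, ← hE] at heb
    have hrd : ∀ u ∈ Icc 0 τ, HasDerivAt
        (fun u => ((s₂ + y s₂ u) - (s + y s u)) - (s₂ - s) * J u)
        ((f u (s₂ + y s₂ u) - f u (s + y s u)) - (s₂ - s) * (J u * f' u (s + y s u))) u :=
      fun u hu => (hed u hu).sub ((hJd u).const_mul _)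
    have hrb := abs_le_of_deriv_le_affine (δ := 0) (D := K * (|s₂ - s| * E) ^ 2) hK
      (by positivity) hrd (by simp [hy0, hJ]) (fun u hu => by
        set e : ℝ := (s₂ + y s₂ u) - (s + y s u) with he
        have e1 : (f u (s₂ + y s₂ u) - f u (s + y s u)) - (s₂ - s) * (J u * f' u (s + y s u)) =
            f' u (s + y s u) * (e - (s₂ - s) * J u) +
              (f u (s₂ + y s₂ u) - f u (s + y s u) - e * f' u (s + y s u)) := by ring
        rw [e1]
        refine (abs_add_le _ _).trans (add_le_add ?_ ?_)
        · rw [abs_mul]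
          exact mul_le_mul_of_nonneg_right (hb _ _) (abs_nonneg _)
        · refine (htay u _ _).trans ?_
          rw [← he, ← sq_abs]
          have := heb u hu
          gcongr) τ ⟨hτ, le_rfl⟩
    rw [zero_add, ← hE] at hrb
    calc |w s₂ τ - w s τ - (s₂ - s) * (J τ - 1)|
        = |((s₂ + y s₂ τ) - (s + y s τ)) - (s₂ - s) * J τ| := by
          rw [hyw s₂ τ hτ, hyw s τ hτ]; congr 1; ring
      _ ≤ _ := hrb
      _ = _ := by rw [Real.norm_eq_abs]; ring
  rw [hJτ, hasDerivAt_iff_isLittleO]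
  refine Asymptotics.IsBigO.trans_isLittleO (g := fun s₂ => ‖s₂ - s‖ ^ 2) ?_
    (Asymptotics.isLittleO_pow_sub_sub s one_lt_two)
  refine Asymptotics.IsBigO.of_bound (K * E ^ 3) (Filter.Eventually.of_forall fun s₂ => ?_)
  rw [norm_pow, norm_norm, smul_eq_mul]
  exact hmain s₂

/-! ### The medium along a characteristic -/

/-- A function of two variables, with partial derivatives `mt` and `mz`, all bounded by `K`, and
with quadratic Taylor remainders in each variable. -/
structure IsBoundedSmooth (K : ℝ) (m mt mz : ℝ → ℝ → ℝ) : Prop where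
  continuous : Continuous (Function.uncurry m)
  continuous_t : Continuous (Function.uncurry mt)
  continuous_z : Continuous (Function.uncurry mz)
  hasDerivAt_comp : ∀ {a b : ℝ → ℝ} {a' b' u : ℝ}, HasDerivAt a a' u → HasDerivAt b b' u →
    HasDerivAt (fun u => m (a u) (b u)) (a' * mt (a u) (b u) + b' * mz (a u) (b u)) u
  bound : ∀ t z, |m t z| ≤ K
  bound_t : ∀ t z, |mt t z| ≤ K
  bound_z : ∀ t z, |mz t z| ≤ K
  lip_t : ∀ t t' z, |m t' z - m t z| ≤ K * |t' - t|
  lip_z : ∀ t z z', |m t z' - m t z| ≤ K * |z' - z|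
  lip_tt : ∀ t t' z, |mt t' z - mt t z| ≤ K * |t' - t|
  lip_zz : ∀ t z z', |mz t z' - mz t z| ≤ K * |z' - z|
  taylor_t : ∀ t t' z, |m t' z - m t z - (t' - t) * mt t z| ≤ K * (t' - t) ^ 2
  taylor_z : ∀ t z z', |m t z' - m t z - (z' - z) * mz t z| ≤ K * (z' - z) ^ 2

theorem abs_sub_le_of_deriv_bound {f f' : ℝ → ℝ} {K : ℝ} (hf : ∀ x, HasDerivAt f (f' x) x)
    (hK : ∀ x, |f' x| ≤ K) (x x' : ℝ) : |f x' - f x| ≤ K * |x' - x| :=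
  convex_univ.norm_image_sub_le_of_norm_hasDerivWithin_le
    (fun x _ => (hf x).hasDerivWithinAt) (fun x _ => hK x) (mem_univ x) (mem_univ x')

theorem abs_taylor_le {f f' : ℝ → ℝ} {K : ℝ} (hf : ∀ x, HasDerivAt f (f' x) x)
    (hK : ∀ x x', |f' x' - f' x| ≤ K * |x' - x|) (x x' : ℝ) :
    |f x' - f x - (x' - x) * f' x| ≤ K * (x' - x) ^ 2 := by
  have hK0 : 0 ≤ K := by
    have := (abs_nonneg _).trans (hK 0 1)
    simpa using this
  have h := (convex_uIcc x x').norm_image_sub_le_of_norm_hasDerivWithin_le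
    (f := fun v => f v - v * f' x) (f' := fun v => f' v - f' x) (C := K * |x' - x|)
    (fun v _ => ((hf v).sub (((hasDerivAt_id v).mul_const (f' x)).congr_deriv
      (one_mul _))).hasDerivWithinAt)
    (fun v hv => (hK x v).trans
      (mul_le_mul_of_nonneg_left (abs_sub_left_of_mem_uIcc hv) hK0))
    left_mem_uIcc right_mem_uIcc
  rw [Real.norm_eq_abs, Real.norm_eq_abs] at h
  calc _ = |f x' - x' * f' x - (f x - x * f' x)| := by congr 1; ring
    _ ≤ _ := h
    _ = _ := by rw [mul_assoc, abs_mul_abs_self, sq]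

section Medium

section Field

variable {Ω : Type*} {μ : ℝ → ℝ → Ω → ℝ}

theorem hasDerivAt_fst_fderiv {ω : Ω} (h : ContDiff ℝ 2 fun p : ℝ × ℝ => μ p.1 p.2 ω) (t z : ℝ) :
    HasDerivAt (fun t => μ t z ω) (fderiv ℝ (fun p : ℝ × ℝ => μ p.1 p.2 ω) (t, z) (1, 0)) t := by
  have hF := (h.differentiable (by norm_num) (t, z)).hasFDerivAt
  exact hF.comp_hasDerivAt t ((hasDerivAt_id t).prodMk (hasDerivAt_const t z))

theorem hasDerivAt_snd_fderiv {ω : Ω} (h : ContDiff ℝ 2 fun p : ℝ × ℝ => μ p.1 p.2 ω) (t z : ℝ) :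
    HasDerivAt (fun z => μ t z ω) (fderiv ℝ (fun p : ℝ × ℝ => μ p.1 p.2 ω) (t, z) (0, 1)) z := by
  have hF := (h.differentiable (by norm_num) (t, z)).hasFDerivAt
  exact hF.comp_hasDerivAt z ((hasDerivAt_const z t).prodMk (hasDerivAt_id z))

theorem measurable_rangeHistory (μ : ℝ → ℝ → Ω → ℝ) (t : ℝ) {z : ℝ} (hz : 0 ≤ z) :
    Measurable[rangeHistory μ z] (μ t z) := by
  rw [measurable_iff_comap_le]
  exact le_iSup_of_le t (le_iSup₂_of_le z ⟨hz, le_rfl⟩ le_rfl)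

/-- A derivative of the medium at fixed range is a limit of difference quotients at the same
range, hence known to the history of that range. -/
theorem measurable_deriv_rangeHistory {m' : MeasurableSpace Ω} {z : ℝ}
    (hm : ∀ t, Measurable[m'] (μ t z)) (hd : ∀ t ω, DifferentiableAt ℝ (fun t => μ t z ω) t)
    (t : ℝ) : Measurable[m'] (partialT μ t z) := by
  refine @measurable_of_tendsto_metrizable Ω ℝ m' _ _ _ _
    (fun n : ℕ => fun ω => (1 / ((n : ℝ) + 1))⁻¹ • (μ (t + 1 / ((n : ℝ) + 1)) z ω - μ t z ω)) _
    (fun n => ((hm (t + 1 / ((n : ℝ) + 1))).sub (hm t)).const_smul (1 / ((n : ℝ) + 1))⁻¹) ?_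
  rw [tendsto_pi_nhds]
  intro ω
  have h1 := hasDerivAt_iff_tendsto_slope_zero.1 (hd t ω).hasDerivAt
  refine h1.comp (tendsto_nhdsWithin_iff.2 ⟨tendsto_one_div_add_atTop_nhds_zero_nat,
    Filter.Eventually.of_forall fun n => ?_⟩)
  have : (0 : ℝ) < 1 / ((n : ℝ) + 1) := by positivity
  exact this.ne'

end Field

variable {Ω : Type*} [m : MeasurableSpace Ω] {P : Measure Ω} {μ : ℝ → ℝ → Ω → ℝ}

theorem IsRandomMedium.exists_isBoundedSmooth (hμ : IsRandomMedium P μ) :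
    ∃ K : ℝ, 1 ≤ K ∧ ∀ ω, IsBoundedSmooth K (fun t z => μ t z ω) (fun t z => partialT μ t z ω)
      fun t z => partialZ μ t z ω := by
  obtain ⟨A, hA⟩ := hμ.bounded
  obtain ⟨At, hAt⟩ := hμ.bounded_t
  obtain ⟨Az, hAz⟩ := hμ.bounded_z
  obtain ⟨Att, hAtt⟩ := hμ.bounded_tt
  obtain ⟨Azz, hAzz⟩ := hμ.bounded_zz
  set K : ℝ := 1 + |A| + |At| + |Az| + |Att| + |Azz| with hK
  have kA := le_abs_self A
  have kAt := le_abs_self At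
  have kAz := le_abs_self Az
  have kAtt := le_abs_self Att
  have kAzz := le_abs_self Azz
  have pA := abs_nonneg A
  have pAt := abs_nonneg At
  have pAz := abs_nonneg Az
  have pAtt := abs_nonneg Att
  have pAzz := abs_nonneg Azz
  refine ⟨K, by linarith, fun ω => ?_⟩
  have h := hμ.contDiff ω
  set F : ℝ × ℝ → ℝ := fun p => μ p.1 p.2 ω with hF
  have hT : ∀ t z, partialT μ t z ω = fderiv ℝ F (t, z) (1, 0) := fun t z =>
    (hasDerivAt_fst_fderiv h t z).deriv
  have hZ : ∀ t z, partialZ μ t z ω = fderiv ℝ F (t, z) (0, 1) := fun t z =>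
    (hasDerivAt_snd_fderiv h t z).deriv
  have hdT : ∀ t z, HasDerivAt (fun t => μ t z ω) (partialT μ t z ω) t := fun t z => by
    rw [hT]; exact hasDerivAt_fst_fderiv h t z
  have hdZ : ∀ t z, HasDerivAt (fun z => μ t z ω) (partialZ μ t z ω) z := fun t z => by
    rw [hZ]; exact hasDerivAt_snd_fderiv h t z
  have hF1 : ∀ v : ℝ × ℝ, ContDiff ℝ 1 fun p => fderiv ℝ F p v := fun v =>
    (h.fderiv_right (m := 1) (by norm_num)).clm_apply contDiff_const
  have hcT : Function.uncurry (fun t z => partialT μ t z ω) = fun p => fderiv ℝ F p (1, 0) :=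
    funext fun p => hT p.1 p.2
  have hcZ : Function.uncurry (fun t z => partialZ μ t z ω) = fun p => fderiv ℝ F p (0, 1) :=
    funext fun p => hZ p.1 p.2
  have hdTT : ∀ t z, HasDerivAt (fun t => partialT μ t z ω) (partialT (partialT μ) t z ω) t := by
    intro t z
    have h1 : DifferentiableAt ℝ (fun t => partialT μ t z ω) t := by
      simp_rw [hT]
      have h2 : DifferentiableAt ℝ (fun t : ℝ => ((t, z) : ℝ × ℝ)) t := by fun_prop
      exact DifferentiableAt.comp t ((hF1 (1, 0)).differentiable one_ne_zero (t, z)) h2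
    exact h1.hasDerivAt
  have hdZZ : ∀ t z, HasDerivAt (fun z => partialZ μ t z ω) (partialZ (partialZ μ) t z ω) z := by
    intro t z
    have h1 : DifferentiableAt ℝ (fun z => partialZ μ t z ω) z := by
      simp_rw [hZ]
      have h2 : DifferentiableAt ℝ (fun z : ℝ => ((t, z) : ℝ × ℝ)) z := by fun_prop
      exact DifferentiableAt.comp z ((hF1 (0, 1)).differentiable one_ne_zero (t, z)) h2
    exact h1.hasDerivAt
  have b0 : ∀ t z, |μ t z ω| ≤ K := fun t z => (hA t z ω).trans (by linarith)
  have bt : ∀ t z, |partialT μ t z ω| ≤ K := fun t z => (hAt t z ω).trans (by linarith)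
  have bz : ∀ t z, |partialZ μ t z ω| ≤ K := fun t z => (hAz t z ω).trans (by linarith)
  have btt : ∀ t z, |partialT (partialT μ) t z ω| ≤ K := fun t z =>
    (hAtt t z ω).trans (by linarith)
  have bzz : ∀ t z, |partialZ (partialZ μ) t z ω| ≤ K := fun t z =>
    (hAzz t z ω).trans (by linarith)
  have ltt : ∀ t t' z, |partialT μ t' z ω - partialT μ t z ω| ≤ K * |t' - t| := fun t t' z =>
    abs_sub_le_of_deriv_bound (fun t => hdTT t z) (fun t => btt t z) t t'
  have lzz : ∀ t z z', |partialZ μ t z' ω - partialZ μ t z ω| ≤ K * |z' - z| := fun t z z' =>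
    abs_sub_le_of_deriv_bound (fun z => hdZZ t z) (fun z => bzz t z) z z'
  exact
    { continuous := h.continuous
      continuous_t := by rw [hcT]; exact (hF1 _).continuous
      continuous_z := by rw [hcZ]; exact (hF1 _).continuous
      hasDerivAt_comp := by
        intro a b a' b' u ha hb
        have h1 := (h.differentiable (by norm_num) (a u, b u)).hasFDerivAt.comp_hasDerivAt u
          (ha.prodMk hb)
        refine h1.congr_deriv ?_
        rw [hT, hZ]
        have e : ((a', b') : ℝ × ℝ) = a' • (1, 0) + b' • (0, 1) := by simp
        rw [e, map_add, map_smul, map_smul, smul_eq_mul, smul_eq_mul]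
      bound := b0
      bound_t := bt
      bound_z := bz
      lip_t := fun t t' z => abs_sub_le_of_deriv_bound (fun t => hdT t z) (fun t => bt t z) t t'
      lip_z := fun t z z' => abs_sub_le_of_deriv_bound (fun z => hdZ t z) (fun z => bz t z) z z'
      lip_tt := ltt
      lip_zz := lzz
      taylor_t := fun t t' z => abs_taylor_le (fun t => hdT t z) (fun t t' => ltt t t' z) t t'
      taylor_z := fun t z z' => abs_taylor_le (fun z => hdZ t z) (fun z z' => lzz t z z') z z' }

/-- The histories of the medium up to the range `c u`, as a filtration in `u`. -/
def historyFiltration (μ : ℝ → ℝ → Ω → ℝ) (hμ : ∀ t z, Measurable (μ t z)) {c : ℝ} (hc : 0 ≤ c) :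
    Filtration ℝ m where
  seq u := rangeHistory μ (c * u)
  mono' _ _ huv := iSup_mono fun _ => biSup_mono fun _ hz =>
    ⟨hz.1, hz.2.trans (mul_le_mul_of_nonneg_left huv hc)⟩
  le' _ := iSup_le fun t => iSup₂_le fun z _ => (hμ t z).comap_le

/-- The trivial bound `K` and the mixing rate, with `d > 2`, together are dominated by the decay
profile of `IsMixing`. -/
theorem decay_profile_le {η x c C d K a : ℝ} (hη : 0 < η) (hx : 0 < x) (hc : 0 < c) (hd : 2 < d)
    (hK : 0 ≤ K) (h1 : a ≤ K) (h2 : a ≤ C * (c * (x / η)) ^ (-d)) :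
    a ≤ 4 * (K + |C| * c ^ (-d)) * (η ^ 2 / (η + x) ^ 2) := by
  have hcd : 0 ≤ |C| * c ^ (-d) := by positivity
  rcases le_total x η with hxη | hxη
  · have h3 : 1 ≤ 4 * (η ^ 2 / (η + x) ^ 2) := by
      rw [mul_div_assoc', le_div_iff₀ (by positivity)]
      nlinarith
    calc a ≤ K := h1
      _ ≤ (K + |C| * c ^ (-d)) * 1 := by linarith
      _ ≤ (K + |C| * c ^ (-d)) * (4 * (η ^ 2 / (η + x) ^ 2)) := by gcongr
      _ = _ := by ring
  · have hξ : 1 ≤ x / η := by rwa [le_div_iff₀ hη, one_mul]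
    have h3 : (x / η) ^ (-d) ≤ (η / x) ^ 2 := by
      calc (x / η) ^ (-d) ≤ (x / η) ^ (-2 : ℝ) :=
            Real.rpow_le_rpow_of_exponent_le hξ (by linarith)
        _ = (η / x) ^ 2 := by
            rw [Real.rpow_neg (by positivity), Real.rpow_two, ← inv_pow, inv_div]
    have h4 : (η / x) ^ 2 ≤ 4 * (η ^ 2 / (η + x) ^ 2) := by
      rw [div_pow, mul_div_assoc', div_le_div_iff₀ (by positivity) (by positivity)]
      have : (η + x) ^ 2 ≤ (2 * x) ^ 2 := by gcongr; linarith
      nlinarith [mul_le_mul_of_nonneg_left this (sq_nonneg η)]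
    calc a ≤ C * (c * (x / η)) ^ (-d) := h2
      _ ≤ |C| * (c * (x / η)) ^ (-d) := by gcongr; exact le_abs_self C
      _ = |C| * c ^ (-d) * (x / η) ^ (-d) := by
          rw [Real.mul_rpow hc.le (by positivity), mul_assoc]
      _ ≤ |C| * c ^ (-d) * (4 * (η ^ 2 / (η + x) ^ 2)) := by gcongr; exact h3.trans h4
      _ ≤ (K + |C| * c ^ (-d)) * (4 * (η ^ 2 / (η + x) ^ 2)) := by gcongr; linarith
      _ = _ := by ring

/-- Along a path with fast range `c₀ u / ε ^ 2`, a field that mixes in range becomes a process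
that mixes on the scale `ε ^ 2`, whatever its time argument. -/
theorem MixesInRange.exists_isMixing [IsProbabilityMeasure P]
    (hμ : ∀ t z, Measurable (μ t z)) {X : ℝ → ℝ → Ω → ℝ} (hX : MixesInRange P μ X)
    (hXm : ∀ t z, Measurable (X t z)) (hXa : ∀ t z, 0 ≤ z → Measurable[rangeHistory μ z] (X t z))
    (hXc : ∀ ω, Continuous fun p : ℝ × ℝ => X p.1 p.2 ω) {K : ℝ}
    (hXb : ∀ t z ω, |X t z ω| ≤ K) {c₀ : ℝ} (hc₀ : 0 < c₀) :
    ∃ L : ℝ, ∀ ε : ℝ, 0 < ε → ∀ (hc : 0 ≤ c₀ / ε ^ 2) (a : ℝ),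
      IsMixing P (historyFiltration μ hμ hc) (ε ^ 2) L
        fun u => X (u / a) (c₀ * u / ε ^ 2) := by
  obtain ⟨C, d, hd, hmix⟩ := hX
  obtain ⟨ω₀⟩ := P.nonempty_of_neZero
  have hK : 0 ≤ K := (abs_nonneg _).trans (hXb 0 0 ω₀)
  refine ⟨4 * (K + |C| * c₀ ^ (-d)), fun ε hε hc a => ?_⟩
  have hcu : ∀ u, c₀ * u / ε ^ 2 = c₀ / ε ^ 2 * u := fun u => by ring
  have hcd : 0 ≤ |C| * c₀ ^ (-d) := by positivity
  exact
    { measurable := fun u => hXm _ _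
      adapted := fun u hu => by
        simp only [hcu]
        exact hXa _ _ (mul_nonneg hc hu)
      continuous := fun ω => (hXc ω).comp
        (by fun_prop : Continuous fun u : ℝ => (u / a, c₀ * u / ε ^ 2))
      bound := fun u ω => (hXb _ _ _).trans (by linarith)
      mixing := fun u x hu hx => by
        have hz : 0 ≤ c₀ / ε ^ 2 * u := mul_nonneg hc hu
        have hΔ : 0 < c₀ * (x / ε ^ 2) := by positivity
        have h1 := hmix ((u + x) / a) _ _ hz hΔ
        have e1 : c₀ / ε ^ 2 * u + c₀ * (x / ε ^ 2) = c₀ * (u + x) / ε ^ 2 := by ring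
        rw [e1] at h1
        have h2 : ∀ᵐ ω ∂P, |(P[X ((u + x) / a) (c₀ * (u + x) / ε ^ 2) |
            rangeHistory μ (c₀ / ε ^ 2 * u)]) ω| ≤ K := by
          exact ae_bdd_abs_condExp_of_ae_bdd_abs (ae_of_all _ fun ω => hXb _ _ _)
        filter_upwards [h1, h2] with ω g1 g2
        exact decay_profile_le (by positivity) hx hc₀ hd hK g2 g1 }

theorem IsMixing.mono {ℱ : Filtration ℝ m} {η K L : ℝ} {g : ℝ → Ω → ℝ}
    (hg : IsMixing P ℱ η K g) (h : K ≤ L) : IsMixing P ℱ η L g :=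
  { hg with
    bound := fun u ω => (hg.bound u ω).trans h
    mixing := fun u x hu hx => by
      filter_upwards [hg.mixing u x hu hx] with ω hω
      exact hω.trans (by gcongr) }

theorem IsMixing.const_mul {ℱ : Filtration ℝ m} {η K : ℝ} {g : ℝ → Ω → ℝ}
    (hg : IsMixing P ℱ η K g) (c : ℝ) :
    IsMixing P ℱ η (|c| * K) fun u ω => c * g u ω where
  measurable u := (hg.measurable u).const_mul c
  adapted u hu := (hg.adapted u hu).const_mul c
  continuous ω := (hg.continuous ω).const_mul c
  bound u ω := by rw [abs_mul]; exact mul_le_mul_of_nonneg_left (hg.bound u ω) (abs_nonneg c)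
  mixing u x hu hx := by
    have h1 : P[fun ω => c * g (u + x) ω | ℱ u] =ᵐ[P] c • P[g (u + x) | ℱ u] :=
      condExp_smul c (g (u + x)) _
    filter_upwards [hg.mixing u x hu hx, h1] with ω hω e
    rw [e, Pi.smul_apply, smul_eq_mul, abs_mul, mul_assoc]
    exact mul_le_mul_of_nonneg_left hω (abs_nonneg c)

/-! ### From bounds on events to rates -/

/-- From bounds on good events to the rates: with `r = ε ^ (-θ / 2)` the failure probability
`C / r ^ 2` is `C ε ^ θ`. Where `ε` is bounded below, the probabilities are trivially of that
size. -/
theorem splitsWithRate_of_bounds [IsProbabilityMeasure P] {c₀ S T γ : ℝ} (hc₀ : 0 < c₀)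
    (hγ : 0 ≤ γ) {𝒲 : ℝ → ℝ → ℝ → Ω → ℝ} {W : ℝ → ℝ → Ω → ℝ}
    (hdiff : ∀ ε ∈ Ioc (0 : ℝ) 1, ∀ τ ∈ Icc 0 T, ∀ s ∈ Icc 0 S, ∀ ω,
      DifferentiableAt ℝ (fun s' => 𝒲 ε τ s' ω) s)
    {C ε₀ : ℝ} (hC : 0 < C) (hε₀ : 0 < ε₀)
    (hgood : ∀ ε ∈ Ioc (0 : ℝ) 1, ε ≤ ε₀ → ∀ r : ℝ, 1 ≤ r → ε ^ ((2 - γ) / 2) * r ≤ 1 →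
      P {ω | ¬ ∀ s ∈ Icc 0 S, ∀ τ ∈ Icc 0 T,
        |𝒲 ε τ s ω - W ε τ ω| ≤ C * (ε ^ ((2 - γ) / 2) * r) ∧
        |deriv (fun s' => 𝒲 ε τ s' ω) s| ≤ C * (ε ^ ((2 - γ) / 2) * r)} ≤
      ENNReal.ofReal (C / r ^ 2)) :
    SplitsWithRate P c₀ S T γ 𝒲 W := by
  refine ⟨fun ε z s ω => 𝒲 ε (z / c₀) s ω - W ε (z / c₀) ω, fun ε hε τ hτ s hs ω =>
    ⟨?_, hdiff ε hε τ hτ s hs ω⟩, 2 * C, C + 1 / ε₀ ^ 2, by positivity, by positivity, ?_⟩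
  · beta_reduce
    rw [mul_div_cancel_left₀ _ hc₀.ne']; ring
  intro θ hθ ε hε
  have hε0 := hε.1
  rcases le_or_gt ε ε₀ with hle | hgt
  · have hr : 1 ≤ ε ^ (-(θ / 2)) :=
      Real.one_le_rpow_of_pos_of_le_one_of_nonpos hε0 hε.2 (by linarith [hθ.1])
    have hbr : ε ^ ((2 - γ) / 2) * ε ^ (-(θ / 2)) = ε ^ ((2 - γ - θ) / 2) := by
      rw [← Real.rpow_add hε0]; congr 1; ring
    have hp : 0 < ε ^ ((2 - γ - θ) / 2) := Real.rpow_pos_of_pos hε0 _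
    have h := hgood ε hε hle _ hr (by
      rw [hbr]; exact Real.rpow_le_one hε0.le hε.2 (by linarith [hθ.2]))
    rw [hbr] at h
    have hCr : C / (ε ^ (-(θ / 2))) ^ 2 ≤ (C + 1 / ε₀ ^ 2) * ε ^ θ := by
      have e1 : (ε ^ (-(θ / 2))) ^ 2 = (ε ^ θ)⁻¹ := by
        rw [← Real.rpow_natCast, ← Real.rpow_mul hε0.le, ← Real.rpow_neg hε0.le]
        congr 1; push_cast; ring
      rw [e1, div_inv_eq_mul]
      have : 0 ≤ 1 / ε₀ ^ 2 := by positivity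
      gcongr
      linarith
    have hsup : ∀ f : ℝ → ℝ → ℝ,
        (∀ s ∈ Icc 0 S, ∀ τ ∈ Icc 0 T, |f τ s| ≤ C * ε ^ ((2 - γ - θ) / 2)) →
        ¬ ENNReal.ofReal (2 * C * ε ^ ((2 - γ - θ) / 2)) ≤ supAbs S T f := by
      intro f hf hcon
      have h1 : supAbs S T f ≤ ENNReal.ofReal (C * ε ^ ((2 - γ - θ) / 2)) :=
        iSup₂_le fun s hs => iSup₂_le fun τ hτ => ENNReal.ofReal_le_ofReal (hf s hs τ hτ)
      have h2 := (ENNReal.ofReal_le_ofReal_iff (by positivity)).1 (hcon.trans h1)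
      have h3 : 0 < C * ε ^ ((2 - γ - θ) / 2) := by positivity
      linarith
    refine ⟨?_, ?_⟩
    · refine (measure_mono fun ω hω hall => ?_).trans
        (h.trans (ENNReal.ofReal_le_ofReal hCr))
      refine hsup _ (fun s hs τ hτ => ?_) hω
      beta_reduce
      rw [mul_div_cancel_left₀ _ hc₀.ne']
      exact (hall s hs τ hτ).1
    · refine (measure_mono fun ω hω hall => ?_).trans
        (h.trans (ENNReal.ofReal_le_ofReal hCr))
      exact hsup _ (fun s hs τ hτ => (hall s hs τ hτ).2) hω
  · have h1 : 1 ≤ (C + 1 / ε₀ ^ 2) * ε ^ θ := by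
      have e1 : ε ^ 2 ≤ ε ^ θ := by
        rw [← Real.rpow_two]
        exact Real.rpow_le_rpow_of_exponent_ge hε0 hε.2 (by linarith [hθ.2])
      calc (1 : ℝ) = 1 / ε₀ ^ 2 * ε₀ ^ 2 := by field_simp
        _ ≤ (C + 1 / ε₀ ^ 2) * ε ^ θ := by
          gcongr
          · linarith
          · refine le_trans ?_ e1
            gcongr
    have h2 : ∀ A : Set Ω, P A ≤ ENNReal.ofReal ((C + 1 / ε₀ ^ 2) * ε ^ θ) := fun A =>
      prob_le_one.trans (by rw [← ENNReal.ofReal_one]; exact ENNReal.ofReal_le_ofReal h1)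
    exact ⟨h2 _, h2 _⟩

end Medium

/-! ### The travel time shift and its derivative in the starting time -/

theorem abs_exp_sub_one_le_mul_exp_abs (x : ℝ) : |Real.exp x - 1| ≤ |x| * Real.exp |x| := by
  have h1 := Real.add_one_le_exp x
  have h2 := Real.add_one_le_exp (-x)
  have h3 : Real.exp (-x) * Real.exp x = 1 := by rw [← Real.exp_add]; simp
  have h4 := Real.exp_pos x
  have h5 : 1 ≤ Real.exp |x| := Real.one_le_exp (abs_nonneg x)
  have h6 : Real.exp x ≤ Real.exp |x| := Real.exp_le_exp.2 (le_abs_self x)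
  rcases le_total 0 x with hx | hx
  · rw [abs_of_nonneg hx] at *
    rw [abs_of_nonneg (by linarith)]
    nlinarith
  · rw [abs_of_nonpos (by linarith [Real.exp_le_one_iff.2 hx])]
    rw [abs_of_nonpos hx] at *
    nlinarith

theorem abs_log_one_add_le {x : ℝ} (hx : |x| ≤ 1 / 2) : |Real.log (1 + x)| ≤ 2 * |x| := by
  obtain ⟨h1, h2⟩ := abs_le.1 hx
  have hp : 0 < 1 + x := by linarith
  have u1 := Real.log_le_sub_one_of_pos hp
  have u2 := Real.one_sub_inv_le_log_of_pos hp
  have u3 : -(2 * |x|) ≤ 1 - (1 + x)⁻¹ := by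
    have : 1 - (1 + x)⁻¹ = x / (1 + x) := by field_simp; ring
    rw [this, le_div_iff₀ hp]
    nlinarith [neg_abs_le x, le_abs_self x, abs_nonneg x]
  exact abs_le.2 ⟨by linarith, by linarith [le_abs_self x, abs_nonneg x]⟩

/-- The scales of the problem: the coefficient `κ = ε ^ (1 - γ)` of the linearized equation and the
size `b = ε ^ ((2 - γ) / 2)` of the residual. -/
theorem scale_relations {ε γ : ℝ} (hε : ε ∈ Ioc (0 : ℝ) 1) (hγ : γ ∈ Icc (0 : ℝ) 1) :
    ε ^ (1 - γ) ∈ Icc (0 : ℝ) 1 ∧ 0 ≤ ε ^ ((2 - γ) / 2) ∧ ε ^ ((2 - γ) / 2) ≤ 1 ∧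
    (ε ^ ((2 - γ) / 2)) ^ 2 = ε * ε ^ (1 - γ) ∧ ε ≤ ε ^ ((2 - γ) / 2) ∧
    ε ^ (1 - γ) * √ε ≤ ε ^ ((2 - γ) / 2) ∧ ε ^ (2 - γ) = ε * ε ^ (1 - γ) ∧
    ε ^ 2 / ε ^ γ = ε * ε ^ (1 - γ) := by
  obtain ⟨h0, h1⟩ := hε
  obtain ⟨g0, g1⟩ := hγ
  have e1 : ε ^ (2 - γ) = ε * ε ^ (1 - γ) := by
    nth_rewrite 2 [← Real.rpow_one ε]
    rw [← Real.rpow_add h0]; congr 1; ring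
  refine ⟨⟨by positivity, Real.rpow_le_one h0.le h1 (by linarith)⟩, by positivity,
    Real.rpow_le_one h0.le h1 (by linarith), ?_, ?_, ?_, e1, ?_⟩
  · rw [← e1, ← Real.rpow_natCast, ← Real.rpow_mul h0.le]; congr 1; push_cast; ring
  · nth_rewrite 1 [← Real.rpow_one ε]
    exact Real.rpow_le_rpow_of_exponent_ge h0 h1 (by linarith)
  · rw [Real.sqrt_eq_rpow, ← Real.rpow_add h0]
    exact Real.rpow_le_rpow_of_exponent_ge h0 h1 (by linarith)
  · rw [← e1, Real.rpow_sub h0, Real.rpow_two]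

theorem hasDerivAt_travelTimeShift {Ω : Type*} [MeasurableSpace Ω] {P : Measure Ω}
    {μ : ℝ → ℝ → Ω → ℝ} (hμ : IsRandomMedium P μ) {K : ℝ} (hK : 1 ≤ K) {ω : Ω}
    (hm : IsBoundedSmooth K (fun t z => μ t z ω) (fun t z => partialT μ t z ω)
      fun t z => partialZ μ t z ω) {α β c₀ ε τ : ℝ} (hα : α ≤ 2) (hε : ε ∈ Ioc (0 : ℝ) 1)
    (hτ : 0 ≤ τ) (s : ℝ) :
    HasDerivAt (fun s => travelTimeShift μ α β c₀ ε τ s ω)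
      (Real.exp (∫ u in (0 : ℝ)..τ, 1 / ε * (ε ^ (2 - α) * partialT μ
        (u / ε ^ α + ε ^ (2 - α) * (s + travelTimeShift μ α β c₀ ε u s ω))
        (c₀ * u / ε ^ β) ω)) - 1) s := by
  have hε0 := hε.1
  have he0 : 0 ≤ ε ^ (2 - α) := by positivity
  have he1 : ε ^ (2 - α) ≤ 1 := Real.rpow_le_one hε0.le hε.2 (by linarith)
  set e : ℝ := ε ^ (2 - α) with he
  have hKε : 1 ≤ 1 / ε * K := by
    rw [one_div_mul_eq_div, le_div_iff₀ hε0]; linarith [hε.2]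
  have hdiff : ∀ u x x' : ℝ, (u / ε ^ α + e * x') - (u / ε ^ α + e * x) = e * (x' - x) :=
    fun u x x' => by ring
  have habs : ∀ x : ℝ, |1 / ε * x| = 1 / ε * |x| := fun x => by
    rw [abs_mul, abs_of_pos (by positivity : 0 < 1 / ε)]
  have hcont : Continuous fun p : ℝ × ℝ => ((p.1 / ε ^ α + e * p.2, c₀ * p.1 / ε ^ β) : ℝ × ℝ) := by
    fun_prop
  refine hasDerivAt_flow (K := 1 / ε * K)
    (f := fun u x => 1 / ε * μ (u / ε ^ α + e * x) (c₀ * u / ε ^ β) ω)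
    (f' := fun u x => 1 / ε * (e * partialT μ (u / ε ^ α + e * x) (c₀ * u / ε ^ β) ω))
    (w := fun s τ => travelTimeShift μ α β c₀ ε τ s ω) hKε
    (continuous_const.mul (hm.continuous.comp hcont))
    (continuous_const.mul (continuous_const.mul (hm.continuous_t.comp hcont)))
    (fun u x x' => ?_) (fun u x => ?_) (fun u x x' => ?_)
    (fun s => (isTravelTimeShift_travelTimeShift hμ α β c₀ ε s ω).1) (fun s τ hτ => ?_) hτ s
  · rw [← mul_sub, habs, mul_assoc]
    refine mul_le_mul_of_nonneg_left ((hm.lip_t _ _ _).trans ?_) (by positivity)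
    rw [hdiff, abs_mul, abs_of_nonneg he0]
    gcongr
    exact mul_le_of_le_one_left (abs_nonneg _) he1
  · rw [habs, abs_mul, abs_of_nonneg he0]
    refine mul_le_mul_of_nonneg_left ?_ (by positivity)
    calc _ ≤ 1 * K := mul_le_mul he1 (hm.bound_t _ _) (abs_nonneg _) zero_le_one
      _ = K := one_mul K
  · have e1 := hm.taylor_t (u / ε ^ α + e * x) (u / ε ^ α + e * x') (c₀ * u / ε ^ β)
    rw [hdiff] at e1
    have e2 : 1 / ε * μ (u / ε ^ α + e * x') (c₀ * u / ε ^ β) ω -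
        1 / ε * μ (u / ε ^ α + e * x) (c₀ * u / ε ^ β) ω -
        (x' - x) * (1 / ε * (e * partialT μ (u / ε ^ α + e * x) (c₀ * u / ε ^ β) ω)) =
        1 / ε * (μ (u / ε ^ α + e * x') (c₀ * u / ε ^ β) ω -
        μ (u / ε ^ α + e * x) (c₀ * u / ε ^ β) ω -
        e * (x' - x) * partialT μ (u / ε ^ α + e * x) (c₀ * u / ε ^ β) ω) := by ring
    rw [e2, habs, mul_assoc (1 / ε)]
    refine mul_le_mul_of_nonneg_left (e1.trans ?_) (by positivity)
    rw [mul_pow]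
    gcongr
    exact mul_le_of_le_one_left (sq_nonneg _) (pow_le_one₀ he0 he1)
  · rw [intervalIntegral.integral_const_mul]
    exact (isTravelTimeShift_travelTimeShift hμ α β c₀ ε s ω).2 τ hτ

/-- The extension of a travel time shift to the line, differentiable at every point of `[0, ∞)`. -/
theorem IsTravelTimeShift.exists_extension {m : ℝ → ℝ → ℝ} (hm : Continuous (Function.uncurry m))
    {α β c₀ ε s : ℝ} {w : ℝ → ℝ} (hw : IsTravelTimeShift m α β c₀ ε s w) :
    ∃ y : ℝ → ℝ, Continuous y ∧ (∀ τ, 0 ≤ τ → y τ = w τ) ∧ ∀ u, 0 ≤ u →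
      HasDerivAt y (1 / ε * m (u / ε ^ α + ε ^ (2 - α) * (s + y u)) (c₀ * u / ε ^ β)) u := by
  refine exists_extension_hasDerivAt
    (F := fun u x => 1 / ε * m (u / ε ^ α + ε ^ (2 - α) * (s + x)) (c₀ * u / ε ^ β)) ?_ hw.1
    fun τ hτ => ?_
  · exact continuous_const.mul (hm.comp (by fun_prop : Continuous fun p : ℝ × ℝ =>
      ((p.1 / ε ^ α + ε ^ (2 - α) * (s + p.2), c₀ * p.1 / ε ^ β) : ℝ × ℝ)))
  · rw [hw.2 τ hτ, intervalIntegral.integral_const_mul]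

/-! ### Slowly changing media -/

/-- In slowly changing media the slow argument is perturbed around the straight path, so that
`exists_shift_error_le` applies with `v u = u` and `ρ = 0`. The second bound is that of the
exponent of `1 + ∂_s 𝒲`, which is `κ M` up to the variation of `mt` over the shift. -/
theorem exists_slow_shift_bounds {K T S : ℝ} (hK : 1 ≤ K) (hT : 0 ≤ T) (hS : 0 ≤ S) :
    ∃ C : ℝ, 1 ≤ C ∧ ∀ (m mt mz : ℝ → ℝ → ℝ) (α c₀ ε s r : ℝ) (w : ℝ → ℝ),
      IsBoundedSmooth K m mt mz → α ∈ Icc (0 : ℝ) 1 → ε ∈ Ioc (0 : ℝ) 1 → s ∈ Icc 0 S → 1 ≤ r →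
      IsTravelTimeShift m α 2 c₀ ε s w →
      HasIntegralBounds ε T r (fun u => m (u / ε ^ α) (c₀ * u / ε ^ 2))
        (fun u => mt (u / ε ^ α) (c₀ * u / ε ^ 2)) →
      ∀ τ ∈ Icc 0 T,
        |w τ - 1 / ε * ∫ u in (0 : ℝ)..τ, m (u / ε ^ α) (c₀ * u / ε ^ 2)| ≤
          C * (ε ^ ((2 - α) / 2) * r + (ε ^ ((2 - α) / 2) * r) ^ 2) ∧
        |∫ u in (0 : ℝ)..τ, 1 / ε * (ε ^ (2 - α) *
          mt (u / ε ^ α + ε ^ (2 - α) * (s + w u)) (c₀ * u / ε ^ (2 : ℝ)))| ≤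
          C * (ε ^ ((2 - α) / 2) * r) := by
  obtain ⟨C, hC, hmain⟩ := exists_shift_error_le hK hT hS T
  have hK0 : 0 ≤ K := by linarith
  have hconst : 0 ≤ T * K * (S + C) := by positivity
  refine ⟨C + (1 + T * K * (S + C)), by linarith,
    fun m mt mz α c₀ ε s r w hm hα hε hs hr hw hI τ hτ => ?_⟩
  obtain ⟨y, hyc, hyw, hyd⟩ := hw.exists_extension hm.continuous
  have hε0 := hε.1
  obtain ⟨hκ, hb0, hb1, hb2, hεb, hκε, hεκ, -⟩ := scale_relations hε hα
  rw [Real.rpow_two]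
  rw [Real.rpow_two, hεκ] at hyd
  rw [hεκ]
  set κ : ℝ := ε ^ (1 - α) with hκdef
  set b : ℝ := ε ^ ((2 - α) / 2) with hbdef
  have hκ0 := hκ.1
  have hpath : Continuous fun u : ℝ => ((u / ε ^ α, c₀ * u / ε ^ 2) : ℝ × ℝ) := by fun_prop
  have hf₀ := hm.continuous.comp hpath
  have hf₁ := hm.continuous_t.comp hpath
  have hy0 : y 0 = 0 := by rw [hyw 0 le_rfl, hw.2 0 le_rfl]; simp
  have habs : ∀ x : ℝ, |1 / ε * x| = 1 / ε * |x| := fun x => by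
    rw [abs_mul, abs_of_pos (by positivity : 0 < 1 / ε)]
  have hall := hmain ε κ b s r _ _ y _ (fun u => u) (fun _ => 1) (fun _ => 0) hε hκ hb0 hb2 hεb
    hκε hs hr hf₀ hf₁ continuous_const hI (fun u _ => hasDerivAt_id u) (fun u hu => hu)
    (fun u hu => hyd u hu.1) hy0 (by simpa using (by positivity : 0 ≤ K * ε))
    (fun u hu => by
      have h1 := hm.taylor_t (u / ε ^ α) (u / ε ^ α + ε * κ * (s + y u)) (c₀ * u / ε ^ 2)
      rw [add_sub_cancel_left] at h1
      have e2 : ∀ A B D : ℝ, 1 / ε * A - 1 * (1 / ε * B + κ * (s + y u) * D) - 0 =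
          1 / ε * (A - B - ε * κ * (s + y u) * D) := fun A B D => by field_simp; ring
      simp only [Function.comp, Function.uncurry]
      rw [e2, habs]
      calc _ ≤ 1 / ε * (K * (ε * κ * (s + y u)) ^ 2) := by gcongr
        _ = _ := by field_simp)
    (fun u hu => by
      have h1 := hm.lip_t (u / ε ^ α) (u / ε ^ α + ε * κ * (s + y u)) (c₀ * u / ε ^ 2)
      rw [add_sub_cancel_left, abs_mul, abs_of_nonneg (by positivity : 0 ≤ ε * κ)] at h1
      simp only [Function.comp, Function.uncurry]
      rw [one_mul, ← mul_sub, habs]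
      calc _ ≤ 1 / ε * (K * (ε * κ * |s + y u|)) := by gcongr
        _ = K * (κ * |s + y u|) := by field_simp
        _ ≤ K * (|s + y u| + 1) := by
          gcongr
          nlinarith [abs_nonneg (s + y u), hκ.2])
  have hy := fun u hu => (hall u hu).1
  obtain ⟨-, h2⟩ := hall τ hτ
  have hbr : 0 ≤ b * r := by positivity
  refine ⟨?_, ?_⟩
  · rw [intervalIntegral.integral_zero, sub_zero, hyw τ hτ.1] at h2
    refine h2.trans ?_
    gcongr
    linarith
  · have e1 : ∫ u in (0 : ℝ)..τ, 1 / ε * (ε * κ * mt (u / ε ^ α + ε * κ * (s + w u))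
        (c₀ * u / ε ^ 2)) = ∫ u in (0 : ℝ)..τ, κ * mt (u / ε ^ α + ε * κ * (s + y u))
        (c₀ * u / ε ^ 2) := by
      refine intervalIntegral.integral_congr fun u hu => ?_
      rw [uIcc_of_le hτ.1] at hu
      simp only [hyw u hu.1]
      field_simp
    have hi1 : IntervalIntegrable (fun u => κ * mt (u / ε ^ α + ε * κ * (s + y u))
        (c₀ * u / ε ^ 2)) volume 0 τ :=
      (continuous_const.mul (hm.continuous_t.comp (by fun_prop : Continuous fun u : ℝ =>
        ((u / ε ^ α + ε * κ * (s + y u), c₀ * u / ε ^ 2) : ℝ × ℝ)))).intervalIntegrable _ _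
    have hi2 : IntervalIntegrable (fun u => κ * mt (u / ε ^ α) (c₀ * u / ε ^ 2)) volume 0 τ :=
      (continuous_const.mul hf₁).intervalIntegrable _ _
    have e2 : |(∫ u in (0 : ℝ)..τ, κ * mt (u / ε ^ α + ε * κ * (s + y u)) (c₀ * u / ε ^ 2)) -
        ∫ u in (0 : ℝ)..τ, κ * mt (u / ε ^ α) (c₀ * u / ε ^ 2)| ≤
        T * K * (S + C) * (b * r) := by
      rw [← intervalIntegral.integral_sub hi1 hi2]
      have h3 := intervalIntegral.norm_integral_le_of_norm_le_const (a := (0 : ℝ)) (b := τ)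
        (C := K * (S + C) * (b * r)) (f := fun u => κ * mt (u / ε ^ α + ε * κ * (s + y u))
          (c₀ * u / ε ^ 2) - κ * mt (u / ε ^ α) (c₀ * u / ε ^ 2)) (fun u hu => by
          rw [uIoc_of_le hτ.1] at hu
          have hu' : u ∈ Icc 0 T := ⟨hu.1.le, hu.2.trans hτ.2⟩
          have h4 := hm.lip_tt (u / ε ^ α) (u / ε ^ α + ε * κ * (s + y u)) (c₀ * u / ε ^ 2)
          rw [add_sub_cancel_left, abs_mul, abs_of_nonneg (by positivity : 0 ≤ ε * κ)] at h4
          have h5 : |s + y u| ≤ (S + C) * r := by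
            refine (abs_add_le _ _).trans ?_
            rw [abs_of_nonneg hs.1, add_mul]
            exact add_le_add (hs.2.trans (le_mul_of_one_le_right hS hr)) (hy u hu')
          rw [← mul_sub, norm_mul, Real.norm_eq_abs, Real.norm_eq_abs, abs_of_nonneg hκ0]
          calc _ ≤ 1 * (K * (ε * κ * ((S + C) * r))) := by
                gcongr
                · exact hκ.2
                · refine h4.trans ?_
                  gcongr
            _ = K * (S + C) * (b * b * r) := by rw [← sq b, hb2]; ring
            _ ≤ K * (S + C) * (1 * b * r) := by gcongr
            _ = _ := by ring)
      rw [sub_zero, abs_of_nonneg hτ.1] at h3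
      refine h3.trans ?_
      calc _ ≤ K * (S + C) * (b * r) * T := by gcongr; exact hτ.2
        _ = _ := by ring
    have e3 : |∫ u in (0 : ℝ)..τ, κ * mt (u / ε ^ α) (c₀ * u / ε ^ 2)| ≤ b * r := by
      rw [intervalIntegral.integral_const_mul, abs_mul, abs_of_nonneg hκ0]
      calc _ ≤ κ * (r * ε) := by gcongr; exact hI.correction τ hτ
        _ ≤ 1 * (r * b) := by gcongr; exact hκ.2
        _ = _ := by ring
    rw [e1]
    have e4 := abs_sub_abs_le_abs_sub
      (∫ u in (0 : ℝ)..τ, κ * mt (u / ε ^ α + ε * κ * (s + y u)) (c₀ * u / ε ^ 2))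
      (∫ u in (0 : ℝ)..τ, κ * mt (u / ε ^ α) (c₀ * u / ε ^ 2))
    have e5 : 0 ≤ C * (b * r) := by positivity
    linarith

/-! ### Rapidly changing media -/

set_option maxHeartbeats 1000000 in
/-- In rapidly changing media the fast argument of the medium is the position `v / ε ^ 2` of the
characteristic. As `v' = 1 + ε μ`, the shift satisfies `y' = v' μ / ε - μ ^ 2` exactly, and
`μ_t / ε` is, up to `c₀ κ μ_z / (1 + ε μ)`, the derivative of `log (1 + ε μ)` along the
characteristic. -/
theorem exists_rapid_shift_bounds {K T S c₀ : ℝ} (hK : 1 ≤ K) (hT : 0 ≤ T) (hS : 0 ≤ S)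
    (hc₀ : 0 < c₀) :
    ∃ C : ℝ, 1 ≤ C ∧ ∀ (m mt mz : ℝ → ℝ → ℝ) (β ε s r : ℝ) (w : ℝ → ℝ),
      IsBoundedSmooth K m mt mz → β ∈ Icc (0 : ℝ) 1 → ε ∈ Ioc (0 : ℝ) 1 → ε * K ≤ 1 / 2 →
      s ∈ Icc 0 S → 1 ≤ r → IsTravelTimeShift m 2 β c₀ ε s w →
      HasIntegralBounds ε (2 * T + S) r (fun u => m (u / ε ^ 2) (c₀ * u / ε ^ β))
        (fun u => -c₀ * mz (u / ε ^ 2) (c₀ * u / ε ^ β)) →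
      ∀ τ ∈ Icc 0 T,
        |w τ - (1 / ε * (∫ u in (0 : ℝ)..τ, m (u / ε ^ 2) (c₀ * u / ε ^ β)) -
          ∫ u in (0 : ℝ)..τ, m (u / ε ^ 2) (c₀ * u / ε ^ β) ^ 2)| ≤
          C * (ε ^ ((2 - β) / 2) * r + (ε ^ ((2 - β) / 2) * r) ^ 2) ∧
        |∫ u in (0 : ℝ)..τ, 1 / ε * (ε ^ ((2 : ℝ) - 2) *
          mt (u / ε ^ (2 : ℝ) + ε ^ ((2 : ℝ) - 2) * (s + w u)) (c₀ * u / ε ^ β))| ≤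
          C * (ε ^ ((2 - β) / 2) * r) := by
  have hK0 : 0 ≤ K := by linarith
  -- the one constant that serves for all the hypotheses of `exists_shift_error_le`
  have hKD : 1 ≤ 2 * K ^ 2 * (1 + c₀) ^ 2 * (1 + S) := by
    have h1 : 1 ≤ K ^ 2 := one_le_pow₀ hK
    have h2 : 1 ≤ (1 + c₀) ^ 2 := one_le_pow₀ (by linarith)
    have h3 : 1 ≤ K ^ 2 * (1 + c₀) ^ 2 := one_le_mul_of_one_le_of_one_le h1 h2
    have h4 : 1 ≤ K ^ 2 * (1 + c₀) ^ 2 * (1 + S) :=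
      one_le_mul_of_one_le_of_one_le h3 (by linarith)
    linarith
  have hKD1 : K ^ 2 ≤ 2 * K ^ 2 * (1 + c₀) ^ 2 * (1 + S) := by
    have h2 : 1 ≤ (1 + c₀) ^ 2 * (1 + S) :=
      one_le_mul_of_one_le_of_one_le (one_le_pow₀ (by linarith)) (by linarith)
    nlinarith [mul_le_mul_of_nonneg_left h2 (sq_nonneg K), sq_nonneg K]
  have hKD2 : 2 * K * c₀ ≤ 2 * K ^ 2 * (1 + c₀) ^ 2 * (1 + S) := by
    have h2 : c₀ * 1 ≤ (1 + c₀) ^ 2 * (1 + S) :=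
      mul_le_mul (by nlinarith) (by linarith) zero_le_one (by positivity)
    have h3 : K ≤ K ^ 2 := by nlinarith
    calc 2 * K * c₀ = 2 * K * (c₀ * 1) := by ring
      _ ≤ 2 * K ^ 2 * ((1 + c₀) ^ 2 * (1 + S)) := by gcongr
      _ = _ := by ring
  have hKD3 : 2 * K * c₀ ^ 2 ≤ 2 * K ^ 2 * (1 + c₀) ^ 2 * (1 + S) := by
    have h2 : c₀ ^ 2 * 1 ≤ (1 + c₀) ^ 2 * (1 + S) :=
      mul_le_mul (by nlinarith) (by linarith) zero_le_one (by positivity)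
    have h3 : K ≤ K ^ 2 := by nlinarith
    calc 2 * K * c₀ ^ 2 = 2 * K * (c₀ ^ 2 * 1) := by ring
      _ ≤ 2 * K ^ 2 * ((1 + c₀) ^ 2 * (1 + S)) := by gcongr
      _ = _ := by ring
  have hKD4 : K * S ≤ 2 * K ^ 2 * (1 + c₀) ^ 2 * (1 + S) := by
    have h2 : 1 * S ≤ (1 + c₀) ^ 2 * (1 + S) :=
      mul_le_mul (one_le_pow₀ (by linarith)) (by linarith) hS (by positivity)
    have h3 : K ≤ 2 * K ^ 2 := by nlinarith
    calc K * S = K * (1 * S) := by ring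
      _ ≤ 2 * K ^ 2 * ((1 + c₀) ^ 2 * (1 + S)) := by gcongr
      _ = _ := by ring
  set L : ℝ := 2 * K ^ 2 * (1 + c₀) ^ 2 * (1 + S) with hL
  obtain ⟨C, hC, hmain⟩ := exists_shift_error_le hKD hT hS (2 * T + S)
  set N : ℝ := S + C with hN
  have hN0 : 0 ≤ N := by linarith
  set C₁ : ℝ := K * N + (T * (2 * K ^ 2 * c₀ * N + K ^ 3) + K ^ 2 * N + K ^ 2 * S) with hC₁
  set C₂ : ℝ := T * (c₀ * (5 * K ^ 2 + 2 * K * c₀ * N)) + 4 * K + 2 with hC₂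
  have hC₁0 : 0 ≤ C₁ := by positivity
  have hC₂0 : 0 ≤ C₂ := by positivity
  refine ⟨C + C₁ + C₂, by linarith,
    fun m mt mz β ε s r w hm hβ hε hεK hs hr hw hI τ hτ => ?_⟩
  obtain ⟨y, hyc, hyw, hyd⟩ := hw.exists_extension hm.continuous
  have hε0 := hε.1
  have hr0 : 0 ≤ r := by linarith
  obtain ⟨hκ, hb0, hb1, hb2, hεb, hκε, -, hεκ⟩ := scale_relations hε hβ
  simp only [sub_self, Real.rpow_zero, Real.rpow_two, one_mul] at hyd ⊢
  set κ : ℝ := ε ^ (1 - β) with hκdef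
  set b : ℝ := ε ^ ((2 - β) / 2) with hbdef
  have hκ0 := hκ.1
  have hεβ : 0 < ε ^ β := Real.rpow_pos_of_pos hε0 _
  have hy0 : y 0 = 0 := by rw [hyw 0 le_rfl, hw.2 0 le_rfl]; simp
  set v : ℝ → ℝ := fun u => u + ε ^ 2 * (s + y u) with hv
  set A : ℝ → ℝ := fun u => m (v u / ε ^ 2) (c₀ * u / ε ^ β) with hA
  set f₀ : ℝ → ℝ := fun u => m (u / ε ^ 2) (c₀ * u / ε ^ β) with hf₀
  set f₁ : ℝ → ℝ := fun u => -c₀ * mz (u / ε ^ 2) (c₀ * u / ε ^ β) with hf₁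
  have hpt : ∀ u, u / ε ^ 2 + (s + y u) = v u / ε ^ 2 := fun u => by
    simp only [hv]; field_simp
  simp only [hpt] at hyd
  have hvc : Continuous v := by simp only [hv]; fun_prop
  have hpath : Continuous fun u : ℝ => ((v u / ε ^ 2, c₀ * u / ε ^ β) : ℝ × ℝ) := by fun_prop
  have hpath₀ : Continuous fun u : ℝ => ((u / ε ^ 2, c₀ * u / ε ^ β) : ℝ × ℝ) := by fun_prop
  have hAc : Continuous A := hm.continuous.comp hpath
  have hf₀c : Continuous f₀ := hm.continuous.comp hpath₀
  have hf₁c : Continuous f₁ := continuous_const.mul (hm.continuous_z.comp hpath₀)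
  have hAb : ∀ u, |A u| ≤ K := fun u => hm.bound _ _
  have hf₀b : ∀ u, |f₀ u| ≤ K := fun u => hm.bound _ _
  have hφ : ∀ u, |ε * A u| ≤ ε * K := fun u => by
    rw [abs_mul, abs_of_pos hε0]; exact mul_le_mul_of_nonneg_left (hAb u) hε0.le
  have habs : ∀ x : ℝ, |1 / ε * x| = 1 / ε * |x| := fun x => by
    rw [abs_mul, abs_of_pos (by positivity : 0 < 1 / ε)]
  have hvd : ∀ u, 0 ≤ u → HasDerivAt v (1 + ε * A u) u := fun u hu =>
    ((hasDerivAt_id u).add (((hyd u hu).const_add s).const_mul (ε ^ 2))).congr_deriv (by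
      simp only [hA]; field_simp)
  -- as `ε K ≤ 1 / 2`, the path `v` stays nonnegative, where the bounds on the integrals hold
  have hyu : ∀ u ∈ Icc 0 T, |y u| ≤ K / ε * u := by
    intro u hu
    have h1 := norm_image_sub_le_of_norm_deriv_le_segment' (f := y) (a := 0) (b := T)
      (C := K / ε) (fun x hx => (hyd x hx.1).hasDerivWithinAt) (fun x hx => by
        rw [Real.norm_eq_abs, habs, one_div_mul_eq_div]
        exact div_le_div_of_nonneg_right (hAb x) hε0.le) u hu
    rwa [hy0, sub_zero, sub_zero] at h1
  have hvm : ∀ u ∈ Icc 0 T, v u ∈ Icc 0 (2 * T + S) := by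
    intro u hu
    have h1 : |ε ^ 2 * y u| ≤ 1 / 2 * u := by
      rw [abs_mul, abs_of_pos (by positivity : 0 < ε ^ 2)]
      calc ε ^ 2 * |y u| ≤ ε ^ 2 * (K / ε * u) := by gcongr; exact hyu u hu
        _ = ε * K * u := by field_simp
        _ ≤ 1 / 2 * u := by gcongr; exact hu.1
    have h2 : ε ^ 2 * s ≤ S := (mul_le_of_le_one_left hs.1 (pow_le_one₀ hε0.le hε.2)).trans hs.2
    have h3 : 0 ≤ ε ^ 2 * s := mul_nonneg (by positivity) hs.1
    have h4 : v u = u + (ε ^ 2 * s + ε ^ 2 * y u) := by simp only [hv]; ring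
    obtain ⟨h5, h6⟩ := abs_le.1 h1
    rw [h4]
    constructor <;> linarith [hu.1, hu.2]
  -- the slow argument differs from its value on the straight path through `v` by `c₀ ε κ (s + y)`
  have hz : ∀ u, c₀ * u / ε ^ β - c₀ * v u / ε ^ β = -(c₀ * (ε * κ) * (s + y u)) := fun u => by
    rw [← hεκ]; simp only [hv]; field_simp; ring
  have hzabs : ∀ u, |c₀ * u / ε ^ β - c₀ * v u / ε ^ β| = c₀ * (ε * κ) * |s + y u| := fun u => by
    rw [hz, abs_neg, abs_mul, abs_of_nonneg (by positivity : 0 ≤ c₀ * (ε * κ))]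
  have hAf : ∀ u, |A u - f₀ (v u)| ≤ K * (c₀ * (ε * κ) * |s + y u|) := fun u => by
    rw [← hzabs]; exact hm.lip_z _ _ _
  have hv0 : v 0 = ε ^ 2 * s := by simp only [hv, hy0]; ring
  have hW0 : ∀ x x', |(∫ u in (0 : ℝ)..x', f₀ u) - ∫ u in (0 : ℝ)..x, f₀ u| ≤ K * |x' - x| :=
    abs_sub_le_of_deriv_bound (hasDerivAt_integral_of_continuous hf₀c) hf₀b
  have hsq_b : ∀ u, |f₀ u ^ 2| ≤ K ^ 2 := fun u => by
    rw [abs_pow]; exact pow_le_pow_left₀ (abs_nonneg _) (hf₀b u) 2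
  have hQ0 : ∀ x x', |(∫ u in (0 : ℝ)..x', f₀ u ^ 2) - ∫ u in (0 : ℝ)..x, f₀ u ^ 2| ≤
      K ^ 2 * |x' - x| :=
    abs_sub_le_of_deriv_bound (hasDerivAt_integral_of_continuous (hf₀c.pow 2)) hsq_b
  have h1A : ∀ u, |1 + ε * A u| ≤ 2 := fun u => by
    have := hφ u
    refine (abs_add_le _ _).trans ?_
    rw [abs_one]; linarith
  have hall := hmain ε κ b s r f₀ f₁ y _ v (fun u => 1 + ε * A u) (fun u => -(A u ^ 2)) hε hκ hb0
    hb2 hεb hκε hs hr hf₀c hf₁c (hAc.pow 2).neg hI (fun u hu => hvd u hu.1) hvm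
    (fun u hu => hyd u hu.1) hy0 (by
      have h1 := hW0 0 (v 0)
      rw [intervalIntegral.integral_same, sub_zero, sub_zero, hv0,
        abs_of_nonneg (mul_nonneg (by positivity) hs.1)] at h1
      rw [habs, hv0]
      calc _ ≤ 1 / ε * (K * (ε ^ 2 * s)) := by gcongr
        _ = K * s * ε := by field_simp
        _ ≤ K * S * ε := by gcongr; exact hs.2
        _ ≤ _ := by gcongr)
    (fun u hu => by
      have h1 := hm.taylor_z (v u / ε ^ 2) (c₀ * v u / ε ^ β) (c₀ * u / ε ^ β)
      have e2 : 1 / ε * A u - (1 + ε * A u) * (1 / ε * f₀ (v u) + κ * (s + y u) * f₁ (v u)) -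
          -(A u ^ 2) = (1 + ε * A u) * (1 / ε * (A u - f₀ (v u) -
            (c₀ * u / ε ^ β - c₀ * v u / ε ^ β) * mz (v u / ε ^ 2) (c₀ * v u / ε ^ β))) := by
        rw [hz]; simp only [hf₁]; field_simp; ring
      change |1 / ε * A u - _ - _| ≤ _
      rw [e2, abs_mul, habs]
      calc _ ≤ 2 * (1 / ε * (K * (c₀ * u / ε ^ β - c₀ * v u / ε ^ β) ^ 2)) := by
            gcongr
            · exact h1A u
        _ = 2 * K * c₀ ^ 2 * (ε * κ ^ 2) * (s + y u) ^ 2 := by rw [hz]; field_simp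
        _ ≤ _ := by gcongr)
    (fun u hu => by
      have e2 : 1 / ε * A u - (1 + ε * A u) * (1 / ε * f₀ (v u)) =
          (1 + ε * A u) * (1 / ε * (A u - f₀ (v u))) - A u ^ 2 := by field_simp; ring
      have e3 : |A u ^ 2| ≤ K ^ 2 := by
        rw [abs_pow]; exact pow_le_pow_left₀ (abs_nonneg _) (hAb u) 2
      change |1 / ε * A u - _| ≤ _
      rw [e2]
      refine (abs_sub _ _).trans ?_
      rw [abs_mul, habs]
      calc _ ≤ 2 * (1 / ε * (K * (c₀ * (ε * κ) * |s + y u|))) + K ^ 2 := by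
            gcongr
            · exact h1A u
            · exact hAf u
        _ = 2 * K * c₀ * (κ * |s + y u|) + K ^ 2 := by field_simp
        _ ≤ L * (1 * |s + y u|) + L := by gcongr; exact hκ.2
        _ = _ := by ring)
  have hsy : ∀ u ∈ Icc 0 T, |s + y u| ≤ N * r := fun u hu => by
    refine (abs_add_le _ _).trans ?_
    rw [abs_of_nonneg hs.1, hN, add_mul]
    exact add_le_add (hs.2.trans (le_mul_of_one_le_right hS hr)) (hall u hu).1
  obtain ⟨-, h2⟩ := hall τ hτ
  have hbr : 0 ≤ b * r := by positivity
  have hεbr : ε ≤ b * r := hεb.trans (le_mul_of_one_le_right hb0 hr)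
  have hεr : ε * r ≤ b * r := by gcongr
  have hεκb : ε * κ ≤ b := by rw [← hb2, sq]; exact mul_le_of_le_one_left hb0 hb1
  have hε2 : ε ^ 2 ≤ ε := by rw [sq]; exact mul_le_of_le_one_left hε0.le hε.2
  have h0T : (0 : ℝ) ∈ Icc 0 T := ⟨le_rfl, hT⟩
  have hvτ : |v τ - τ| ≤ ε ^ 2 * (N * r) := by
    have : v τ - τ = ε ^ 2 * (s + y τ) := by simp only [hv]; ring
    rw [this, abs_mul, abs_of_pos (by positivity : 0 < ε ^ 2)]
    gcongr
    exact hsy τ hτ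
  have hvτ' : |v τ - τ| ≤ N * (b * r) := hvτ.trans (by
    calc ε ^ 2 * (N * r) = N * (ε ^ 2 * r) := by ring
      _ ≤ N * (b * r) := by gcongr; exact hε2.trans hεb)
  refine ⟨?_, ?_⟩
  · have d1 : |1 / ε * (∫ u in (0 : ℝ)..v τ, f₀ u) - 1 / ε * ∫ u in (0 : ℝ)..τ, f₀ u| ≤
        K * N * (b * r) := by
      rw [← mul_sub, habs]
      calc _ ≤ 1 / ε * (K * (ε ^ 2 * (N * r))) := by
            gcongr
            exact (hW0 _ _).trans (by gcongr)
        _ = K * N * (ε * r) := by field_simp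
        _ ≤ _ := by gcongr
    -- `∫ μ ^ 2` along the characteristic becomes an integral over the straight path by the
    -- substitution `x = v u`, whose Jacobian `1 + ε μ` costs `O(ε)`
    have hQd : ∀ u ∈ Icc 0 T, HasDerivAt
        (fun u => (∫ x in (0 : ℝ)..v u, f₀ x ^ 2) - ∫ x in (0 : ℝ)..u, A x ^ 2)
        (f₀ (v u) ^ 2 * (1 + ε * A u) - A u ^ 2) u := fun u hu =>
      ((hasDerivAt_integral_of_continuous (hf₀c.pow 2) (v u)).comp u (hvd u hu.1)).sub
        (hasDerivAt_integral_of_continuous (hAc.pow 2) u)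
    have d2 := norm_image_sub_le_of_norm_deriv_le_segment' (a := 0) (b := T)
      (C := (2 * K ^ 2 * c₀ * N + K ^ 3) * (b * r))
      (fun u hu => (hQd u hu).hasDerivWithinAt) (fun u hu => by
        have hu' := Ico_subset_Icc_self hu
        have e1 : f₀ (v u) ^ 2 * (1 + ε * A u) - A u ^ 2 =
            -((A u - f₀ (v u)) * (A u + f₀ (v u))) + ε * A u * f₀ (v u) ^ 2 := by ring
        have e2 : |A u + f₀ (v u)| ≤ 2 * K :=
          (abs_add_le _ _).trans (by linarith [hAb u, hf₀b (v u)])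
        rw [Real.norm_eq_abs, e1]
        refine (abs_add_le _ _).trans ?_
        rw [abs_neg, abs_mul, abs_mul (ε * A u)]
        calc _ ≤ K * (c₀ * (ε * κ) * (N * r)) * (2 * K) + ε * K * K ^ 2 := by
              gcongr
              · refine (hAf u).trans ?_
                gcongr
                exact hsy u hu'
              · exact hφ u
              · exact hsq_b _
          _ ≤ K * (c₀ * b * (N * r)) * (2 * K) + (b * r) * K * K ^ 2 := by gcongr
          _ = _ := by ring) τ hτ
    rw [intervalIntegral.integral_same, sub_zero, sub_zero, Real.norm_eq_abs] at d2
    have d3 : (2 * K ^ 2 * c₀ * N + K ^ 3) * (b * r) * τ ≤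
        T * (2 * K ^ 2 * c₀ * N + K ^ 3) * (b * r) := by
      calc _ ≤ (2 * K ^ 2 * c₀ * N + K ^ 3) * (b * r) * T := by gcongr; exact hτ.2
        _ = _ := by ring
    have d4 : |(∫ u in (0 : ℝ)..v τ, f₀ u ^ 2) - ∫ u in (0 : ℝ)..τ, f₀ u ^ 2| ≤
        K ^ 2 * N * (b * r) := by
      refine (hQ0 _ _).trans ?_
      rw [mul_assoc]
      gcongr
    have d5 : |∫ u in (0 : ℝ)..v 0, f₀ u ^ 2| ≤ K ^ 2 * S * (b * r) := by
      have h1 := hQ0 0 (v 0)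
      rw [intervalIntegral.integral_same, sub_zero, sub_zero, hv0,
        abs_of_nonneg (mul_nonneg (by positivity) hs.1)] at h1
      rw [hv0]
      refine h1.trans ?_
      calc K ^ 2 * (ε ^ 2 * s) = K ^ 2 * s * ε ^ 2 := by ring
        _ ≤ K ^ 2 * S * (b * r) := by
          gcongr
          · exact hs.2
          · exact hε2.trans hεbr
    rw [intervalIntegral.integral_neg, hyw τ hτ.1] at h2
    have t1 : w τ - (1 / ε * (∫ u in (0 : ℝ)..τ, f₀ u) - ∫ u in (0 : ℝ)..τ, f₀ u ^ 2) =
        (w τ - 1 / ε * (∫ u in (0 : ℝ)..v τ, f₀ u) - -∫ u in (0 : ℝ)..τ, A u ^ 2) +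
        (1 / ε * (∫ u in (0 : ℝ)..v τ, f₀ u) - 1 / ε * ∫ u in (0 : ℝ)..τ, f₀ u) +
        ((∫ u in (0 : ℝ)..v τ, f₀ u ^ 2) - (∫ u in (0 : ℝ)..τ, A u ^ 2) -
          ∫ u in (0 : ℝ)..v 0, f₀ u ^ 2) -
        ((∫ u in (0 : ℝ)..v τ, f₀ u ^ 2) - ∫ u in (0 : ℝ)..τ, f₀ u ^ 2) +
        (∫ u in (0 : ℝ)..v 0, f₀ u ^ 2) := by ring
    rw [t1]
    have p1 : 0 ≤ (C₁ + C₂) * (b * r) ^ 2 := by positivity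
    have p2 : 0 ≤ C₂ * (b * r) := by positivity
    refine (abs_add_le _ _).trans ((add_le_add ((abs_sub _ _).trans (add_le_add
      ((abs_add_le _ _).trans (add_le_add ((abs_add_le _ _).trans (add_le_add h2 d1))
        (d2.trans d3))) d4)) d5).trans ?_)
    have p3 : C₁ * (b * r) = K * N * (b * r) + (T * (2 * K ^ 2 * c₀ * N + K ^ 3) * (b * r) +
      K ^ 2 * N * (b * r) + K ^ 2 * S * (b * r)) := by rw [hC₁]; ring
    linarith
  · have e1 : ∫ u in (0 : ℝ)..τ, 1 / ε * mt (u / ε ^ 2 + (s + w u)) (c₀ * u / ε ^ β) =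
        ∫ u in (0 : ℝ)..τ, 1 / ε * mt (v u / ε ^ 2) (c₀ * u / ε ^ β) := by
      refine intervalIntegral.integral_congr fun u hu => ?_
      rw [uIcc_of_le hτ.1] at hu
      simp only [← hyw u hu.1, hpt]
    rw [e1]
    have hIc : Continuous fun u => 1 / ε * mt (v u / ε ^ 2) (c₀ * u / ε ^ β) :=
      continuous_const.mul (hm.continuous_t.comp hpath)
    have hpos : ∀ u, 1 / 2 ≤ 1 + ε * A u := fun u => by
      have := (abs_le.1 (hφ u)).1; linarith
    set M : ℝ → ℝ := fun x => ∫ u in (0 : ℝ)..x, f₁ u with hM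
    have hΨd : ∀ u ∈ Icc 0 T, HasDerivAt
        (fun u => (∫ x in (0 : ℝ)..u, 1 / ε * mt (v x / ε ^ 2) (c₀ * x / ε ^ β)) -
          Real.log (1 + ε * A u) - κ * M (v u))
        (κ * c₀ * (mz (v u / ε ^ 2) (c₀ * v u / ε ^ β) * (1 + ε * A u) -
          mz (v u / ε ^ 2) (c₀ * u / ε ^ β) / (1 + ε * A u))) u := by
      intro u hu
      have dz : HasDerivAt (fun u => c₀ * u / ε ^ β) (c₀ / ε ^ β) u :=
        (((hasDerivAt_id u).const_mul c₀).div_const (ε ^ β)).congr_deriv (by rw [mul_one])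
      have dA := hm.hasDerivAt_comp ((hvd u hu.1).div_const (ε ^ 2)) dz
      have dlog := ((dA.const_mul ε).const_add 1).log (by
        have := hpos u
        change 1 + ε * A u ≠ 0
        linarith)
      have dM := (hasDerivAt_integral_of_continuous hf₁c (v u)).comp u (hvd u hu.1)
      refine (((hasDerivAt_integral_of_continuous hIc u).sub dlog).sub
        (dM.const_mul κ)).congr_deriv ?_
      have hne : 1 + ε * A u ≠ 0 := by linarith [hpos u]
      have hβκ : c₀ / ε ^ β = c₀ * κ / ε := by
        have : ε / ε ^ β = κ := by
          have h1 : ε * (ε / ε ^ β) = ε * κ := by rw [← hεκ]; ring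
          exact mul_left_cancel₀ hε0.ne' h1
        rw [← this]; field_simp
      have hAu : m (v u / ε ^ 2) (c₀ * u / ε ^ β) = A u := rfl
      rw [hβκ, hAu]
      simp only [hf₁]
      field_simp
      ring
    have hΨ := norm_image_sub_le_of_norm_deriv_le_segment' (a := 0) (b := T)
      (C := c₀ * (5 * K ^ 2 + 2 * K * c₀ * N) * (b * r))
      (fun u hu => (hΨd u hu).hasDerivWithinAt) (fun u hu => by
        have hu' := Ico_subset_Icc_self hu
        set z₁ : ℝ := mz (v u / ε ^ 2) (c₀ * u / ε ^ β) with hz₁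
        set z₂ : ℝ := mz (v u / ε ^ 2) (c₀ * v u / ε ^ β) with hz₂
        have hp := hpos u
        have hp0 : 0 < 1 + ε * A u := by linarith
        have e2 : z₂ * (1 + ε * A u) - z₁ / (1 + ε * A u) =
            -((z₁ - z₂) * (1 + ε * A u)) +
              z₁ * ((ε * A u) * (2 + ε * A u) / (1 + ε * A u)) := by
          field_simp; ring
        have e3 : |z₁ - z₂| ≤ K * (c₀ * (ε * κ) * (N * r)) := by
          refine (hm.lip_zz _ _ _).trans ?_
          rw [hzabs]
          gcongr
          exact hsy u hu'
        have e4 : |(ε * A u) * (2 + ε * A u) / (1 + ε * A u)| ≤ 5 * (ε * K) := by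
          rw [abs_div, abs_of_pos hp0, div_le_iff₀ hp0, abs_mul]
          have e5 : |2 + ε * A u| ≤ 5 / 2 :=
            (abs_add_le _ _).trans (by rw [abs_two]; linarith [hφ u])
          have e6 : 0 ≤ ε * K := by positivity
          calc _ ≤ ε * K * (5 / 2) := mul_le_mul (hφ u) e5 (abs_nonneg _) e6
            _ = 5 * (ε * K) * (1 / 2) := by ring
            _ ≤ _ := by gcongr
        rw [Real.norm_eq_abs, e2, abs_mul, abs_of_nonneg (by positivity : 0 ≤ κ * c₀)]
        have e7 : |-((z₁ - z₂) * (1 + ε * A u)) +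
            z₁ * ((ε * A u) * (2 + ε * A u) / (1 + ε * A u))| ≤
            K * (c₀ * b * (N * r)) * 2 + K * (5 * ((b * r) * K)) := by
          refine (abs_add_le _ _).trans ?_
          rw [abs_neg, abs_mul, abs_mul z₁]
          calc _ ≤ K * (c₀ * (ε * κ) * (N * r)) * 2 + K * (5 * (ε * K)) := by
                gcongr
                · exact h1A u
                · exact hm.bound_z _ _
            _ ≤ _ := by gcongr
        calc _ ≤ 1 * c₀ * (K * (c₀ * b * (N * r)) * 2 + K * (5 * ((b * r) * K))) := by
              gcongr
              exact hκ.2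
          _ = _ := by ring) τ hτ
    rw [intervalIntegral.integral_same, sub_zero, Real.norm_eq_abs] at hΨ
    have hΨ' : c₀ * (5 * K ^ 2 + 2 * K * c₀ * N) * (b * r) * τ ≤
        T * (c₀ * (5 * K ^ 2 + 2 * K * c₀ * N)) * (b * r) := by
      calc _ ≤ c₀ * (5 * K ^ 2 + 2 * K * c₀ * N) * (b * r) * T := by gcongr; exact hτ.2
        _ = _ := by ring
    have hlog : ∀ u, |Real.log (1 + ε * A u)| ≤ 2 * K * (b * r) := fun u => by
      refine (abs_log_one_add_le ((hφ u).trans hεK)).trans ?_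
      calc 2 * |ε * A u| ≤ 2 * ((b * r) * K) := by
            gcongr
            exact (hφ u).trans (by gcongr)
        _ = _ := by ring
    have hMb : ∀ u ∈ Icc 0 T, |κ * M (v u)| ≤ b * r := fun u hu => by
      rw [abs_mul, abs_of_nonneg hκ0]
      calc κ * |M (v u)| ≤ 1 * (r * ε) := by
            gcongr
            · exact hκ.2
            · exact hI.correction _ (hvm u hu)
        _ = ε * r := by ring
        _ ≤ _ := hεr
    have l0 := hlog 0
    have lτ := hlog τ
    have m0 := hMb 0 h0T
    have mτ := hMb τ hτ
    have hb' := abs_le.1 (hΨ.trans hΨ')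
    have l0' := abs_le.1 l0
    have lτ' := abs_le.1 lτ
    have m0' := abs_le.1 m0
    have mτ' := abs_le.1 mτ
    have p3 : C₂ * (b * r) = T * (c₀ * (5 * K ^ 2 + 2 * K * c₀ * N)) * (b * r) +
      2 * (2 * K * (b * r)) + 2 * (b * r) := by rw [hC₂]; ring
    have p4 : 0 ≤ (C + C₁) * (b * r) := by positivity
    rw [abs_le]
    constructor
    · linarith [hb'.1, hb'.2, l0'.1, l0'.2, lτ'.1, lτ'.2, m0'.1, m0'.2, mτ'.1, mτ'.2]
    · linarith [hb'.1, hb'.2, l0'.1, l0'.2, lτ'.1, lτ'.2, m0'.1, m0'.2, mτ'.1, mτ'.2]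

/-! ### Rates of the residual and of the derivative -/

section Medium

variable {Ω : Type*} [m : MeasurableSpace Ω] {P : Measure Ω} {μ : ℝ → ℝ → Ω → ℝ}

/-- The rates follow from the deterministic bounds, of strength `A r`, on events `G ε r` whose
complement has probability at most `A / r ^ 2`. The exponent `I` is that of `1 + ∂_s 𝒲`. -/
theorem splitsWithRate_of_events [IsProbabilityMeasure P] {c₀ S T γ : ℝ} (hc₀ : 0 < c₀)
    (hγ : γ ∈ Icc (0 : ℝ) 1) {𝒲 I : ℝ → ℝ → ℝ → Ω → ℝ} {W : ℝ → ℝ → Ω → ℝ}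
    (hder : ∀ ε ∈ Ioc (0 : ℝ) 1, ∀ τ ∈ Icc 0 T, ∀ s ∈ Icc 0 S, ∀ ω,
      HasDerivAt (fun s' => 𝒲 ε τ s' ω) (Real.exp (I ε τ s ω) - 1) s)
    {A B ε₀ : ℝ} (hA : 1 ≤ A) (hB : 1 ≤ B) (hε₀ : 0 < ε₀) {G : ℝ → ℝ → Ω → Prop}
    (hG : ∀ ε ∈ Ioc (0 : ℝ) 1, ∀ r, 1 ≤ r → P {ω | ¬ G ε r ω} ≤ ENNReal.ofReal (A / r ^ 2))
    (hgood : ∀ ε ∈ Ioc (0 : ℝ) 1, ε ≤ ε₀ → ∀ r, 1 ≤ r → ∀ ω, G ε r ω →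
      ∀ s ∈ Icc 0 S, ∀ τ ∈ Icc 0 T,
        |𝒲 ε τ s ω - W ε τ ω| ≤ B * (ε ^ ((2 - γ) / 2) * (A * r) +
          (ε ^ ((2 - γ) / 2) * (A * r)) ^ 2) ∧
        |I ε τ s ω| ≤ B * (ε ^ ((2 - γ) / 2) * (A * r))) :
    SplitsWithRate P c₀ S T γ 𝒲 W := by
  have hA0 : 0 ≤ A := by linarith
  have hB0 : 0 ≤ B := by linarith
  have hE := Real.exp_pos (B * A)
  have q1 : 0 ≤ B * (A + A ^ 2) := by positivity
  have q2 : 0 ≤ B * A * Real.exp (B * A) := by positivity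
  refine splitsWithRate_of_bounds hc₀ hγ.1
    (fun ε hε τ hτ s hs ω => (hder ε hε τ hτ s hs ω).differentiableAt)
    (C := A + (B * (A + A ^ 2) + B * A * Real.exp (B * A))) (by linarith) hε₀
    fun ε hε hle r hr hbr => ?_
  refine (measure_mono fun ω hω hGω => ?_).trans ((hG ε hε r hr).trans
    (ENNReal.ofReal_le_ofReal (div_le_div_of_nonneg_right (by linarith) (sq_nonneg r))))
  refine hω fun s hs τ hτ => ?_
  obtain ⟨h1, h2⟩ := hgood ε hε hle r hr ω hGω s hs τ hτ
  have hb0 : 0 ≤ ε ^ ((2 - γ) / 2) := Real.rpow_nonneg hε.1.le _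
  have e1 : ε ^ ((2 - γ) / 2) * (A * r) = A * (ε ^ ((2 - γ) / 2) * r) := by ring
  rw [e1] at h1 h2
  set x : ℝ := ε ^ ((2 - γ) / 2) * r with hx
  have hx0 : 0 ≤ x := mul_nonneg hb0 (by linarith)
  constructor
  · calc _ ≤ B * (A * x + (A * x) ^ 2) := h1
      _ = B * (A * x + A ^ 2 * (x * x)) := by ring
      _ ≤ B * (A * x + A ^ 2 * (1 * x)) := by gcongr
      _ = B * (A + A ^ 2) * x := by ring
      _ ≤ _ := by gcongr; linarith
  · rw [(hder ε hε τ hτ s hs ω).deriv]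
    have h3 : |I ε τ s ω| ≤ B * A := h2.trans (by
      calc B * (A * x) ≤ B * (A * 1) := by gcongr
        _ = B * A := by ring)
    calc _ ≤ |I ε τ s ω| * Real.exp |I ε τ s ω| := abs_exp_sub_one_le_mul_exp_abs _
      _ ≤ B * (A * x) * Real.exp (B * A) := by gcongr
      _ = B * A * Real.exp (B * A) * x := by ring
      _ ≤ _ := by gcongr; linarith

theorem splitsWithRate_slowShift [IsProbabilityMeasure P] (hμ : IsRandomMedium P μ)
    {c₀ S T α : ℝ} (hc₀ : 0 < c₀) (hS : 0 < S) (hT : 0 < T) (hα : α ∈ Icc (0 : ℝ) 1)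
    (h0 : MixesInRange P μ μ) (h1 : MixesInRange P μ (partialT μ)) :
    SplitsWithRate P c₀ S T α (fun ε τ s ω => travelTimeShift μ α 2 c₀ ε τ s ω)
      fun ε τ ω => slowShift μ α c₀ ε τ ω := by
  obtain ⟨K, hK, hsm⟩ := hμ.exists_isBoundedSmooth
  have hdiff : ∀ z t ω, DifferentiableAt ℝ (fun t => μ t z ω) t := fun z t ω =>
    (hasDerivAt_fst_fderiv (hμ.contDiff ω) t z).differentiableAt
  obtain ⟨L₀, hL₀⟩ := h0.exists_isMixing hμ.measurable hμ.measurable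
    (fun t z hz => measurable_rangeHistory μ t hz) (fun ω => (hsm ω).continuous)
    (fun t z ω => (hsm ω).bound t z) hc₀
  obtain ⟨L₁, hL₁⟩ := h1.exists_isMixing hμ.measurable
    (fun t z => measurable_deriv_rangeHistory (fun t => hμ.measurable t z) (hdiff z) t)
    (fun t z hz => measurable_deriv_rangeHistory (fun t => measurable_rangeHistory μ t hz)
      (hdiff z) t) (fun ω => (hsm ω).continuous_t) (fun t z ω => (hsm ω).bound_t t z) hc₀
  set L : ℝ := max 0 (max L₀ L₁) with hL
  obtain ⟨A, hA, hprob⟩ := exists_measure_not_hasIntegralBounds_le P (K := L) (T := T)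
    (le_max_left _ _) hT
  obtain ⟨B, hB, hdet⟩ := exists_slow_shift_bounds hK hT.le hS.le
  refine splitsWithRate_of_events hc₀ hα
    (fun ε hε τ hτ s _ ω => hasDerivAt_travelTimeShift hμ hK (hsm ω)
      (hα.2.trans one_le_two) hε hτ.1 s) hA hB one_pos
    (G := fun ε r ω => HasIntegralBounds ε T (A * r) (fun u => μ (u / ε ^ α) (c₀ * u / ε ^ 2) ω)
      fun u => partialT μ (u / ε ^ α) (c₀ * u / ε ^ 2) ω) (fun ε hε r hr => ?_)
    fun ε hε _ r hr ω hG s hs τ hτ => ?_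
  · have hc : 0 ≤ c₀ / ε ^ 2 := by positivity
    exact hprob (historyFiltration μ hμ.measurable hc) ε _ _ hε
      ((hL₀ ε hε.1 hc (ε ^ α)).mono ((le_max_left _ _).trans (le_max_right _ _)))
      ((hL₁ ε hε.1 hc (ε ^ α)).mono ((le_max_right _ _).trans (le_max_right _ _))) r hr
  · exact hdet _ _ _ α c₀ ε s (A * r) _ (hsm ω) hα hε hs
      (one_le_mul_of_one_le_of_one_le hA hr)
      (isTravelTimeShift_travelTimeShift hμ α 2 c₀ ε s ω) hG τ hτ

theorem splitsWithRate_rapidShift [IsProbabilityMeasure P] (hμ : IsRandomMedium P μ)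
    {c₀ S T β : ℝ} (hc₀ : 0 < c₀) (hS : 0 < S) (hT : 0 < T) (hβ : β ∈ Icc (0 : ℝ) 1)
    (h0 : MixesInTime P μ μ) (h1 : MixesInTime P μ (partialZ μ)) :
    SplitsWithRate P c₀ S T β (fun ε τ s ω => travelTimeShift μ 2 β c₀ ε τ s ω)
      fun ε τ ω => rapidShift μ β c₀ ε τ ω := by
  obtain ⟨K, hK, hsm⟩ := hμ.exists_isBoundedSmooth
  -- mixing in time is mixing in range of the field with time and range exchanged
  set ν : ℝ → ℝ → Ω → ℝ := fun z t => μ t z with hν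
  set ν' : ℝ → ℝ → Ω → ℝ := fun z t => partialZ μ t z with hν'
  have g0 : MixesInRange P ν ν := by
    obtain ⟨C, d, hd, h⟩ := h0
    exact ⟨C, d, hd, fun t z => h z t⟩
  have g1 : MixesInRange P ν ν' := by
    obtain ⟨C, d, hd, h⟩ := h1
    exact ⟨C, d, hd, fun t z => h z t⟩
  have hνm : ∀ z t, Measurable (ν z t) := fun z t => hμ.measurable t z
  have hdiff : ∀ t z ω, DifferentiableAt ℝ (fun z => ν z t ω) z := fun t z ω =>
    (hasDerivAt_snd_fderiv (hμ.contDiff ω) t z).differentiableAt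
  obtain ⟨L₀, hL₀⟩ := g0.exists_isMixing hνm hνm
    (fun z t ht => measurable_rangeHistory ν z ht)
    (fun ω => (hsm ω).continuous.comp continuous_swap)
    (fun z t ω => (hsm ω).bound t z) one_pos
  obtain ⟨L₁, hL₁⟩ := g1.exists_isMixing hνm
    (fun z t => measurable_deriv_rangeHistory (fun z => hνm z t) (hdiff t) z)
    (fun z t ht => measurable_deriv_rangeHistory (fun z => measurable_rangeHistory ν z ht)
      (hdiff t) z) (fun ω => (hsm ω).continuous_z.comp continuous_swap)
    (fun z t ω => (hsm ω).bound_z t z) one_pos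
  set L : ℝ := max 0 (max L₀ (|-c₀| * L₁)) with hL
  obtain ⟨A, hA, hprob⟩ := exists_measure_not_hasIntegralBounds_le P (K := L) (T := 2 * T + S)
    (le_max_left _ _) (by positivity)
  obtain ⟨B, hB, hdet⟩ := exists_rapid_shift_bounds hK hT.le hS.le hc₀
  refine splitsWithRate_of_events hc₀ hβ
    (fun ε hε τ hτ s _ ω => hasDerivAt_travelTimeShift hμ hK (hsm ω) le_rfl hε hτ.1 s) hA hB
    (ε₀ := 1 / (2 * K)) (by positivity)
    (G := fun ε r ω => HasIntegralBounds ε (2 * T + S) (A * r)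
      (fun u => μ (u / ε ^ 2) (c₀ * u / ε ^ β) ω)
      fun u => -c₀ * partialZ μ (u / ε ^ 2) (c₀ * u / ε ^ β) ω) (fun ε hε r hr => ?_)
    fun ε hε hle r hr ω hG s hs τ hτ => ?_
  · have hε0 := hε.1
    have hc : 0 ≤ 1 / ε ^ 2 := by positivity
    have hz : ∀ u, u / (ε ^ β / c₀) = c₀ * u / ε ^ β := fun u => by
      rw [div_div_eq_mul_div, mul_comm]
    have m0 := hL₀ ε hε0 hc (ε ^ β / c₀)
    have m1 := (hL₁ ε hε0 hc (ε ^ β / c₀)).const_mul (-c₀)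
    simp only [hz, one_mul] at m0 m1
    exact hprob (historyFiltration ν hνm hc) ε _ _ hε
      (m0.mono ((le_max_left _ _).trans (le_max_right _ _)))
      (m1.mono ((le_max_right _ _).trans (le_max_right _ _))) r hr
  · have hεK : ε * K ≤ 1 / 2 := by
      rw [le_div_iff₀ (by positivity)] at hle
      linarith
    exact hdet _ _ _ β ε s (A * r) _ (hsm ω) hβ hε hεK hs
      (one_le_mul_of_one_le_of_one_le hA hr)
      (isTravelTimeShift_travelTimeShift hμ 2 β c₀ ε s ω) hG τ hτ

end Medium

end WaveFront


theorem lemma1 {Ω : Type*} [MeasurableSpace Ω] (P : Measure Ω) [IsProbabilityMeasure P]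
    (μ : ℝ → ℝ → Ω → ℝ) (hμ : WaveFront.IsRandomMedium P μ)
    (c₀ S T : ℝ) (hc₀ : 0 < c₀) (hS : 0 < S) (hT : 0 < T) :
    (∀ α ∈ Icc (0 : ℝ) 1,
      WaveFront.MixesInRange P μ μ → WaveFront.MixesInRange P μ (WaveFront.partialT μ) →
      WaveFront.SplitsWithRate P c₀ S T α
        (fun ε τ s ω => WaveFront.travelTimeShift μ α 2 c₀ ε τ s ω)
        (fun ε τ ω => WaveFront.slowShift μ α c₀ ε τ ω)) ∧
    (∀ β ∈ Icc (0 : ℝ) 1,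
      WaveFront.MixesInTime P μ μ → WaveFront.MixesInTime P μ (WaveFront.partialZ μ) →
      WaveFront.SplitsWithRate P c₀ S T β
        (fun ε τ s ω => WaveFront.travelTimeShift μ 2 β c₀ ε τ s ω)
        (fun ε τ ω => WaveFront.rapidShift μ β c₀ ε τ ω)) :=
  ⟨fun _ hα h0 h1 => WaveFront.splitsWithRate_slowShift hμ hc₀ hS hT hα h0 h1,
    fun _ hβ h0 h1 => WaveFront.splitsWithRate_rapidShift hμ hc₀ hS hT hβ h0 h1⟩
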